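/- Lemma 2.1. Let $H$ and $K$ be complex Hilbert spaces, let $M\subseteq B(H)$ and $S\subseteq B(K)$ be von Neumann algebras, and let $M\overline\otimes S\subseteq B(H\otimes_2 K)$ be the von Neumann algebra generated by the operators $m\otimes s$, $m\in M$, $s\in S$. Suppose that $S$ is hyperfinite (the ultraweak closure of the union of an upwards directed family of finite-dimensional $*$-subalgebras), and that $S$ has no nonzero direct summand of type $\mathrm{I}_n$ with $n$ finite; this holds in particular if $S$ is of type $\mathrm{II}_1$. Let $\phi\colon M\overline\otimes S\to B(H\otimes_2 K)$ be a bounded linear map that is normal (ultraweakly continuous) and $(I\otimes S)$-modular, that is, $\phi((I\otimes s)x)=(I\otimes s)\phi(x)$ and $\phi(x(I\otimes s))=\phi(x)(I\otimes s)$ for all $s\in S$ and $x\in M\overline\otimes S$. Then $\phi$ is completely bounded: there is a constant $C$ such that for every $n$ and every $(x_{ij})\in \mathbb M_n(M\overline\otimes S)$, $\|(\phi(x_{ij}))\|\le C\,\|(x_{ij})\|$. -/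

import Mathlib

open scoped TensorProduct

noncomputable section

/-- The Hilbert space tensor product `H ⊗₂ K`: the completion of the algebraic tensor product with
respect to the inner product `⟪a ⊗ b, c ⊗ d⟫ = ⟪a, c⟫ ⟪b, d⟫`. -/
abbrev HilbertTensor (H K : Type*)
    [NormedAddCommGroup H] [InnerProductSpace ℂ H]
    [NormedAddCommGroup K] [InnerProductSpace ℂ K] : Type _ :=
  UniformSpace.Completion (H ⊗[ℂ] K)

/-- The operator `a ⊗ b` on `H ⊗₂ K`, the continuous extension of `ξ ⊗ η ↦ a ξ ⊗ b η`. -/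
def opTensor {H K : Type*}
    [NormedAddCommGroup H] [InnerProductSpace ℂ H]
    [NormedAddCommGroup K] [InnerProductSpace ℂ K]
    (a : H →L[ℂ] H) (b : K →L[ℂ] K) : HilbertTensor H K →L[ℂ] HilbertTensor H K :=
  (TensorProduct.mapL a b).completion

/-- The von Neumann algebra generated by a set `s` of operators: the double commutant of
`s ∪ star s` (the commutant of `s` taken by `StarSubalgebra.centralizer` is that of
`s ∪ star s`). -/
def generatedVonNeumannAlgebra {L : Type*}
    [NormedAddCommGroup L] [InnerProductSpace ℂ L] [CompleteSpace L]
    (s : Set (L →L[ℂ] L)) : VonNeumannAlgebra L where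
  toStarSubalgebra :=
    StarSubalgebra.centralizer ℂ (StarSubalgebra.centralizer ℂ s : Set (L →L[ℂ] L))
  centralizer_centralizer' := by
    simp

theorem subset_generatedVonNeumannAlgebra {L : Type*}
    [NormedAddCommGroup L] [InnerProductSpace ℂ L] [CompleteSpace L]
    (s : Set (L →L[ℂ] L)) :
    s ⊆ ((generatedVonNeumannAlgebra s).toStarSubalgebra : Set (L →L[ℂ] L)) := by
  intro x hx
  have h := StarSubalgebra.coe_centralizer_centralizer (R := ℂ) s
  have hx' : x ∈ (s ∪ star s).centralizer.centralizer :=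
    Set.subset_centralizer_centralizer (Or.inl hx)
  rw [← h] at hx'
  exact hx'

/-- The von Neumann algebra tensor product `M ⊗̄ S` acting on `H ⊗₂ K`: the von Neumann algebra
generated by the operators `m ⊗ s`, `m ∈ M`, `s ∈ S`. -/
def vonNeumannTensor {H K : Type*}
    [NormedAddCommGroup H] [InnerProductSpace ℂ H] [CompleteSpace H]
    [NormedAddCommGroup K] [InnerProductSpace ℂ K] [CompleteSpace K]
    (M : VonNeumannAlgebra H) (S : VonNeumannAlgebra K) :
    VonNeumannAlgebra (HilbertTensor H K) :=
  generatedVonNeumannAlgebra {x | ∃ m ∈ M, ∃ s ∈ S, x = opTensor m s}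

/-- The ultraweak (σ-weak) topology on `B(L)`: the coarsest topology that makes the functionals
`x ↦ ∑ₙ ⟪ηₙ, x ξₙ⟫` continuous, for all square-summable sequences `ξ`, `η` in `L`. -/
abbrev ultraweakTopology (L : Type*)
    [NormedAddCommGroup L] [InnerProductSpace ℂ L] :
    TopologicalSpace (L →L[ℂ] L) :=
  ⨅ (ξ : lp (fun _ : ℕ => L) 2) (η : lp (fun _ : ℕ => L) 2),
    TopologicalSpace.induced (fun x : L →L[ℂ] L => ∑' n, inner ℂ (η n) (x (ξ n))) inferInstance

/-- A von Neumann algebra is hyperfinite if it is the ultraweak closure of the union of an upwards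
directed family of finite-dimensional `*`-subalgebras. -/
def IsHyperfinite {K : Type*}
    [NormedAddCommGroup K] [InnerProductSpace ℂ K] [CompleteSpace K]
    (S : VonNeumannAlgebra K) : Prop :=
  ∃ 𝓕 : Set (StarSubalgebra ℂ (K →L[ℂ] K)),
    𝓕.Nonempty ∧ DirectedOn (· ≤ ·) 𝓕 ∧ (∀ F ∈ 𝓕, FiniteDimensional ℂ F) ∧
      @closure _ (ultraweakTopology K) (⋃ F ∈ 𝓕, (F : Set (K →L[ℂ] K))) = (S : Set (K →L[ℂ] K))

/-- `p` is an abelian projection of `S`: a projection in `S` such that `p S p` is commutative. -/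
def IsAbelianProjection {K : Type*}
    [NormedAddCommGroup K] [InnerProductSpace ℂ K] [CompleteSpace K]
    (S : VonNeumannAlgebra K) (p : K →L[ℂ] K) : Prop :=
  p ∈ S ∧ IsStarProjection p ∧
    ∀ a ∈ S, ∀ b ∈ S, (p * a * p) * (p * b * p) = (p * b * p) * (p * a * p)

/-- Murray-von Neumann equivalence of the projections `p` and `q` in `S`. -/
def MurrayVonNeumannEquiv {K : Type*}
    [NormedAddCommGroup K] [InnerProductSpace ℂ K] [CompleteSpace K]
    (S : VonNeumannAlgebra K) (p q : K →L[ℂ] K) : Prop :=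
  ∃ v ∈ S, star v * v = p ∧ v * star v = q

/-- `S z` is a direct summand of `S` of type `Iₙ`: the operator `z` is a central projection of `S`
and is the sum of `n` mutually orthogonal, equivalent, abelian projections of `S`.
(Degenerate case: `z = 0`.) -/
def IsTypeISummand {K : Type*}
    [NormedAddCommGroup K] [InnerProductSpace ℂ K] [CompleteSpace K]
    (S : VonNeumannAlgebra K) (n : ℕ) (z : K →L[ℂ] K) : Prop :=
  z ∈ S ∧ z ∈ S.commutant ∧ ∃ p : Fin n → (K →L[ℂ] K),
    (∀ i, IsAbelianProjection S (p i)) ∧ (∀ i j, i ≠ j → p i * p j = 0) ∧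
      (∀ i j, MurrayVonNeumannEquiv S (p i) (p j)) ∧ z = ∑ i, p i

/-- `S` has no nonzero direct summand of type `Iₙ` with `n` finite. Every von Neumann algebra of
type II₁ has this property, since it has no nonzero abelian projection at all. -/
def HasNoFiniteTypeISummand {K : Type*}
    [NormedAddCommGroup K] [InnerProductSpace ℂ K] [CompleteSpace K]
    (S : VonNeumannAlgebra K) : Prop :=
  ∀ (n : ℕ) (z : K →L[ℂ] K), IsTypeISummand S n z → z = 0

/-- A map from a von Neumann algebra `N` on `L` into `B(L)` is normal if it is continuous for the
ultraweak topologies. -/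
def IsNormalMap {L : Type*}
    [NormedAddCommGroup L] [InnerProductSpace ℂ L] [CompleteSpace L]
    {N : VonNeumannAlgebra L} (φ : N.toStarSubalgebra → (L →L[ℂ] L)) : Prop :=
  @Continuous _ _
    (TopologicalSpace.induced (fun x : N.toStarSubalgebra => (x : L →L[ℂ] L))
      (ultraweakTopology L))
    (ultraweakTopology L) φ

/-- The element `I ⊗ s` of `M ⊗̄ S`. -/
def oneTensor {H K : Type*}
    [NormedAddCommGroup H] [InnerProductSpace ℂ H] [CompleteSpace H]
    [NormedAddCommGroup K] [InnerProductSpace ℂ K] [CompleteSpace K]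
    (M : VonNeumannAlgebra H) {S : VonNeumannAlgebra K} (s : K →L[ℂ] K) (hs : s ∈ S) :
    (vonNeumannTensor M S).toStarSubalgebra :=
  ⟨opTensor 1 s, subset_generatedVonNeumannAlgebra _ ⟨1, one_mem M, s, hs, rfl⟩⟩

/-- `φ : M ⊗̄ S → B(H ⊗₂ K)` is `(I ⊗ S)`-modular: `φ((I ⊗ s) x) = (I ⊗ s) φ(x)` and
`φ(x (I ⊗ s)) = φ(x) (I ⊗ s)` for all `s ∈ S` and `x ∈ M ⊗̄ S`. -/
def IsModularMap {H K : Type*}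
    [NormedAddCommGroup H] [InnerProductSpace ℂ H] [CompleteSpace H]
    [NormedAddCommGroup K] [InnerProductSpace ℂ K] [CompleteSpace K]
    {M : VonNeumannAlgebra H} {S : VonNeumannAlgebra K}
    (φ : (vonNeumannTensor M S).toStarSubalgebra →
      (HilbertTensor H K →L[ℂ] HilbertTensor H K)) : Prop :=
  ∀ (s : K →L[ℂ] K) (hs : s ∈ S) (x : (vonNeumannTensor M S).toStarSubalgebra),
    φ (oneTensor M s hs * x) = opTensor 1 s * φ x ∧
      φ (x * oneTensor M s hs) = φ x * opTensor 1 s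

/-- `φ : N → B(L)` is completely bounded: its amplifications `φₙ : 𝕄ₙ(N) → 𝕄ₙ(B(L))`, which apply
`φ` to every entry, are bounded uniformly in `n`. The norm on `𝕄ₙ(N) ⊆ 𝕄ₙ(B(L))` is the
C⋆-norm. -/
def IsCompletelyBounded {L : Type*}
    [NormedAddCommGroup L] [InnerProductSpace ℂ L] [CompleteSpace L]
    {N : VonNeumannAlgebra L} (φ : N.toStarSubalgebra → (L →L[ℂ] L)) : Prop :=
  ∃ C : ℝ, ∀ (n : ℕ) (X : Matrix (Fin n) (Fin n) N.toStarSubalgebra),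
    ‖CStarMatrix.ofMatrix (X.map φ)‖ ≤
      C * ‖CStarMatrix.ofMatrix (X.map fun x => (x : L →L[ℂ] L))‖

end

noncomputable section

/-! ### Range projections and central supports -/

namespace VonNeumannAlgebra

variable {K : Type*} [NormedAddCommGroup K] [InnerProductSpace ℂ K] [CompleteSpace K]

/-! For a single n, an n × n matrix over the algebra can be moved into the algebra itself when `S`
contains partial isometries `uᵢ` with `uᵢ* uⱼ = δᵢⱼ p`: put `b = ∑ uₖ xₖₗ uₗ*`. Then `‖b‖ ≤
‖(xₖₗ)‖`, and modularity gives `p φ(xₖₗ) p = uₖ* φ(b) uₗ` (with `s` written for `I ⊗ s`), so the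
compression of `(φ(xₖₗ))` by `p` is bounded by `‖φ‖ ‖(xₖₗ)‖` whatever n is (`norm_compression_le`).
It remains to remove the compression.

The hypothesis on type splits `S` by a central projection `z` (`exists_central_decomposition`). The
summand `S z` contains two isometries with orthogonal ranges, hence n of them, and `p = z` serves.
The summand `S (1 - z)` has no nonzero abelian projection, so `1 - z` can be cut into arbitrarily
many equivalent pieces, but then `p` is only one small piece. Here hyperfiniteness enters. Suppose
that the entries `xₖₗ` commute with `T = F' ∩ S`, where `F` is one of the finite-dimensional
algebras. By modularity the `φ(xₖₗ)` commute with `T` as well. Passing from `S` to `T` creates no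
abelian projections below `1 - z` (`eq_zero_of_isAbelianProjection_relativeCommutant`), so the
pieces and the partial isometries between them can be chosen in `T`. A matrix that commutes with
these is, below `1 - z`, a direct sum of copies of its corner, so the compression loses no norm
(`norm_mul_le_of_commute`). Adding the two summands gives the bound `2 ‖φ‖`, for every n and every
`F`.

The elements that commute with `F' ∩ S` for some `F` form a *-algebra `A` (`locallyCommuting`), by
directedness. It contains `M ⊗ 1` and `1 ⊗ F` for all `F`, so its bicommutant contains `M ⊗̄ S`.
Kaplansky's density theorem for matrices over `A` supplies bounded strong approximants to
selfadjoint matrices; bounded strong convergence is ultraweak, and normality carries the estimate to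
all matrices. -/

theorem smul_mem' (S : VonNeumannAlgebra K) (c : ℂ) {x : K →L[ℂ] K} (hx : x ∈ S) : c • x ∈ S :=
  S.toStarSubalgebra.smul_mem hx c

theorem mem_of_commute (S : VonNeumannAlgebra K) {x : K →L[ℂ] K}
    (h : ∀ y ∈ S.commutant, y * x = x * y) : x ∈ S := by
  rw [← S.commutant_commutant, mem_commutant_iff]
  exact h

theorem commute_of_mem_commutant {S : VonNeumannAlgebra K} {x y : K →L[ℂ] K}
    (hx : x ∈ S) (hy : y ∈ S.commutant) : x * y = y * x :=
  mem_commutant_iff.1 hy x hx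

theorem starProjection_mem (S : VonNeumannAlgebra K) (U : Submodule ℂ K)
    [U.HasOrthogonalProjection]
    (h : ∀ y ∈ S.commutant, ∀ x ∈ U, y x ∈ U) : U.starProjection ∈ S := by
  rw [VonNeumannAlgebra.IsStarProjection.mem_iff isStarProjection_starProjection]
  intro y hy
  rw [Submodule.range_starProjection]
  exact h y hy

/-- The range projection of an element of a von Neumann algebra. -/
theorem exists_rangeProjection (S : VonNeumannAlgebra K) {a : K →L[ℂ] K} (ha : a ∈ S) :
    ∃ p ∈ S, IsStarProjection p ∧ p * a = a ∧ ∀ b : K →L[ℂ] K, b * a = 0 → b * p = 0 := by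
  set U := (LinearMap.range (a : K →ₗ[ℂ] K)).topologicalClosure with hU
  have hUc : IsClosed (U : Set K) := Submodule.isClosed_topologicalClosure _
  have : CompleteSpace U := hUc.completeSpace_coe
  have key : ∀ b c : K →L[ℂ] K, ∀ V : Submodule ℂ K, IsClosed (V : Set K) →
      (∀ x, b (a x) ∈ V) → ∀ x ∈ U, b x ∈ V := by
    intro b c V hV h x hx
    have h1 : U ≤ V.comap (b : K →ₗ[ℂ] K) := by
      apply Submodule.topologicalClosure_minimal
      · rintro _ ⟨x, rfl⟩
        exact h x
      · exact hV.preimage b.continuous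
    exact h1 hx
  refine ⟨U.starProjection, S.starProjection_mem U ?_, isStarProjection_starProjection, ?_, ?_⟩
  · intro y hy
    refine key y 0 U hUc fun x => ?_
    have : y (a x) = a (y x) := by
      have := commute_of_mem_commutant ha hy
      exact (congrArg (fun f : K →L[ℂ] K => f x) this).symm
    rw [this]
    exact Submodule.le_topologicalClosure _ ⟨y x, rfl⟩
  · ext x
    exact Submodule.starProjection_eq_self_iff.2 (Submodule.le_topologicalClosure _ ⟨x, rfl⟩)
  · intro b hb
    ext x
    have := key b 0 ⊥ (by simp) (fun x => by
      simpa using congrArg (fun f : K →L[ℂ] K => f x) hb) (U.starProjection x)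
      (Submodule.starProjection_apply_mem _ _)
    simpa using this

/-- The central support of an element of a von Neumann algebra. -/
theorem exists_centralSupport (S : VonNeumannAlgebra K) {e : K →L[ℂ] K} (he : e ∈ S) :
    ∃ c ∈ S, c ∈ S.commutant ∧ IsStarProjection c ∧ c * e = e ∧
      ∀ f : K →L[ℂ] K, (∀ a ∈ S, f * a * e = 0) → f * c = 0 := by
  set X : Set K := {x | ∃ a ∈ S, ∃ y, x = a (e y)} with hX
  set U := (Submodule.span ℂ X).topologicalClosure with hU
  have hUc : IsClosed (U : Set K) := Submodule.isClosed_topologicalClosure _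
  have : CompleteSpace U := hUc.completeSpace_coe
  have key : ∀ b : K →L[ℂ] K, ∀ V : Submodule ℂ K, IsClosed (V : Set K) →
      (∀ a ∈ S, ∀ x, b (a (e x)) ∈ V) → ∀ x ∈ U, b x ∈ V := by
    intro b V hV h x hx
    have h1 : U ≤ V.comap (b : K →ₗ[ℂ] K) := by
      apply Submodule.topologicalClosure_minimal
      · rw [Submodule.span_le]
        rintro _ ⟨a, ha, x, rfl⟩
        exact h a ha x
      · exact hV.preimage b.continuous
    exact h1 hx
  have hmem : ∀ a ∈ S, ∀ y, a (e y) ∈ U := fun a ha y =>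
    Submodule.le_topologicalClosure _ (Submodule.subset_span ⟨a, ha, y, rfl⟩)
  refine ⟨U.starProjection, S.starProjection_mem U ?_, S.commutant.starProjection_mem U ?_,
    isStarProjection_starProjection, ?_, ?_⟩
  · intro y hy
    refine key y U hUc fun a ha x => ?_
    have : y (a (e x)) = a (e (y x)) := by
      have := commute_of_mem_commutant (mul_mem ha he) hy
      exact (congrArg (fun f : K →L[ℂ] K => f x) this).symm
    rw [this]
    exact hmem a ha _
  · intro y hy
    rw [commutant_commutant] at hy
    exact key y U hUc fun a ha x => hmem (y * a) (mul_mem hy ha) x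
  · ext x
    exact Submodule.starProjection_eq_self_iff.2 (hmem 1 (one_mem S) x)
  · intro b hb
    ext x
    have := key b ⊥ (by simp) (fun a ha x => by
      simpa using congrArg (fun f : K →L[ℂ] K => f x) (hb a ha)) (U.starProjection x)
      (Submodule.starProjection_apply_mem _ _)
    simpa using this

end VonNeumannAlgebra

/-! ### Polar decomposition -/

section
variable {K : Type*} [NormedAddCommGroup K] [InnerProductSpace ℂ K] [CompleteSpace K]

theorem norm_cfcAbs_apply (a : K →L[ℂ] K) (x : K) : ‖CFC.abs a x‖ = ‖a x‖ := by
  have h1 : ∀ b : K →L[ℂ] K, ‖b x‖ ^ 2 = RCLike.re (inner ℂ ((star b * b) x) x) := by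
    intro b
    rw [ContinuousLinearMap.star_eq_adjoint]
    exact ContinuousLinearMap.apply_norm_sq_eq_inner_adjoint_left b x
  have h2 : star (CFC.abs a) * CFC.abs a = star a * a := by
    rw [(IsSelfAdjoint.of_nonneg (CFC.abs_nonneg a)).star_eq, CFC.abs_mul_abs]
  have h3 : ‖CFC.abs a x‖ ^ 2 = ‖a x‖ ^ 2 := by rw [h1, h1, h2]
  exact (sq_eq_sq₀ (norm_nonneg _) (norm_nonneg _)).1 h3

theorem cfcAbs_mul_eq_zero {a b : K →L[ℂ] K} : CFC.abs a * b = 0 ↔ a * b = 0 := by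
  constructor <;> intro h <;> ext x <;> have h' := congrArg (fun f : K →L[ℂ] K => f x) h <;>
    simp only [mul_apply_eq_comp, zero_apply] at h' ⊢
  · rw [← norm_eq_zero, ← norm_cfcAbs_apply, h', norm_zero]
  · rw [← norm_eq_zero, norm_cfcAbs_apply, h', norm_zero]

namespace VonNeumannAlgebra

/-- The phase of an element of a von Neumann algebra: the partial isometry of its polar
decomposition. -/
theorem exists_phase (S : VonNeumannAlgebra K) {a : K →L[ℂ] K} (ha : a ∈ S) :
    ∃ w ∈ S, w * CFC.abs a = a ∧ w * star w * w = w ∧ (∀ b, a * b = 0 → w * b = 0) ∧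
      ∀ b, b * a = 0 → b * w = 0 := by
  set h := CFC.abs a with hh
  have hsa : star h = h := (IsSelfAdjoint.of_nonneg (CFC.abs_nonneg a)).star_eq
  set U := (LinearMap.range (h : K →ₗ[ℂ] K)).topologicalClosure with hU
  have hUc : IsClosed (U : Set K) := Submodule.isClosed_topologicalClosure _
  have : CompleteSpace U := hUc.completeSpace_coe
  have hmem : ∀ x, h x ∈ U := fun x => Submodule.le_topologicalClosure _ ⟨x, rfl⟩
  let e : K →ₗ[ℂ] U := LinearMap.codRestrict U (h : K →ₗ[ℂ] K) hmem
  have hd : DenseRange e := by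
    rintro ⟨x, hx⟩
    rw [closure_subtype]
    have himg : Subtype.val '' Set.range e = Set.range h := by
      rw [← Set.range_comp]
      rfl
    rw [himg]
    exact hx
  have hn : ∀ x, ‖(a : K →ₗ[ℂ] K) x‖ = ‖e x‖ := fun x => (norm_cfcAbs_apply a x).symm
  -- The map `|a| x ↦ a x` is isometric, so it extends to the closed range of `|a|`; `w` is this
  -- extension, set to zero on the orthogonal complement.
  let u : U →L[ℂ] K := (a : K →ₗ[ℂ] K).extendOfNorm e
  have hu : ∀ x, u (e x) = a x :=
    LinearMap.extendOfNorm_eq hd ⟨1, fun x => by rw [hn, one_mul]⟩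
  have hiso : ∀ x : U, ‖u x‖ = ‖x‖ := by
    intro x
    refine hd.induction_on (p := fun x => ‖u x‖ = ‖x‖) x
      (isClosed_eq u.continuous.norm continuous_norm) fun y => ?_
    rw [hu]
    exact hn y
  let w : K →L[ℂ] K := u ∘L U.orthogonalProjectionOnto
  have hwh : w * h = a := by
    ext x
    have : U.orthogonalProjectionOnto (h x) = e x :=
      Submodule.orthogonalProjectionOnto_mem_subspace_eq_self (e x)
    change u (U.orthogonalProjectionOnto (h x)) = a x
    rw [this, hu]
  have hww : star w * w = U.starProjection := by
    rw [ContinuousLinearMap.star_eq_adjoint]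
    apply ContinuousLinearMap.coe_injective
    rw [← ext_inner_map]
    intro x
    have h1 : inner ℂ ((ContinuousLinearMap.adjoint w * w) x) x = ((‖w x‖ ^ 2 : ℝ) : ℂ) := by
      rw [mul_apply_eq_comp, ContinuousLinearMap.adjoint_inner_left,
        inner_self_eq_norm_sq_to_K]
      push_cast
      rfl
    have h2 : ‖w x‖ = ‖U.starProjection x‖ := hiso _
    have h3 : inner ℂ (U.starProjection x) x = ((‖U.starProjection x‖ ^ 2 : ℝ) : ℂ) := by
      conv_lhs => rw [← U.isIdempotentElem_starProjection.eq, mul_apply_eq_comp,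
        Submodule.inner_starProjection_left_eq_right]
      rw [inner_self_eq_norm_sq_to_K]
      push_cast
      rfl
    exact h1.trans ((by rw [h2] : _ = _).trans h3.symm)
  have hwP : w * U.starProjection = w := by
    ext x
    change u (U.orthogonalProjectionOnto (U.starProjection x)) = u (U.orthogonalProjectionOnto x)
    congr 1
    exact Submodule.orthogonalProjectionOnto_mem_subspace_eq_self (U.orthogonalProjectionOnto x)
  have hright : ∀ b, a * b = 0 → w * b = 0 := by
    intro b hb
    have hb' := cfcAbs_mul_eq_zero.2 hb
    ext x
    have : U.orthogonalProjectionOnto (b x) = 0 := by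
      rw [Submodule.orthogonalProjectionOnto_eq_zero_iff, hU,
        Submodule.orthogonal_closure, Submodule.mem_orthogonal]
      rintro _ ⟨y, rfl⟩
      change inner ℂ (h y) (b x) = 0
      rw [← hsa, ContinuousLinearMap.star_eq_adjoint, ContinuousLinearMap.adjoint_inner_left]
      have := congrArg (fun f : K →L[ℂ] K => f x) hb'
      simp only [mul_apply_eq_comp, zero_apply] at this
      rw [this, inner_zero_right]
    change u (U.orthogonalProjectionOnto (b x)) = 0
    rw [this, map_zero]
  have hU0 : ∀ b : K →L[ℂ] K, b * h = 0 → b * U.starProjection = 0 := by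
    intro b hb
    have h1 : U ≤ LinearMap.ker (b : K →ₗ[ℂ] K) := by
      apply Submodule.topologicalClosure_minimal
      · rintro _ ⟨x, rfl⟩
        exact congrArg (fun f : K →L[ℂ] K => f x) hb
      · exact b.isClosed_ker
    ext x
    exact h1 (Submodule.starProjection_apply_mem _ _)
  refine ⟨w, S.mem_of_commute fun y hy => ?_, hwh, ?_, hright, ?_⟩
  · have hya : a * y = y * a := commute_of_mem_commutant ha hy
    have hya' : a * star y = star y * a := commute_of_mem_commutant ha (star_mem hy)
    have hyh : h * y = y * h := by
      refine (Commute.cfcAbs_left (a := a) (b := y) hya ?_).eq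
      exact hya'
    -- Commutation with `y` is tested on the closed range of `|a|`, where it follows from that of
    -- `a` and `|a|`, and on the complement, which `y` maps into the kernel of `w`.
    have h1 : (w * y - y * w) * U.starProjection = 0 := by
      apply hU0
      rw [sub_mul, mul_assoc, ← hyh, ← mul_assoc, hwh, mul_assoc, hwh, hya, sub_self]
    have h2 : w * (y * (1 - U.starProjection)) = 0 := by
      apply hright
      rw [← cfcAbs_mul_eq_zero, ← mul_assoc, ← hh, hyh, mul_assoc]
      have : h * (1 - U.starProjection) = 0 := by
        have h3 : U.starProjection * h = h := by
          ext x
          exact Submodule.starProjection_eq_self_iff.2 (hmem x)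
        have h4 := congrArg star h3
        rw [star_mul, hsa, isStarProjection_starProjection.isSelfAdjoint.star_eq] at h4
        rw [mul_sub, mul_one, h4, sub_self]
      rw [this, mul_zero]
    rw [sub_mul, mul_assoc, mul_assoc, hwP, sub_eq_zero] at h1
    rw [mul_sub, mul_one, mul_sub, sub_eq_zero] at h2
    rw [h2, h1]
  · rw [mul_assoc, hww, hwP]
  · intro b hb
    have : b * w * U.starProjection = 0 := hU0 _ (by rw [mul_assoc, hwh, hb])
    rwa [mul_assoc, hwP] at this

end VonNeumannAlgebra
end

/-! ### Maximal families and orthogonal sums of partial isometries -/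

/-- Zorn's lemma, in the form that all exhaustion arguments below use: a compatible `y` already
belongs to `X`, so whatever holds for the members of `X` holds for `y` itself and forces it to
vanish. -/
theorem exists_maximal_pairwise {α : Type*} (P : α → Prop) (r : α → α → Prop) :
    ∃ X : Set α, (∀ x ∈ X, P x) ∧ X.Pairwise r ∧
      ∀ y, P y → (∀ x ∈ X, r x y ∧ r y x) → y ∈ X := by
  obtain ⟨X, hX⟩ := zorn_subset {X : Set α | (∀ x ∈ X, P x) ∧ X.Pairwise r} (by
    intro c hc hchain
    refine ⟨⋃₀ c, ⟨?_, ?_⟩, fun s hs => Set.subset_sUnion_of_mem hs⟩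
    · rintro x ⟨s, hs, hx⟩
      exact (hc hs).1 x hx
    · rw [Set.pairwise_sUnion hchain.directedOn]
      exact fun s hs => (hc hs).2)
  refine ⟨X, hX.prop.1, hX.prop.2, fun y hy hr => ?_⟩
  have h1 : insert y X ∈ {X : Set α | (∀ x ∈ X, P x) ∧ X.Pairwise r} := by
    refine ⟨?_, ?_⟩
    · rintro x (rfl | hx)
      · exact hy
      · exact hX.prop.1 x hx
    · rw [Set.pairwise_insert]
      exact ⟨hX.prop.2, fun x hx _ => ⟨(hr x hx).2, (hr x hx).1⟩⟩
  exact hX.le_of_ge h1 (Set.subset_insert y X) (Set.mem_insert y X)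

section
variable {K : Type*} [NormedAddCommGroup K] [InnerProductSpace ℂ K] [CompleteSpace K]

/-- `V` is the strong sum of the pairwise orthogonal family of partial isometries `v`. -/
structure IsOrthogonalSum {ι : Type*} (v : ι → K →L[ℂ] K) (V : K →L[ℂ] K) : Prop where
  comm : ∀ b c : K →L[ℂ] K, (∀ i, b * v i = v i * c) → b * V = V * c
  star_mul : ∀ j, star (v j) * V = star (v j) * v j
  mul_star : ∀ j, V * star (v j) = v j * star (v j)

namespace IsOrthogonalSum

variable {ι : Type*} {v : ι → K →L[ℂ] K} {V : K →L[ℂ] K}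

theorem mul_eq_zero (h : IsOrthogonalSum v V) {b : K →L[ℂ] K} (hb : ∀ i, b * v i = 0) :
    b * V = 0 := by
  rw [h.comm b 0 (by simpa using hb), mul_zero]

theorem mul_eq_zero' (h : IsOrthogonalSum v V) {b : K →L[ℂ] K} (hb : ∀ i, v i * b = 0) :
    V * b = 0 := by
  rw [← h.comm 0 b (fun i => by rw [zero_mul, hb]), zero_mul]

theorem mul_eq_self (h : IsOrthogonalSum v V) {b : K →L[ℂ] K} (hb : ∀ i, b * v i = v i) :
    b * V = V := by
  rw [h.comm b 1 (by simpa using hb), mul_one]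

theorem mul_eq_self' (h : IsOrthogonalSum v V) {b : K →L[ℂ] K} (hb : ∀ i, v i * b = v i) :
    V * b = V := by
  rw [← h.comm 1 b (fun i => by rw [one_mul, hb]), one_mul]

theorem star_mul' (h : IsOrthogonalSum v V) (j : ι) : star V * v j = star (v j) * v j := by
  simpa using congrArg star (h.star_mul j)

theorem mul_star' (h : IsOrthogonalSum v V) (j : ι) : v j * star V = v j * star (v j) := by
  simpa using congrArg star (h.mul_star j)

theorem mul_star_mul (h : IsOrthogonalSum v V) (hv : ∀ i, v i * star (v i) * v i = v i) :
    V * star V * V = V := by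
  apply h.mul_eq_self
  intro i
  rw [mul_assoc, h.star_mul', ← mul_assoc, h.mul_star, hv]

end IsOrthogonalSum

theorem norm_le_one_of_partialIsometry {w : K →L[ℂ] K} (hw : w * star w * w = w) : ‖w‖ ≤ 1 := by
  have h : ‖star w * w‖ ≤ 1 := by
    apply IsStarProjection.norm_le
    refine ⟨?_, IsSelfAdjoint.star_mul_self w⟩
    rw [IsIdempotentElem, mul_assoc, ← mul_assoc w, hw]
  rw [CStarRing.norm_star_mul_self] at h
  nlinarith [norm_nonneg w]

/-- All cross terms vanish because both the ranges and the initial spaces are orthogonal. This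
bounds every partial sum by one in norm. -/
theorem partialIsometry_finset_sum {ι : Type*} {v : ι → K →L[ℂ] K}
    (hv : ∀ i, v i * star (v i) * v i = v i)
    (h1 : ∀ i j, i ≠ j → star (v i) * v j = 0) (h2 : ∀ i j, i ≠ j → v i * star (v j) = 0)
    (s : Finset ι) :
    (∑ i ∈ s, v i) * star (∑ i ∈ s, v i) * (∑ i ∈ s, v i) = ∑ i ∈ s, v i := by
  classical
  rw [star_sum, Finset.sum_mul_sum, Finset.sum_mul]
  refine Finset.sum_congr rfl fun i hi => ?_
  rw [Finset.sum_eq_single i (fun j _ hj => h2 i j hj.symm) (fun h => absurd hi h),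
    Finset.mul_sum, Finset.sum_eq_single i
      (fun j _ hj => by rw [mul_assoc, h1 i j hj.symm, mul_zero]) (fun h => absurd hi h), hv]

theorem norm_sq_finset_sum_apply {ι : Type*} {v : ι → K →L[ℂ] K}
    (h1 : ∀ i j, i ≠ j → star (v i) * v j = 0) (s : Finset ι) (x : K) :
    ‖∑ i ∈ s, v i x‖ ^ 2 = ∑ i ∈ s, ‖v i x‖ ^ 2 := by
  classical
  have key : ∀ i j, i ≠ j → inner ℂ (v i x) (v j x) = 0 := by
    intro i j hij
    have := congrArg (fun f : K →L[ℂ] K => inner ℂ x (f x)) (h1 i j hij)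
    simpa [ContinuousLinearMap.star_eq_adjoint, ContinuousLinearMap.adjoint_inner_right] using this
  have h : (inner ℂ (∑ i ∈ s, v i x) (∑ i ∈ s, v i x) : ℂ) = ∑ i ∈ s, inner ℂ (v i x) (v i x) := by
    rw [sum_inner]
    refine Finset.sum_congr rfl fun i hi => ?_
    rw [inner_sum, Finset.sum_eq_single i (fun j _ hj => key i j hj.symm) (fun h => absurd hi h)]
  simp only [inner_self_eq_norm_sq_to_K] at h
  exact_mod_cast h

/-- The vectors `vᵢ x` are orthogonal and the partial sums are contractions, so `∑ ‖vᵢ x‖²`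
converges by a Bessel inequality; orthogonality turns this into the Cauchy criterion for `∑ vᵢ x`.
-/
theorem summable_apply_of_orthogonal {ι : Type*} {v : ι → K →L[ℂ] K}
    (hv : ∀ i, v i * star (v i) * v i = v i)
    (h1 : ∀ i j, i ≠ j → star (v i) * v j = 0) (h2 : ∀ i j, i ≠ j → v i * star (v j) = 0)
    (x : K) : Summable fun i => v i x := by
  have hs : Summable fun i => ‖v i x‖ ^ 2 := by
    refine summable_of_sum_le (c := ‖x‖ ^ 2) (fun i => by positivity) fun s => ?_
    rw [← norm_sq_finset_sum_apply h1]
    have := (∑ i ∈ s, v i).le_of_opNorm_le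
      (norm_le_one_of_partialIsometry (partialIsometry_finset_sum hv h1 h2 s)) x
    rw [one_mul, _root_.sum_apply] at this
    gcongr
  rw [summable_iff_vanishing_norm] at hs ⊢
  intro ε hε
  obtain ⟨s, hs⟩ := hs (ε ^ 2) (by positivity)
  refine ⟨s, fun t ht => ?_⟩
  have := hs t ht
  rw [← norm_sq_finset_sum_apply h1, Real.norm_of_nonneg (by positivity)] at this
  exact lt_of_pow_lt_pow_left₀ 2 hε.le this

theorem exists_hasSum_of_orthogonal {ι : Type*} {v : ι → K →L[ℂ] K}
    (hv : ∀ i, v i * star (v i) * v i = v i)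
    (h1 : ∀ i j, i ≠ j → star (v i) * v j = 0) (h2 : ∀ i j, i ≠ j → v i * star (v j) = 0) :
    ∃ V : K →L[ℂ] K, ∀ x, HasSum (fun i => v i x) (V x) := by
  have hsum := summable_apply_of_orthogonal hv h1 h2
  let L : K →ₗ[ℂ] K :=
    { toFun := fun x => ∑' i, v i x
      map_add' := fun x y => by
        simp only [map_add]
        exact (hsum x).tsum_add (hsum y)
      map_smul' := fun c x => by
        simp only [map_smul, RingHom.id_apply]
        exact (hsum x).tsum_const_smul c }
  refine ⟨L.mkContinuous 1 fun x => ?_, fun x => (hsum x).hasSum⟩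
  refine le_of_tendsto (hsum x).hasSum.norm (Filter.Eventually.of_forall fun s => ?_)
  have := (∑ i ∈ s, v i).le_of_opNorm_le
      (norm_le_one_of_partialIsometry (partialIsometry_finset_sum hv h1 h2 s)) x
  rwa [_root_.sum_apply] at this

/-- Intertwining relations pass to strong limits; applied to the commutant they put the sum into
`S`. From here on convergence is never mentioned again: the three fields of `IsOrthogonalSum`
suffice. -/
theorem VonNeumannAlgebra.exists_isOrthogonalSum (S : VonNeumannAlgebra K) {ι : Type*}
    {v : ι → K →L[ℂ] K} (hS : ∀ i, v i ∈ S) (hv : ∀ i, v i * star (v i) * v i = v i)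
    (h1 : ∀ i j, i ≠ j → star (v i) * v j = 0) (h2 : ∀ i j, i ≠ j → v i * star (v j) = 0) :
    ∃ V ∈ S, IsOrthogonalSum v V := by
  obtain ⟨V, hV⟩ := exists_hasSum_of_orthogonal hv h1 h2
  have hcomm : ∀ b c : K →L[ℂ] K, (∀ i, b * v i = v i * c) → b * V = V * c := by
    intro b c hbc
    ext x
    refine HasSum.unique (f := fun i => b (v i x)) ((hV x).mapL b) ?_
    have h3 : (fun i => b (v i x)) = fun i => v i (c x) :=
      funext fun i => congrArg (fun f : K →L[ℂ] K => f x) (hbc i)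
    rw [h3]
    exact hV (c x)
  refine ⟨V, S.mem_of_commute fun y hy => hcomm y y fun i =>
    (commute_of_mem_commutant (hS i) hy).symm, hcomm, fun j => ?_, fun j => ?_⟩
  · ext x
    refine HasSum.unique (f := fun i => star (v j) (v i x)) ((hV x).mapL (star (v j))) ?_
    refine hasSum_single j fun i hi => ?_
    exact congrArg (fun f : K →L[ℂ] K => f x) (h1 j i hi.symm)
  · ext x
    refine HasSum.unique (f := fun i => v i (star (v j) x)) (hV (star (v j) x)) ?_
    refine hasSum_single j fun i hi => ?_
    exact congrArg (fun f : K →L[ℂ] K => f x) (h2 i j hi)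

/-! ### Dyadic spectral approximation and halving of projections -/

theorem VonNeumannAlgebra.cfcₙ_mem (S : VonNeumannAlgebra K) {a : K →L[ℂ] K} (ha : a ∈ S)
    (f : ℝ → ℝ) : cfcₙ f a ∈ S := by
  refine S.mem_of_commute fun y hy => ?_
  have : Commute a y := VonNeumannAlgebra.commute_of_mem_commutant ha hy
  exact (this.cfcₙ_real f).eq.symm

/-- Splitting off a multiple of a spectral projection from a positive element. -/
theorem VonNeumannAlgebra.exists_halving_projection (S : VonNeumannAlgebra K) {h q : K →L[ℂ] K}
    (hh : h ∈ S) (hq : IsSelfAdjoint q) (hhq : Commute h q) {t : ℝ} (h0 : 0 ≤ h)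
    (h1 : h ≤ algebraMap ℝ _ (t + t)) :
    ∃ p ∈ S, IsStarProjection p ∧ Commute p q ∧ 0 ≤ h - t • p ∧
      h - t • p ≤ algebraMap ℝ _ t := by
  -- `p` will be the range projection of `(h - t)⁺`, a spectral projection of `h`. On its range `t ≤
  -- h ≤ 2t`, so that `t` can be subtracted; on the complement `0 ≤ h ≤ t` already.
  set g := h - algebraMap ℝ _ t with hg
  have hgS : g ∈ S := by
    refine sub_mem hh ?_
    rw [Algebra.algebraMap_eq_smul_one]
    exact S.smul_mem' (t : ℂ) (one_mem S)
  have hgsa : IsSelfAdjoint g := (IsSelfAdjoint.of_nonneg h0).sub (IsSelfAdjoint.algebraMap _ (IsSelfAdjoint.all t))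
  have hgq : Commute g q := hhq.sub_left (Algebra.commutes t q)
  set u := g⁺ with hu
  set l := g⁻ with hl
  have hul : g = u - l := (CFC.posPart_sub_negPart g hgsa).symm
  have hlu : l * u = 0 := CFC.negPart_mul_posPart g
  have huS : u ∈ S := by
    rw [hu, CFC.posPart_def]
    exact S.cfcₙ_mem hgS _
  have huq : Commute u q := by
    rw [hu, CFC.posPart_def]
    exact hgq.cfcₙ_real _
  have hu0 : 0 ≤ u := CFC.posPart_nonneg g
  have hl0 : 0 ≤ l := CFC.negPart_nonneg g
  have husa : star u = u := (IsSelfAdjoint.of_nonneg hu0).star_eq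
  obtain ⟨p, hpS, hp, hpu, hpann⟩ := S.exists_rangeProjection huS
  have hps : star p = p := hp.isSelfAdjoint.star_eq
  have hpp : p * p = p := hp.isIdempotentElem
  have hup : u * p = u := by simpa [hps, husa] using congrArg star hpu
  have hlp : l * p = 0 := hpann l hlu
  have hpl : p * l = 0 := by
    simpa [hps, (IsSelfAdjoint.of_nonneg hl0).star_eq] using congrArg star hlp
  have hqp : (1 - p) * q * p = 0 := by
    apply hpann
    rw [mul_assoc, ← huq.eq, ← mul_assoc, sub_mul, one_mul, hpu, sub_self, zero_mul]
  have hqp' : q * p = p * q * p := by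
    rw [sub_mul, sub_mul, one_mul, sub_eq_zero] at hqp
    exact hqp
  have hpq : Commute p q := by
    have := congrArg star hqp'
    simp only [star_mul, hps, hq.star_eq] at this
    rw [commute_iff_eq, this, hqp', ← mul_assoc, ← mul_assoc, hpp]
  have hht : h = algebraMap ℝ _ t + u - l := by
    rw [add_sub_assoc, ← hul, hg]
    abel
  refine ⟨p, hpS, hp, hpq, ?_, ?_⟩
  · have h3 : h - t • p = u + (1 - p) * h * star (1 - p) := by
      rw [hht, star_sub, star_one, hps, Algebra.algebraMap_eq_smul_one]
      simp only [mul_sub, sub_mul, mul_add, add_mul, mul_one, one_mul, smul_mul_assoc,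
        mul_smul_comm, hpp, hpu, hlp, hpl, sub_self, zero_mul]
      module
    rw [h3]
    exact add_nonneg hu0 (star_right_conjugate_nonneg h0 _)
  · have h3 : algebraMap ℝ _ t - (h - t • p) =
        l + p * (algebraMap ℝ _ (t + t) - h) * star p := by
      rw [hht, hps, map_add, Algebra.algebraMap_eq_smul_one]
      simp only [mul_sub, sub_mul, mul_add, add_mul, mul_one, smul_mul_assoc,
        mul_smul_comm, hpp, hup, hpu, hpl, zero_mul]
      module
    rw [← sub_nonneg, h3]
    exact add_nonneg hl0 (star_right_conjugate_nonneg (sub_nonneg.2 h1) _)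

/-- Subtracting a multiple of a projection that commutes with `x` leaves the commutator `[h, x]`
unchanged but halves the upper bound of `h`. After `k` such steps the commutator is that of an
element of size `t / 2 ^ k`. -/
theorem VonNeumannAlgebra.norm_commutator_le (S : VonNeumannAlgebra K) {q x : K →L[ℂ] K}
    (hq : IsSelfAdjoint q)
    (hx : ∀ p ∈ S, IsStarProjection p → Commute p q → Commute p x) (k : ℕ) :
    ∀ (t : ℝ) (h : K →L[ℂ] K), h ∈ S → Commute h q → 0 ≤ h → h ≤ algebraMap ℝ _ t → 0 ≤ t →
      ‖h * x - x * h‖ ≤ (1 / 2) ^ k * (2 * t * ‖x‖) := by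
  induction k with
  | zero =>
    intro t h _ _ h0 h1 ht
    have hn : ‖h‖ ≤ t := (CStarAlgebra.norm_le_iff_le_algebraMap h ht h0).2 h1
    calc ‖h * x - x * h‖ ≤ ‖h * x‖ + ‖x * h‖ := norm_sub_le _ _
      _ ≤ ‖h‖ * ‖x‖ + ‖x‖ * ‖h‖ := add_le_add (norm_mul_le _ _) (norm_mul_le _ _)
      _ = 2 * ‖h‖ * ‖x‖ := by ring
      _ ≤ 2 * t * ‖x‖ := by gcongr
      _ = _ := by ring
  | succ k ih =>
    intro t h hS hhq h0 h1 ht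
    obtain ⟨p, hpS, hp, hpq, h2, h3⟩ := S.exists_halving_projection hS hq hhq (t := t / 2) h0
      (by rwa [add_halves])
    have h4 := ih (t / 2) (h - (t / 2) • p) (sub_mem hS (S.smul_mem' ((t / 2 : ℝ) : ℂ) hpS))
      (hhq.sub_left (hpq.smul_left _)) h2 h3 (by positivity)
    have h5 : (h - (t / 2) • p) * x - x * (h - (t / 2) • p) = h * x - x * h := by
      rw [sub_mul, mul_sub, smul_mul_assoc, mul_smul_comm, (hx p hpS hp hpq).eq]
      abel
    rw [h5] at h4
    calc _ ≤ _ := h4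
      _ = _ := by ring

/-- Replaces the statement that a von Neumann algebra, here `S ∩ {q}'`, is generated by its
projections: positive elements by the dyadic estimate, selfadjoint ones by adding a scalar, the rest
by real and imaginary parts. -/
theorem VonNeumannAlgebra.commute_of_commute_projections (S : VonNeumannAlgebra K)
    {q x : K →L[ℂ] K} (hq : IsSelfAdjoint q)
    (hx : ∀ p ∈ S, IsStarProjection p → Commute p q → Commute p x) {h : K →L[ℂ] K} (hS : h ∈ S)
    (hhq : Commute h q) (hhq' : Commute (star h) q) : Commute h x := by
  have hpos : ∀ h ∈ S, Commute h q → 0 ≤ h → Commute h x := by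
    intro h hS hhq h0
    have h1 : h ≤ algebraMap ℝ _ ‖h‖ := IsSelfAdjoint.le_algebraMap_norm_self (.of_nonneg h0)
    have h2 := fun k => S.norm_commutator_le hq hx k ‖h‖ h hS hhq h0 h1 (norm_nonneg _)
    have h3 : Filter.Tendsto (fun k : ℕ => (1 / 2 : ℝ) ^ k * (2 * ‖h‖ * ‖x‖)) Filter.atTop
        (nhds 0) := by
      simpa using (tendsto_pow_atTop_nhds_zero_of_lt_one (r := (1 / 2 : ℝ)) (by norm_num)
        (by norm_num)).mul_const (2 * ‖h‖ * ‖x‖)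
    have h4 : ‖h * x - x * h‖ ≤ 0 := ge_of_tendsto' h3 h2
    exact sub_eq_zero.1 (norm_le_zero_iff.1 h4)
  have hsa : ∀ h ∈ S, Commute h q → IsSelfAdjoint h → Commute h x := by
    intro h hS hhq hh
    have h1 : 0 ≤ h + algebraMap ℝ _ ‖h‖ := by
      have := hh.neg_algebraMap_norm_le_self
      rwa [neg_le_iff_add_nonneg] at this
    have h2 := hpos _ (add_mem hS (by
      rw [Algebra.algebraMap_eq_smul_one]
      exact S.smul_mem' ((‖h‖ : ℝ) : ℂ) (one_mem S))) (hhq.add_left (Algebra.commutes _ q)) h1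
    simpa using h2.sub_left (Algebra.commutes ‖h‖ x)
  have h1 : Commute (h + star h) x :=
    hsa _ (add_mem hS (star_mem hS)) (hhq.add_left hhq') (IsSelfAdjoint.add_star_self h)
  have h2 : Commute (Complex.I • (h - star h)) x := by
    refine hsa _ (S.smul_mem' _ (sub_mem hS (star_mem hS))) ((hhq.sub_left hhq').smul_left _) ?_
    simp only [isSelfAdjoint_iff, star_smul, star_sub, star_star, Complex.star_def, Complex.conj_I]
    module
  have h3 := (h1.smul_left (1 / 2 : ℂ)).add_left (h2.smul_left (-Complex.I / 2))
  have h4 : (1 / 2 : ℂ) • (h + star h) + (-Complex.I / 2) • Complex.I • (h - star h) = h := by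
    rw [smul_smul, show -Complex.I / 2 * Complex.I = 1 / 2 by
      rw [div_mul_eq_mul_div, neg_mul, Complex.I_mul_I, neg_neg]]
    module
  rwa [h4] at h3

/-- A projection that is not abelian dominates a nonzero partial isometry with square zero. -/
theorem VonNeumannAlgebra.exists_square_zero (S : VonNeumannAlgebra K) {q : K →L[ℂ] K}
    (hqS : q ∈ S) (hq : IsStarProjection q) (hna : ¬ IsAbelianProjection S q) :
    ∃ w ∈ S, w ≠ 0 ∧ w * star w * w = w ∧ q * w = w ∧ w * q = w ∧ w * w = 0 := by
  by_contra hcon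
  have hqq : q * q = q := hq.isIdempotentElem
  -- The phase of a square-zero element of `qSq` is a square-zero partial isometry of `qSq`, so
  -- under `hcon` there are no nonzero square-zero elements at all.
  have hsq : ∀ a ∈ S, q * a = a → a * q = a → a * a = 0 → a = 0 := by
    intro a ha h1 h2 h3
    by_contra ha0
    obtain ⟨w, hw, hwa, hww, hwr, hwl⟩ := S.exists_phase ha
    refine hcon ⟨w, hw, fun h => ha0 (by rw [← hwa, h, zero_mul]), hww, ?_, ?_, ?_⟩
    · have := hwl (1 - q) (by rw [sub_mul, h1, one_mul, sub_self])
      rw [sub_mul, one_mul, sub_eq_zero] at this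
      exact this.symm
    · have := hwr (1 - q) (by rw [mul_sub, h2, mul_one, sub_self])
      rw [mul_sub, mul_one, sub_eq_zero] at this
      exact this.symm
    · exact hwl _ (hwr _ h3)
  apply hna
  refine ⟨hqS, hq, fun a ha b hb => ?_⟩
  have hcomm : ∀ a, Commute (q * a * q) q := fun a => by
    rw [commute_iff_eq, mul_assoc, hqq, ← mul_assoc, ← mul_assoc, hqq]
  refine (S.commute_of_commute_projections hq.isSelfAdjoint ?_ (mul_mem (mul_mem hqS ha) hqS)
    (hcomm a) ?_ : Commute (q * a * q) (q * b * q)).eq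
  · intro p hpS hp hpq
    set x := q * b * q with hx
    have hxS : x ∈ S := mul_mem (mul_mem hqS hb) hqS
    have hqx : q * x = x := by rw [hx, ← mul_assoc, ← mul_assoc, hqq]
    have hxq : x * q = x := by rw [hx, mul_assoc, hqq]
    have hpp : p * p = p := hp.isIdempotentElem
    have hz : (1 - p) * p = 0 := by rw [sub_mul, hpp, one_mul, sub_self]
    have hz' : p * (1 - p) = 0 := by rw [mul_sub, hpp, mul_one, sub_self]
    have hpq' : Commute (1 - p) q := (Commute.one_left q).sub_left hpq
    -- With `r = p` and `s = 1 - p`, or the reverse, the off-diagonal blocks of `x` relative to `p`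
    -- have square zero; hence they vanish, and `x` commutes with `p`.
    have key : ∀ r s : K →L[ℂ] K, r ∈ S → s ∈ S → Commute r q → Commute s q → s * r = 0 →
        r * x * s = 0 := by
      intro r s hr hs hrq hsq' hsr
      apply hsq _ (mul_mem (mul_mem hr hxS) hs)
      · rw [← mul_assoc, ← mul_assoc, ← hrq.eq, mul_assoc r, hqx]
      · rw [mul_assoc, hsq'.eq, ← mul_assoc, mul_assoc r, hxq]
      · rw [mul_assoc, ← mul_assoc s, ← mul_assoc s, hsr, zero_mul, zero_mul, mul_zero]
    have e1 := key p (1 - p) hpS (sub_mem (one_mem S) hpS) hpq hpq' hz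
    have e2 := key (1 - p) p (sub_mem (one_mem S) hpS) hpS hpq' hpq hz'
    rw [mul_sub, mul_one, sub_eq_zero] at e1
    rw [sub_mul, sub_mul, one_mul, sub_eq_zero] at e2
    rw [commute_iff_eq, e1, e2]
  · have : star (q * a * q) = q * star a * q := by
      rw [star_mul, star_mul, hq.isSelfAdjoint.star_eq, mul_assoc]
    rw [this]
    exact hcomm _

/-- A projection without nonzero abelian subprojections can be halved. -/
theorem VonNeumannAlgebra.exists_half (S : VonNeumannAlgebra K) {e : K →L[ℂ] K}
    (heS : e ∈ S) (he : IsStarProjection e)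
    (hab : ∀ q, IsAbelianProjection S q → q * e = q → q = 0) :
    ∃ v ∈ S, star v * v + v * star v = e ∧ v * v = 0 ∧ v * star v * v = v := by
  have hes : star e = e := he.isSelfAdjoint.star_eq
  have hee : e * e = e := he.isIdempotentElem
  -- The relation makes the initial and final spaces of different members mutually orthogonal, so
  -- that the sum still has square zero.
  obtain ⟨X, hXP, hXr, hXmax⟩ := exists_maximal_pairwise
    (fun v : K →L[ℂ] K => v ∈ S ∧ v * star v * v = v ∧ e * v = v ∧ v * e = v ∧ v * v = 0)
    (fun v w => star v * w = 0 ∧ v * star w = 0 ∧ v * w = 0)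
  obtain ⟨V, hVS, hV⟩ := S.exists_isOrthogonalSum (v := fun x : X => (x : K →L[ℂ] K))
    (fun x => (hXP x x.2).1) (fun x => (hXP x x.2).2.1)
    (fun x y hxy => (hXr x.2 y.2 (fun h => hxy (Subtype.ext h))).1)
    (fun x y hxy => (hXr x.2 y.2 (fun h => hxy (Subtype.ext h))).2.1)
  have heV : e * V = V := hV.mul_eq_self fun x => (hXP x x.2).2.2.1
  have hVe : V * e = V := hV.mul_eq_self' fun x => (hXP x x.2).2.2.2.1
  have hvV : ∀ x : X, (x : K →L[ℂ] K) * V = 0 := by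
    intro x
    refine hV.mul_eq_zero fun y => ?_
    by_cases hxy : x = y
    · rw [hxy]
      exact (hXP y y.2).2.2.2.2
    · exact (hXr x.2 y.2 (fun h => hxy (Subtype.ext h))).2.2
  have hVV : V * V = 0 := hV.mul_eq_zero' hvV
  have hVv : ∀ x : X, V * (x : K →L[ℂ] K) = 0 := by
    intro x
    refine hV.mul_eq_zero' fun y => ?_
    by_cases hxy : y = x
    · rw [hxy]
      exact (hXP x x.2).2.2.2.2
    · exact (hXr y.2 x.2 (fun h => hxy (Subtype.ext h))).2.2
  have hVVV : V * star V * V = V := hV.mul_star_mul fun x => (hXP x x.2).2.1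
  refine ⟨V, hVS, ?_, hVV, hVVV⟩
  set U := star V with hU
  have hUe : U * e = U := by simpa [hes] using congrArg star heV
  have heU : e * U = U := by simpa [hes] using congrArg star hVe
  have hUU : U * U = 0 := by simpa using congrArg star hVV
  have hUVU : U * V * U = U := by simpa [mul_assoc, ← hU, show star U = V from star_star V] using congrArg star hVVV
  have hVVV' : V * (U * V) = V := by rw [← mul_assoc, hVVV]
  have hUVU' : U * (V * U) = U := by rw [← mul_assoc, hUVU]
  -- The part of `e` that is not yet halved. If it were not abelian, a square-zero partial isometry
  -- below it would enlarge the maximal family.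
  set q := e - (U * V + V * U) with hq
  have hqS : q ∈ S :=
    sub_mem heS (add_mem (mul_mem (star_mem hVS) hVS) (mul_mem hVS (star_mem hVS)))
  have hqe : q * e = q := by
    rw [hq, sub_mul, add_mul, hee, mul_assoc, hVe, mul_assoc, hUe]
  have hqV : q * V = V - V * U * V := by
    rw [hq, sub_mul, heV, add_mul, mul_assoc, hVV, mul_zero, zero_add]
  have hqU : q * U = U - U * V * U := by
    rw [hq, sub_mul, heU, add_mul, mul_assoc V, hUU, mul_zero, add_zero]
  have hqproj : IsStarProjection q := by
    constructor
    · rw [IsIdempotentElem]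
      conv_lhs => rw [hq, mul_sub, ← hq, hqe, mul_add, ← mul_assoc, hqU, ← mul_assoc, hqV, hUVU,
        hVVV, sub_self, zero_mul, sub_self, zero_mul, add_zero, sub_zero]
    · rw [isSelfAdjoint_iff, hq, star_sub, star_add, star_mul, star_mul, hes, hU, star_star]
  have hqa : IsAbelianProjection S q := by
    by_contra hna
    obtain ⟨w, hwS, hw0, hwww, hqw, hwq, hww⟩ := S.exists_square_zero hqS hqproj hna
    have hqs : star q = q := hqproj.isSelfAdjoint.star_eq
    have hqx : ∀ x : X, q * (x : K →L[ℂ] K) = 0 := by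
      intro x
      rw [hq, sub_mul, (hXP x x.2).2.2.1, add_mul, mul_assoc, hVv, mul_zero, zero_add, mul_assoc,
        hV.star_mul', ← mul_assoc, hV.mul_star, (hXP x x.2).2.1, sub_self]
    have hxq : ∀ x : X, (x : K →L[ℂ] K) * q = 0 := by
      intro x
      rw [hq, mul_sub, (hXP x x.2).2.2.2.1, mul_add, ← mul_assoc, hV.mul_star', ← mul_assoc, hvV,
        zero_mul, add_zero, mul_assoc, hV.star_mul, ← mul_assoc, (hXP x x.2).2.1, sub_self]
    have hqx' : ∀ x : X, q * star (x : K →L[ℂ] K) = 0 := fun x => by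
      simpa [hqs] using congrArg star (hxq x)
    have hxq' : ∀ x : X, star (x : K →L[ℂ] K) * q = 0 := fun x => by
      simpa [hqs] using congrArg star (hqx x)
    have hwX : w ∈ X := by
      apply hXmax
      · refine ⟨hwS, hwww, ?_, ?_, hww⟩
        · rw [← hqw, ← mul_assoc]
          congr 1
          simpa [hqs, hes] using congrArg star hqe
        · rw [← hwq, mul_assoc, hqe]
      · intro x hx
        refine ⟨⟨?_, ?_, ?_⟩, ?_, ?_, ?_⟩
        · rw [← hqw, ← mul_assoc, hxq' ⟨x, hx⟩, zero_mul]
        · rw [← hwq, star_mul, hqs, ← mul_assoc, hxq ⟨x, hx⟩, zero_mul]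
        · rw [← hqw, ← mul_assoc, hxq ⟨x, hx⟩, zero_mul]
        · rw [← hqw, star_mul, hqs, mul_assoc, hqx ⟨x, hx⟩, mul_zero]
        · rw [← hwq, mul_assoc, hqx' ⟨x, hx⟩, mul_zero]
        · rw [← hwq, mul_assoc, hqx ⟨x, hx⟩, mul_zero]
    apply hw0
    rw [← hqw, hqx ⟨w, hwX⟩]
  have := hab q hqa hqe
  rw [hq, sub_eq_zero] at this
  exact this.symm

end

/-! ### Division of projections, comparison with an abelian projection, central decomposition -/

section
variable {K : Type*} [NormedAddCommGroup K] [InnerProductSpace ℂ K] [CompleteSpace K]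

theorem mul_eq_self_of_star_mul_self {w e : K →L[ℂ] K} (he : IsStarProjection e)
    (h : star w * w = e) : w * e = w := by
  have hes : star e = e := he.isSelfAdjoint.star_eq
  have hee : e * e = e := he.isIdempotentElem
  have h1 : star (w * e - w) * (w * e - w) = 0 := by
    have h2 : star (w * e - w) * (w * e - w) =
        e * (star w * w) * e - e * (star w * w) - (star w * w) * e + star w * w := by
      rw [star_sub, star_mul, hes]
      noncomm_ring
    rw [h2, h, hee, hee, sub_self, zero_sub, neg_add_cancel]
  exact sub_eq_zero.1 ((CStarRing.star_mul_self_eq_zero_iff _).1 h1)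

theorem partialIsometry_of_star_mul_self {w e : K →L[ℂ] K} (he : IsStarProjection e)
    (h : star w * w = e) : w * star w * w = w := by
  rw [mul_assoc, h, mul_eq_self_of_star_mul_self he h]

namespace VonNeumannAlgebra

/-- A projection without nonzero abelian subprojections can be divided into `2 ^ k` equivalent
orthogonal projections. -/
theorem exists_division (S : VonNeumannAlgebra K) {e : K →L[ℂ] K}
    (heS : e ∈ S) (he : IsStarProjection e)
    (hab : ∀ q, IsAbelianProjection S q → q * e = q → q = 0) (k : ℕ) :
    ∃ (ι : Type) (_ : Fintype ι) (_ : DecidableEq ι) (v : ι → K →L[ℂ] K) (p : K →L[ℂ] K),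
      Fintype.card ι = 2 ^ k ∧ (∀ i, v i ∈ S) ∧ p ∈ S ∧ IsStarProjection p ∧ p * e = p ∧
        (∀ i j, star (v i) * v j = if i = j then p else 0) ∧ ∑ i, v i * star (v i) = e := by
  induction k with
  | zero =>
    have hes : star e = e := he.isSelfAdjoint.star_eq
    have hee : e * e = e := he.isIdempotentElem
    refine ⟨Unit, inferInstance, inferInstance, fun _ => e, e, by simp, fun _ => heS, heS, he, hee,
      fun i j => ?_, ?_⟩
    · simp [hes, hee]
    · simp [hes, hee]
  | succ k ih =>
    obtain ⟨ι, _, _, v, p, hcard, hvS, hpS, hp, hpe, hvv, hsum⟩ := ih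
    obtain ⟨w, hwS, hwp, hww, hwww⟩ := S.exists_half hpS hp (fun q hq hqp =>
      hab q hq (by rw [← hqp, mul_assoc, hpe]))
    have hvp : ∀ i, v i * p = v i := fun i =>
      mul_eq_self_of_star_mul_self hp (by rw [hvv, if_pos rfl])
    set p' := star w * w with hp'
    have hww' : star w * star w = 0 := by simpa using congrArg star hww
    have hp's : star p' = p' := by simp [hp']
    have hp'p' : p' * p' = p' := by rw [hp', mul_assoc, ← mul_assoc w, hwww]
    have hpw : p * w = w := by
      rw [← hwp, add_mul, hwww, hp', mul_assoc, hww, mul_zero, zero_add]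
    have hpp' : p * p' = p' := by
      rw [← hwp, add_mul, hp'p', mul_assoc, hp', ← mul_assoc (star w), hww', zero_mul, mul_zero,
        add_zero]
    have hp'p : p' * p = p' := by
      simpa [hp's, hp.isSelfAdjoint.star_eq] using congrArg star hpp'
    have hp'w : p' * w = 0 := by rw [hp', mul_assoc, hww, mul_zero]
    have hwp' : star w * p' = 0 := by simpa [hp's] using congrArg star hp'w
    have key : ∀ i j (a b : K →L[ℂ] K), p * b = b →
        star (v i * a) * (v j * b) = if i = j then star a * b else 0 := by
      intro i j a b hb
      rw [star_mul, mul_assoc, ← mul_assoc (star (v i)), hvv]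
      split_ifs
      · rw [hb]
      · rw [zero_mul, mul_zero]
    -- Each piece is halved: `vᵢ p'` and `vᵢ w` share the initial projection `p' = w* w`, and their
    -- final projections add up to `vᵢ vᵢ*`, since `w* w + w w* = p`.
    refine ⟨ι × Bool, inferInstance, inferInstance,
      fun x => v x.1 * (if x.2 then w else p'), p', ?_, ?_, mul_mem (star_mem hwS) hwS,
      ⟨hp'p', hp's⟩, ?_, ?_, ?_⟩
    · simp [hcard, pow_succ]
    · rintro ⟨i, b⟩
      refine mul_mem (hvS i) ?_
      cases b
      · exact mul_mem (star_mem hwS) hwS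
      · exact hwS
    · rw [← hp'p, mul_assoc, hpe]
    · rintro ⟨i, b⟩ ⟨j, c⟩
      cases b <;> cases c <;> simp only [Prod.mk.injEq, reduceCtorEq, if_true, if_false,
        Bool.false_eq_true, and_true, and_false]
      · rw [key i j _ _ hpp', hp's, hp'p']
      · rw [key i j _ _ hpw, hp's, hp'w, ite_self]
      · rw [key i j _ _ hpp', hwp', ite_self]
      · rw [key i j _ _ hpw]
    · rw [Fintype.sum_prod_type, ← hsum]
      refine Finset.sum_congr rfl fun i _ => ?_
      rw [Fintype.sum_bool]
      simp only [if_true, Bool.false_eq_true, if_false, star_mul]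
      have h1 : v i * w * (star w * star (v i)) + v i * p' * (star p' * star (v i)) =
          v i * (p' * star p' + w * star w) * star (v i) := by noncomm_ring
      rw [h1, hp's, hp'p', hwp, hvp]

/-- Hilbert's hotel: below `c` the ranges of the `wᵢ` fill everything, so an injection `α` of the
index set into itself gives `∑ c w_{α i} wᵢ*`, with initial projection `c`. The two halves of a
bijection `ι ≃ ι ⊕ ι` give orthogonal ranges. -/
theorem exists_isometries_of_infinite (S : VonNeumannAlgebra K) {e c P : K →L[ℂ] K}
    {ι : Type*} {w : ι → K →L[ℂ] K} (he : IsStarProjection e)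
    (hwS : ∀ i, w i ∈ S) (hwe : ∀ i, star (w i) * w i = e)
    (hw : ∀ i j, i ≠ j → star (w i) * w j = 0) (hc : IsStarProjection c) (hcS : c ∈ S)
    (hcS' : c ∈ S.commutant) (hP : IsOrthogonalSum (fun i => w i * star (w i)) P)
    (hcP : c * P = c) [Infinite ι] :
    ∃ v₁ ∈ S, ∃ v₂ ∈ S, star v₁ * v₁ = c ∧ star v₂ * v₂ = c ∧ star v₁ * v₂ = 0 := by
  have hcs : star c = c := hc.isSelfAdjoint.star_eq
  have hcc : c * c = c := hc.isIdempotentElem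
  have hcw : ∀ i, c * w i = w i * c := fun i => (commute_of_mem_commutant (hwS i) hcS').symm
  have hcw' : ∀ i, c * star (w i) = star (w i) * c := fun i =>
    (commute_of_mem_commutant (star_mem (hwS i)) hcS').symm
  have hwe' : ∀ i, w i * e = w i := fun i => mul_eq_self_of_star_mul_self he (hwe i)
  have hew : ∀ i, e * star (w i) = star (w i) := fun i => by
    simpa [he.isSelfAdjoint.star_eq] using congrArg star (hwe' i)
  have hPw : ∀ i, star (w i) * P = star (w i) := by
    intro i
    have h1 := hP.star_mul i
    simp only [star_mul, star_star] at h1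
    have h2 := congrArg (fun t => star (w i) * t) h1
    simp only [← mul_assoc, hwe, hew] at h2
    exact h2
  have key : ∀ α : ι → ι, Function.Injective α → ∃ V ∈ S,
      IsOrthogonalSum (fun i => c * (w (α i) * star (w i))) V ∧ star V * V = c := by
    intro α hα
    have hx : ∀ i, c * (w (α i) * star (w i)) ∈ S := fun i =>
      mul_mem hcS (mul_mem (hwS _) (star_mem (hwS _)))
    have hxx : ∀ i, star (c * (w (α i) * star (w i))) * (c * (w (α i) * star (w i))) =
        c * (w i * star (w i)) := by
      intro i
      calc star (c * (w (α i) * star (w i))) * (c * (w (α i) * star (w i)))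
          = w i * star (w (α i)) * (star c * c) * w (α i) * star (w i) := by
            simp only [star_mul, star_star, mul_assoc]
        _ = w i * (star (w (α i)) * c) * w (α i) * star (w i) := by
            rw [hcs, hcc]; simp only [mul_assoc]
        _ = (w i * c) * (star (w (α i)) * w (α i)) * star (w i) := by
            rw [← hcw']; simp only [mul_assoc]
        _ = _ := by rw [hwe, ← hcw, mul_assoc, hew, mul_assoc]
    have hxp : ∀ i, c * (w (α i) * star (w i)) * star (c * (w (α i) * star (w i))) *
        (c * (w (α i) * star (w i))) = c * (w (α i) * star (w i)) := by
      intro i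
      rw [mul_assoc, hxx]
      calc c * (w (α i) * star (w i)) * (c * (w i * star (w i)))
          = c * w (α i) * (star (w i) * c) * w i * star (w i) := by simp only [mul_assoc]
        _ = c * (w (α i) * c) * (star (w i) * w i) * star (w i) := by
            rw [← hcw']; simp only [mul_assoc]
        _ = (c * c) * w (α i) * (e * star (w i)) := by
            rw [← hcw, hwe]; simp only [mul_assoc]
        _ = _ := by rw [hcc, hew, mul_assoc]
    obtain ⟨V, hVS, hV⟩ := S.exists_isOrthogonalSum hx hxp
      (by
        intro i j hij
        calc star (c * (w (α i) * star (w i))) * (c * (w (α j) * star (w j)))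
            = w i * star (w (α i)) * (star c * c) * w (α j) * star (w j) := by
              simp only [star_mul, star_star, mul_assoc]
          _ = w i * (star (w (α i)) * c) * w (α j) * star (w j) := by
              rw [hcs, hcc]; simp only [mul_assoc]
          _ = (w i * c) * (star (w (α i)) * w (α j)) * star (w j) := by
              rw [← hcw']; simp only [mul_assoc]
          _ = 0 := by rw [hw _ _ (fun h => hij (hα h)), mul_zero, zero_mul])
      (by
        intro i j hij
        calc c * (w (α i) * star (w i)) * star (c * (w (α j) * star (w j)))
            = c * w (α i) * (star (w i) * w j) * star (w (α j)) * star c := by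
              simp only [star_mul, star_star, mul_assoc]
          _ = 0 := by rw [hw _ _ hij, mul_zero, zero_mul, zero_mul])
    refine ⟨V, hVS, hV, ?_⟩
    have hVP : V * P = V := hV.mul_eq_self' fun i => by
      rw [mul_assoc, mul_assoc, hPw]
    have hVc : V * c = V := hV.mul_eq_self' fun i => by
      rw [mul_assoc, mul_assoc, ← hcw', ← mul_assoc (w _), ← hcw, mul_assoc c, ← mul_assoc c c, hcc]
    have h1 : (star V * V - c) * P = 0 := by
      refine hP.mul_eq_zero fun i => ?_
      have h2 : V * (c * (w i * star (w i))) = c * (w (α i) * star (w i)) := by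
        rw [← hxx, ← mul_assoc, hV.mul_star, hxp]
      have h3 : star V * V * (w i * star (w i)) = c * (w i * star (w i)) := by
        rw [← hxx i, ← hV.star_mul' i, ← h2, ← mul_assoc V, hVc, mul_assoc]
      rw [sub_mul, h3, sub_self]
    rw [sub_mul, mul_assoc, hVP, hcP, sub_eq_zero] at h1
    exact h1
  have hcard : Nonempty (ι ≃ ι ⊕ ι) := by
    rw [← Cardinal.eq, Cardinal.mk_sum, Cardinal.lift_id,
      Cardinal.add_eq_self (Cardinal.aleph0_le_mk ι)]
  obtain ⟨f⟩ := hcard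
  obtain ⟨v₁, h₁S, h₁, h₁c⟩ := key (fun i => f.symm (Sum.inl i))
    (f.symm.injective.comp Sum.inl_injective)
  obtain ⟨v₂, h₂S, h₂, h₂c⟩ := key (fun i => f.symm (Sum.inr i))
    (f.symm.injective.comp Sum.inr_injective)
  refine ⟨v₁, h₁S, v₂, h₂S, h₁c, h₂c, ?_⟩
  refine h₂.mul_eq_zero fun i => ?_
  have h3 : star (w (f.symm (Sum.inr i))) * v₁ = 0 := by
    refine h₁.mul_eq_zero fun j => ?_
    rw [← mul_assoc, ← hcw', mul_assoc, ← mul_assoc (star (w _)), hw _ _ (by simp), zero_mul,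
      mul_zero]
  have h4 : star v₁ * w (f.symm (Sum.inr i)) = 0 := by simpa using congrArg star h3
  rw [← mul_assoc c, hcw, mul_assoc, ← mul_assoc, h4, zero_mul]

/-- The projections `c wᵢ wᵢ*` add up to `c` and are equivalent through `c wⱼ wᵢ*`; they are abelian
because `c wᵢ` carries their corners into the corner of `e`. -/
theorem isTypeISummand_of_fintype (S : VonNeumannAlgebra K) {e c P : K →L[ℂ] K}
    {ι : Type*} {w : ι → K →L[ℂ] K} (he : IsAbelianProjection S e)
    (hwS : ∀ i, w i ∈ S) (hwe : ∀ i, star (w i) * w i = e)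
    (hw : ∀ i j, i ≠ j → star (w i) * w j = 0) (hc : IsStarProjection c) (hcS : c ∈ S)
    (hcS' : c ∈ S.commutant) (hP : IsOrthogonalSum (fun i => w i * star (w i)) P)
    (hcP : c * P = c) [Fintype ι] :
    IsTypeISummand S (Fintype.card ι) c := by
  classical
  have hcs : star c = c := hc.isSelfAdjoint.star_eq
  have hcc : c * c = c := hc.isIdempotentElem
  have hcw : ∀ i, c * w i = w i * c := fun i => (commute_of_mem_commutant (hwS i) hcS').symm
  have hcw' : ∀ i, c * star (w i) = star (w i) * c := fun i =>
    (commute_of_mem_commutant (star_mem (hwS i)) hcS').symm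
  have hwe' : ∀ i, w i * e = w i := fun i => mul_eq_self_of_star_mul_self he.2.1 (hwe i)
  have hew : ∀ i, e * star (w i) = star (w i) := fun i => by
    simpa [he.2.1.isSelfAdjoint.star_eq] using congrArg star (hwe' i)
  obtain ⟨W, hW⟩ : ∃ W : ι → K →L[ℂ] K, ∀ i, W i = c * w i := ⟨_, fun _ => rfl⟩
  have hWS : ∀ i, W i ∈ S := fun i => by
    rw [hW]
    exact mul_mem hcS (hwS i)
  have hWW : ∀ i j, star (W i) * W j = if i = j then c * e else 0 := by
    intro i j
    have h1 : star (W i) * W j = c * (star (w i) * w j) := by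
      simp only [hW, star_mul, hcs]
      rw [mul_assoc, ← mul_assoc c, hcc, ← mul_assoc, ← hcw', mul_assoc]
    rw [h1]
    split_ifs with hij
    · rw [hij, hwe]
    · rw [hw i j hij, mul_zero]
  have hWe : ∀ i, W i * e = W i := fun i => by rw [hW, mul_assoc, hwe']
  have heW : ∀ i, e * star (W i) = star (W i) := fun i => by
    simpa [he.2.1.isSelfAdjoint.star_eq] using congrArg star (hWe i)
  have hWce : ∀ i, W i * (c * e) = W i := fun i => by
    rw [← mul_assoc, hW, mul_assoc c, ← hcw, ← mul_assoc c c, hcc, mul_assoc, hwe']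
  have hp : ∀ i, IsStarProjection (W i * star (W i)) := fun i => by
    refine ⟨?_, IsSelfAdjoint.mul_star_self _⟩
    rw [IsIdempotentElem, mul_assoc, ← mul_assoc (star (W i)), hWW, if_pos rfl, ← mul_assoc, hWce]
  have hpa : ∀ i, IsAbelianProjection S (W i * star (W i)) := by
    intro i
    refine ⟨mul_mem (hWS i) (star_mem (hWS i)), hp i, fun a ha b hb => ?_⟩
    have h1 : ∀ a b : K →L[ℂ] K, (W i * star (W i) * a * (W i * star (W i))) *
        (W i * star (W i) * b * (W i * star (W i))) =
        W i * ((e * (star (W i) * a * W i) * e) * (e * (star (W i) * b * W i) * e)) *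
          star (W i) := by
      intro a b
      have h2 : ∀ a, e * (star (W i) * a * W i) * e = star (W i) * a * W i := fun a => by
        rw [mul_assoc, mul_assoc _ (W i) e, hWe, mul_assoc (star (W i)), ← mul_assoc e, heW]
      rw [h2, h2]
      calc _ = W i * (star (W i) * a * (W i * (star (W i) * W i)) * (star (W i) * b * W i)) *
          star (W i) := by simp only [mul_assoc]
        _ = _ := by rw [hWW, if_pos rfl, hWce]
    have h3 : ∀ a ∈ S, star (W i) * a * W i ∈ S := fun a ha =>
      mul_mem (mul_mem (star_mem (hWS i)) ha) (hWS i)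
    rw [h1, h1, he.2.2 _ (h3 a ha) _ (h3 b hb)]
  have heqv : ∀ i j, MurrayVonNeumannEquiv S (W i * star (W i)) (W j * star (W j)) := by
    have h1 : ∀ i j, W j * star (W i) * (W i * star (W j)) = W j * star (W j) := fun i j => by
      rw [mul_assoc, ← mul_assoc (star (W i)), hWW, if_pos rfl, ← mul_assoc, hWce]
    intro i j
    refine ⟨W j * star (W i), mul_mem (hWS j) (star_mem (hWS i)), ?_, ?_⟩
    · rw [star_mul, star_star, h1]
    · rw [star_mul, star_star, h1]
  refine ⟨hcS, hcS', fun i => W ((Fintype.equivFin ι).symm i) *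
    star (W ((Fintype.equivFin ι).symm i)), fun i => hpa _, fun i j hij => ?_,
    fun i j => heqv _ _, ?_⟩
  · rw [mul_assoc, ← mul_assoc (star _), hWW, if_neg (by simpa using hij), zero_mul, mul_zero]
  · rw [Equiv.sum_comp (Fintype.equivFin ι).symm fun i => W i * star (W i)]
    have hPw : ∀ i, star (w i) * P = star (w i) := by
      intro i
      have h1 := hP.star_mul i
      simp only [star_mul, star_star] at h1
      have h2 := congrArg (fun t => star (w i) * t) h1
      simp only [← mul_assoc, hwe, hew] at h2
      exact h2
    have h1 : (1 - ∑ i, w i * star (w i)) * P = 0 := by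
      refine hP.mul_eq_zero fun i => ?_
      rw [sub_mul, one_mul, Finset.sum_mul, Finset.sum_eq_single i, mul_assoc,
        ← mul_assoc (star (w i)), hwe, hew, sub_self]
      · intro j _ hj
        rw [mul_assoc, ← mul_assoc (star (w j)), hw j i hj, zero_mul, mul_zero]
      · simp
    have h2 : P = ∑ i, w i * star (w i) := by
      rw [sub_mul, one_mul, sub_eq_zero, Finset.sum_mul] at h1
      simp only [mul_assoc, hPw] at h1
      exact h1
    have h3 : c = ∑ i, c * (w i * star (w i)) * c := by
      rw [← Finset.sum_mul, ← Finset.mul_sum, ← h2, hcP, hcc]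
    conv_lhs => rw [h3]
    refine Finset.sum_congr rfl fun i _ => ?_
    simp only [hW, star_mul, hcs, mul_assoc]

/-- A nonzero abelian projection of an algebra without summands of finite type `I` gives rise to
a nonzero central projection, below its central support, that splits into two copies of itself. -/
theorem exists_isometries_of_abelian (S : VonNeumannAlgebra K) (hS : HasNoFiniteTypeISummand S)
    {e : K →L[ℂ] K} (he : IsAbelianProjection S e) (he0 : e ≠ 0) :
    ∃ c ∈ S, c ∈ S.commutant ∧ IsStarProjection c ∧ c ≠ 0 ∧
      (∀ f : K →L[ℂ] K, (∀ a ∈ S, f * a * e = 0) → f * c = 0) ∧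
      ∃ v₁ ∈ S, ∃ v₂ ∈ S, star v₁ * v₁ = c ∧ star v₂ * v₂ = c ∧ star v₁ * v₂ = 0 := by
  obtain ⟨heS, hep, hecomm⟩ := id he
  have hes : star e = e := hep.isSelfAdjoint.star_eq
  have hee : e * e = e := hep.isIdempotentElem
  -- `X` is a maximal set of copies of `e` with orthogonal ranges, spanning `P`. The set `Y` below
  -- fills `Q = 1 - P` as far as possible with partial copies of `e`. A part `e'` of `e` is left
  -- over, and on the central support of `e'` the copies in `X` exhaust everything.
  obtain ⟨X, hX, hXr, hXmax⟩ := exists_maximal_pairwise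
    (fun w : K →L[ℂ] K => w ∈ S ∧ star w * w = e) (fun w w' => star w * w' = 0)
  have hXr' : ∀ x y : X, x ≠ y → star (x : K →L[ℂ] K) * y = 0 := fun x y hxy =>
    hXr x.2 y.2 fun h => hxy (Subtype.ext h)
  have hXe : ∀ x : X, (x : K →L[ℂ] K) * e = x := fun x =>
    mul_eq_self_of_star_mul_self hep (hX x x.2).2
  have heX : ∀ x : X, e * star (x : K →L[ℂ] K) = star (x : K →L[ℂ] K) := fun x => by
    simpa [hes] using congrArg star (hXe x)
  have hXp : ∀ x : X, (x : K →L[ℂ] K) * star (x : K →L[ℂ] K) * ((x : K →L[ℂ] K) *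
      star (x : K →L[ℂ] K)) = (x : K →L[ℂ] K) * star (x : K →L[ℂ] K) := fun x => by
    rw [mul_assoc, ← mul_assoc (star (x : K →L[ℂ] K)), (hX x x.2).2, heX]
  obtain ⟨P, hPS, hP⟩ := S.exists_isOrthogonalSum
    (v := fun x : X => (x : K →L[ℂ] K) * star (x : K →L[ℂ] K))
    (fun x => mul_mem (hX x x.2).1 (star_mem (hX x x.2).1))
    (fun x => by rw [star_mul, star_star, hXp, hXp])
    (fun x y hxy => by
      rw [star_mul, star_star, mul_assoc, ← mul_assoc (star (x : K →L[ℂ] K)), hXr' x y hxy,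
        zero_mul, mul_zero])
    (fun x y hxy => by
      rw [star_mul, star_star, mul_assoc, ← mul_assoc (star (x : K →L[ℂ] K)), hXr' x y hxy,
        zero_mul, mul_zero])
  have hPx : ∀ x : X, P * (x : K →L[ℂ] K) = x := fun x => by
    have h1 := hP.mul_star x
    rw [star_mul, star_star, hXp] at h1
    have h2 := congrArg (fun t => t * (x : K →L[ℂ] K)) h1
    simp only [mul_assoc, (hX x x.2).2, hXe] at h2
    exact h2
  have hPP : P * P = P := hP.mul_eq_self fun x => by rw [← mul_assoc, hPx]
  have hPs : star P = P := by
    have h1 : star P * P = P := hP.mul_eq_self fun x => by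
      rw [hP.star_mul' x, star_mul, star_star, hXp]
    have h2 := congrArg star h1
    rw [star_mul, star_star, h1] at h2
    exact h2.symm
  set Q := 1 - P with hQ
  have hQS : Q ∈ S := sub_mem (one_mem S) hPS
  have hQs : star Q = Q := by rw [hQ, star_sub, star_one, hPs]
  have hQQ : Q * Q = Q := by rw [hQ, sub_mul, mul_sub, mul_sub, hPP, one_mul, mul_one, one_mul, sub_self, sub_zero]
  have hQx : ∀ x : X, Q * (x : K →L[ℂ] K) = 0 := fun x => by
    rw [hQ, sub_mul, one_mul, hPx, sub_self]
  obtain ⟨Y, hY, hYr, hYmax⟩ := exists_maximal_pairwise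
    (fun u : K →L[ℂ] K => u ∈ S ∧ u * star u * u = u ∧ u * e = u ∧ Q * u = u)
    (fun u u' => star u * u' = 0 ∧ u * star u' = 0)
  obtain ⟨V, hVS, hV⟩ := S.exists_isOrthogonalSum (v := fun x : Y => (x : K →L[ℂ] K))
    (fun x => (hY x x.2).1) (fun x => (hY x x.2).2.1)
    (fun x y hxy => (hYr x.2 y.2 (fun h => hxy (Subtype.ext h))).1)
    (fun x y hxy => (hYr x.2 y.2 (fun h => hxy (Subtype.ext h))).2)
  have hVe : V * e = V := hV.mul_eq_self' fun x => (hY x x.2).2.2.1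
  have hQV : Q * V = V := hV.mul_eq_self fun x => (hY x x.2).2.2.2
  have hVVV : V * star V * V = V := hV.mul_star_mul fun x => (hY x x.2).2.1
  have heV : e * star V = star V := by simpa [hes] using congrArg star hVe
  have hVQ : star V * Q = star V := by simpa [hQs] using congrArg star hQV
  set p := star V * V with hp
  have hpp : p * p = p := by rw [hp, mul_assoc, ← mul_assoc V, hVVV]
  have hps : star p = p := by rw [hp, star_mul, star_star]
  have hep' : e * p = p := by rw [hp, ← mul_assoc, heV]
  have hpe : p * e = p := by rw [hp, mul_assoc, hVe]
  have hpS : p ∈ S := mul_mem (star_mem hVS) hVS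
  have hVp : V * p = V := by rw [hp, ← mul_assoc, hVVV]
  -- If `V* V = e`, then `V` would be a further full copy of `e` with range under `Q`, against the
  -- maximality of `X`.
  have hpe0 : e - p ≠ 0 := by
    intro h0
    rw [sub_eq_zero] at h0
    have hVX : V ∈ X := by
      refine hXmax V ⟨hVS, by rw [h0]⟩ fun x hx => ?_
      have h1 : star V * x = 0 := by rw [← hVQ, mul_assoc, hQx ⟨x, hx⟩, mul_zero]
      exact ⟨by simpa using congrArg star h1, h1⟩
    have h1 := hQx ⟨V, hVX⟩
    rw [hQV] at h1
    apply he0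
    rw [h0, hp, h1, mul_zero]
  set e' := e - p with he'
  have he'S : e' ∈ S := sub_mem heS hpS
  have he'e : e' * e = e' := by rw [he', sub_mul, hee, hpe]
  have hee' : e * e' = e' := by rw [he', mul_sub, hee, hep']
  have he's : star e' = e' := by rw [he', star_sub, hes, hps]
  set R := Q - V * star V with hR
  have hRs : star R = R := by rw [hR, star_sub, hQs, star_mul, star_star]
  have hRS : R ∈ S := sub_mem hQS (mul_mem hVS (star_mem hVS))
  have hQR : Q * R = R := by rw [hR, mul_sub, hQQ, ← mul_assoc, hQV]
  -- Otherwise the phase of `R b e'` would map a part of `e'` into the unfilled part `R` of `Q` and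
  -- enlarge `Y`.
  have hRe : ∀ b ∈ S, R * b * e' = 0 := by
    intro b hb
    by_contra h0
    obtain ⟨w, hwS, hwa, hww, hwr, hwl⟩ := S.exists_phase (mul_mem (mul_mem hRS hb) he'S)
    have he'e' : e' * e' = e' := by
      conv_lhs => rw [he', sub_mul, hee', ← he', he', mul_sub, hpp, hpe, sub_self, sub_zero]
    have hwe' : w * e' = w := by
      have := hwr (1 - e') (by rw [mul_assoc, mul_sub, mul_one, he'e', sub_self, mul_zero])
      rw [mul_sub, mul_one, sub_eq_zero] at this
      exact this.symm
    have hRR : R * R = R := by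
      conv_lhs => rw [hR, sub_mul, hQR, hR, mul_sub, mul_assoc V, hVQ, ← mul_assoc, hVVV,
        sub_self, sub_zero]
    have hRw : R * w = w := by
      have := hwl (1 - R) (by rw [sub_mul, one_mul, ← mul_assoc, ← mul_assoc, hRR, sub_self])
      rw [sub_mul, one_mul, sub_eq_zero] at this
      exact this.symm
    have hyw : ∀ y : Y, star (y : K →L[ℂ] K) * w = 0 ∧ (y : K →L[ℂ] K) * star w = 0 := by
      intro y
      constructor
      · have h1 : R * (y : K →L[ℂ] K) = 0 := by
          rw [hR, sub_mul, (hY y y.2).2.2.2, mul_assoc, hV.star_mul', ← mul_assoc, hV.mul_star,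
            (hY y y.2).2.1, sub_self]
        have h2 : star (y : K →L[ℂ] K) * R = 0 := by simpa [hRs] using congrArg star h1
        rw [← hRw, ← mul_assoc, h2, zero_mul]
      · have h1 : (y : K →L[ℂ] K) * e' = 0 := by
          rw [he', mul_sub, (hY y y.2).2.2.1, hp, ← mul_assoc, hV.mul_star', mul_assoc, hV.star_mul,
            ← mul_assoc, (hY y y.2).2.1, sub_self]
        have h2 : e' * star w = star w := by simpa [he's] using congrArg star hwe'
        rw [← h2, ← mul_assoc, h1, zero_mul]
    have hwY : w ∈ Y := by
      refine hYmax w ⟨hwS, hww, ?_, ?_⟩ fun y hy => ⟨hyw ⟨y, hy⟩, ?_, ?_⟩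
      · rw [← hwe', mul_assoc, he'e]
      · rw [← hRw, ← mul_assoc, hQR]
      · simpa using congrArg star (hyw ⟨y, hy⟩).1
      · simpa using congrArg star (hyw ⟨y, hy⟩).2
    have hw0 : w = 0 := (CStarRing.star_mul_self_eq_zero_iff _).1 (hyw ⟨w, hwY⟩).1
    apply h0
    rw [← hwa, hw0, zero_mul]
  obtain ⟨c, hcS, hcS', hc, hce, hcann⟩ := S.exists_centralSupport he'S
  have hcs : star c = c := hc.isSelfAdjoint.star_eq
  have hRc : R * c = 0 := hcann R hRe
  -- Only here does it matter that `e` is abelian: orthogonal subprojections of `e`, such as `p` and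
  -- `e'`, satisfy `p S e' = 0`. Hence `V` vanishes on `c`, and with `R c = 0` so does `Q`.
  have hpc : p * c = 0 := by
    refine hcann p fun b hb => ?_
    have h1 := hecomm b hb e' he'S
    have h2 : e * e' * e = e' := by rw [hee', he'e]
    rw [h2] at h1
    calc p * b * e' = p * ((e * b * e) * e') := by
          rw [mul_assoc (e * b), hee', mul_assoc e, ← mul_assoc p e, hpe, mul_assoc]
      _ = (p * e') * (e * b * e) := by rw [h1, ← mul_assoc p]
      _ = 0 := by rw [he', mul_sub, hpe, hpp, sub_self, zero_mul]
  have hVc : V * c = 0 := by rw [← hVp, mul_assoc, hpc, mul_zero]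
  have hcP : c * P = c := by
    have h1 : Q * c = 0 := by
      rw [hR, sub_mul, mul_assoc, commute_of_mem_commutant (star_mem hVS) hcS', ← mul_assoc, hVc,
        zero_mul, sub_zero] at hRc
      exact hRc
    rw [hQ, sub_mul, one_mul, sub_eq_zero] at h1
    rw [← commute_of_mem_commutant hPS hcS', ← h1]
  have hc0 : c ≠ 0 := fun h => hpe0 (by rw [← hce, h, zero_mul])
  refine ⟨c, hcS, hcS', hc, hc0, fun f hf => hcann f fun a ha => ?_, ?_⟩
  · rw [← hee', ← mul_assoc, hf a ha, zero_mul]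
  · rcases finite_or_infinite X with hfin | hinf
    · have := Fintype.ofFinite X
      exact absurd (hS _ _ (S.isTypeISummand_of_fintype he (fun x : X => (hX x x.2).1)
        (fun x => (hX x x.2).2) hXr' hc hcS hcS' hP hcP)) hc0
    · exact S.exists_isometries_of_infinite hep (fun x : X => (hX x x.2).1)
        (fun x => (hX x x.2).2) hXr' hc hcS hcS' hP hcP

/-- A von Neumann algebra without summands of finite type `I` is the direct sum of a summand that
contains two isometries with orthogonal ranges and of one without abelian projections. -/
theorem exists_central_decomposition (S : VonNeumannAlgebra K) (hS : HasNoFiniteTypeISummand S) :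
    ∃ z ∈ S, z ∈ S.commutant ∧ IsStarProjection z ∧
      (∃ v₁ ∈ S, ∃ v₂ ∈ S, star v₁ * v₁ = z ∧ star v₂ * v₂ = z ∧ star v₁ * v₂ = 0) ∧
      ∀ e, IsAbelianProjection S e → e * z = 0 → e = 0 := by
  -- A member is a pair of partial isometries with orthogonal ranges and the same central initial
  -- projection `ζ`; different `ζ` are orthogonal. Sums over such a family give the pair for `z = ∑
  -- ζ`.
  obtain ⟨X, hX, hXr, hXmax⟩ := exists_maximal_pairwise
    (fun x : (K →L[ℂ] K) × (K →L[ℂ] K) => x.1 ∈ S ∧ x.2 ∈ S ∧ star x.1 * x.1 ∈ S.commutant ∧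
      IsStarProjection (star x.1 * x.1) ∧ star x.2 * x.2 = star x.1 * x.1 ∧ star x.1 * x.2 = 0)
    (fun x y => (star x.1 * x.1) * (star y.1 * y.1) = 0)
  set ζ : X → K →L[ℂ] K := fun x => star (x : (K →L[ℂ] K) × (K →L[ℂ] K)).1 * x.1.1 with hζ
  have hζp : ∀ x, IsStarProjection (ζ x) := fun x => (hX x x.2).2.2.2.1
  have hζs : ∀ x, star (ζ x) = ζ x := fun x => (hζp x).isSelfAdjoint.star_eq
  have hζζ : ∀ x, ζ x * ζ x = ζ x := fun x => (hζp x).isIdempotentElem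
  have hζS' : ∀ x, ζ x ∈ S.commutant := fun x => (hX x x.2).2.2.1
  have hζS : ∀ x, ζ x ∈ S := fun x => mul_mem (star_mem (hX x x.2).1) (hX x x.2).1
  have hζr : ∀ x y, x ≠ y → ζ x * ζ y = 0 := fun x y hxy =>
    hXr x.2 y.2 fun h => hxy (Subtype.ext h)
  obtain ⟨z, hzS, hz⟩ := S.exists_isOrthogonalSum hζS
    (fun x => by rw [hζs, hζζ, hζζ])
    (fun x y hxy => by rw [hζs, hζr x y hxy]) (fun x y hxy => by rw [hζs, hζr x y hxy])
  have hzζ : ∀ x, z * ζ x = ζ x := fun x => by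
    have := hz.mul_star x
    rwa [hζs, hζζ] at this
  have hζz : ∀ x, ζ x * z = ζ x := fun x => by
    have := hz.star_mul x
    rwa [hζs, hζζ] at this
  have hzS' : z ∈ S.commutant := mem_commutant_iff.2 fun y hy =>
    hz.comm y y fun x => commute_of_mem_commutant hy (hζS' x)
  have hzz : z * z = z := hz.mul_eq_self hzζ
  have hzs : star z = z := by
    have h1 : star z * z = z := hz.mul_eq_self fun x => by
      rw [hz.star_mul', hζs, hζζ]
    have h2 := congrArg star h1
    rw [star_mul, star_star, h1] at h2
    exact h2.symm
  have key : ∀ v : X → K →L[ℂ] K, (∀ x, v x ∈ S) → (∀ x, star (v x) * v x = ζ x) →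
      ∃ V ∈ S, IsOrthogonalSum v V ∧ star V * V = z ∧ ∀ x, V * ζ x = v x := by
    intro v hvS hv
    have hvζ : ∀ x, v x * ζ x = v x := fun x => mul_eq_self_of_star_mul_self (hζp x) (hv x)
    have hζv : ∀ x, ζ x * v x = v x := fun x => by
      rw [← commute_of_mem_commutant (hvS x) (hζS' x), hvζ]
    have hvζ' : ∀ x, star (v x) * ζ x = star (v x) := fun x => by
      simpa [hζs] using congrArg star (hζv x)
    have hζv' : ∀ x, ζ x * star (v x) = star (v x) := fun x => by
      simpa [hζs] using congrArg star (hvζ x)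
    obtain ⟨V, hVS, hV⟩ := S.exists_isOrthogonalSum hvS
      (fun x => partialIsometry_of_star_mul_self (hζp x) (hv x))
      (fun x y hxy => by
        rw [← hvζ', ← hζv y, mul_assoc, ← mul_assoc (ζ x), hζr x y hxy, zero_mul, mul_zero])
      (fun x y hxy => by
        rw [← hvζ, ← hζv' y, mul_assoc, ← mul_assoc (ζ x), hζr x y hxy, zero_mul, mul_zero])
    have hVζ : ∀ x, V * ζ x = v x := fun x => by
      rw [← hv, ← mul_assoc, hV.mul_star, mul_assoc, hv, hvζ]
    refine ⟨V, hVS, hV, ?_, hVζ⟩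
    have hVz : V * z = V := hV.mul_eq_self' fun x => by
      rw [← hvζ, mul_assoc, hζz]
    have h1 : (star V * V - 1) * z = 0 := hz.mul_eq_zero fun x => by
      rw [sub_mul, mul_assoc, hVζ, hV.star_mul', hv, one_mul, sub_self]
    rw [sub_mul, one_mul, mul_assoc, hVz, sub_eq_zero] at h1
    exact h1
  obtain ⟨V₁, h₁S, h₁, h₁z, h₁ζ⟩ := key (fun x => (x : (K →L[ℂ] K) × (K →L[ℂ] K)).1)
    (fun x => (hX x x.2).1) (fun x => rfl)
  obtain ⟨V₂, h₂S, h₂, h₂z, h₂ζ⟩ := key (fun x => (x : (K →L[ℂ] K) × (K →L[ℂ] K)).2)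
    (fun x => (hX x x.2).2.1) (fun x => (hX x x.2).2.2.2.2.1)
  refine ⟨z, hzS, hzS', ⟨hzz, hzs⟩, ⟨V₁, h₁S, V₂, h₂S, h₁z, h₂z, ?_⟩, fun e he hez => ?_⟩
  · refine h₂.mul_eq_zero fun x => ?_
    have h3 : ζ x * (x : (K →L[ℂ] K) × (K →L[ℂ] K)).2 = (x : (K →L[ℂ] K) × (K →L[ℂ] K)).2 := by
      rw [← commute_of_mem_commutant (hX x x.2).2.1 (hζS' x)]
      exact mul_eq_self_of_star_mul_self (hζp x) (hX x x.2).2.2.2.2.1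
    have h4 : star V₁ * ζ x = star (x : (K →L[ℂ] K) × (K →L[ℂ] K)).1 := by
      rw [← h₁ζ, commute_of_mem_commutant h₁S (hζS' x), star_mul, hζs]
    rw [← h3, ← mul_assoc, h4]
    exact (hX x x.2).2.2.2.2.2
  · by_contra he0
    obtain ⟨c, hcS, hcS', hc, hc0, hcann, v₁, h1S, v₂, h2S, h1, h2, h12⟩ :=
      S.exists_isometries_of_abelian hS he he0
    -- The central projection `ζ x` kills `e`, hence every `a e`, and so kills `c`, which lies below
    -- the central support of `e`. The new pair is then compatible with the family.
    have hζc : ∀ x, ζ x * c = 0 := fun x => hcann _ fun a ha => by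
      have h3 : ζ x * e = 0 := by
        rw [← commute_of_mem_commutant he.1 (hζS' x), ← hzζ, ← mul_assoc, hez, zero_mul]
      rw [← commute_of_mem_commutant ha (hζS' x), mul_assoc, h3, mul_zero]
    have hcζ : ∀ x, c * ζ x = 0 := fun x => by
      rw [commute_of_mem_commutant hcS (hζS' x), hζc]
    have hmem : (v₁, v₂) ∈ X := by
      refine hXmax _ ⟨h1S, h2S, ?_, ?_, ?_, h12⟩ fun x hx => ⟨?_, ?_⟩
      · rwa [h1]
      · rwa [h1]
      · rw [h1, h2]
      · change ζ ⟨x, hx⟩ * (star v₁ * v₁) = 0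
        rw [h1, hζc]
      · change (star v₁ * v₁) * ζ ⟨x, hx⟩ = 0
        rw [h1, hcζ]
    apply hc0
    have h3 := hζc ⟨_, hmem⟩
    simp only [hζ, h1] at h3
    rwa [hc.isIdempotentElem.eq] at h3

end VonNeumannAlgebra
end

/-! ### Finite-dimensional *-algebras and their relative commutants -/

/-- Choose `s` so that the subspace of `F` annihilating it has least dimension. If it contained `a ≠
0`, adding a vector with `a x ≠ 0` would lower the dimension. -/
theorem exists_separating_finset {K : Type*} [NormedAddCommGroup K] [InnerProductSpace ℂ K]
    (F : Submodule ℂ (K →L[ℂ] K)) [FiniteDimensional ℂ F] :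
    ∃ s : Finset K, ∀ a ∈ F, (∀ x ∈ s, a x = 0) → a = 0 := by
  classical
  let N : Finset K → Submodule ℂ F := fun s =>
    { carrier := {a | ∀ x ∈ s, (a : K →L[ℂ] K) x = 0}
      add_mem' := fun {a b} ha hb x hx => by simp [ha x hx, hb x hx]
      zero_mem' := fun x hx => by simp
      smul_mem' := fun c a ha x hx => by simp [ha x hx] }
  have hex : ∃ n, ∃ s, Module.finrank ℂ (N s) = n := ⟨_, ∅, rfl⟩
  obtain ⟨s, hs⟩ := Nat.find_spec hex
  refine ⟨s, fun a ha has => ?_⟩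
  by_contra ha0
  obtain ⟨x, hx⟩ : ∃ x, a x ≠ 0 := by
    by_contra! h
    exact ha0 (ContinuousLinearMap.ext h)
  have hlt : N (insert x s) < N s := by
    refine lt_of_le_of_ne (fun b hb y hy => hb y (Finset.mem_insert_of_mem hy)) fun h => hx ?_
    have h1 : (⟨a, ha⟩ : F) ∈ N s := has
    rw [← h] at h1
    exact h1 x (Finset.mem_insert_self x s)
  have h1 := Submodule.finrank_lt_finrank_of_lt hlt
  have h2 := Nat.find_min' hex ⟨insert x s, rfl⟩
  omega

section
variable {K : Type*} [NormedAddCommGroup K] [InnerProductSpace ℂ K] [CompleteSpace K]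

namespace VonNeumannAlgebra

/-- The relative commutant `F' ∩ S`. -/
def relativeCommutant (S : VonNeumannAlgebra K) (F : StarSubalgebra ℂ (K →L[ℂ] K)) :
    VonNeumannAlgebra K :=
  (generatedVonNeumannAlgebra ((F : Set (K →L[ℂ] K)) ∪ S.commutant)).commutant

theorem mem_relativeCommutant {S : VonNeumannAlgebra K} {F : StarSubalgebra ℂ (K →L[ℂ] K)}
    {x : K →L[ℂ] K} : x ∈ S.relativeCommutant F ↔ x ∈ S ∧ ∀ f ∈ F, f * x = x * f := by
  have hsub := subset_generatedVonNeumannAlgebra ((F : Set (K →L[ℂ] K)) ∪ S.commutant)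
  constructor
  · intro hx
    rw [relativeCommutant, mem_commutant_iff] at hx
    exact ⟨S.mem_of_commute fun y hy => hx y (hsub (Or.inr hy)), fun f hf => hx f (hsub (Or.inl hf))⟩
  · rintro ⟨hxS, hxF⟩
    rw [relativeCommutant, mem_commutant_iff]
    have hx : x ∈ StarSubalgebra.centralizer ℂ ((F : Set (K →L[ℂ] K)) ∪ S.commutant) := by
      rw [StarSubalgebra.mem_centralizer_iff]
      rintro g (hg | hg)
      · exact ⟨hxF g hg, hxF _ (star_mem (s := F) hg)⟩
      · exact ⟨(commute_of_mem_commutant hxS hg).symm,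
          (commute_of_mem_commutant hxS (star_mem (s := S.commutant) hg)).symm⟩
    intro g hg
    have hg' : g ∈ StarSubalgebra.centralizer ℂ
      (StarSubalgebra.centralizer ℂ ((F : Set (K →L[ℂ] K)) ∪ S.commutant) : Set (K →L[ℂ] K)) := hg
    rw [StarSubalgebra.mem_centralizer_iff] at hg'
    exact (hg' x hx).1.symm

end VonNeumannAlgebra

/-- A finite-dimensional `*`-algebra of operators has a separability element of the form
`∑ uᵢ ⊗ uᵢ*`, where the `uᵢ` span the algebra. -/
theorem exists_casimir (F : StarSubalgebra ℂ (K →L[ℂ] K)) [FiniteDimensional ℂ F] :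
    ∃ (m : ℕ) (u : Fin m → K →L[ℂ] K), (∀ i, u i ∈ F) ∧
      (∀ f ∈ F, ∃ c : Fin m → ℂ, f = ∑ i, c i • u i) ∧
      ∀ a ∈ F, ∀ y : K →L[ℂ] K,
        a * ∑ i, u i * y * star (u i) = (∑ i, u i * y * star (u i)) * a := by
  classical
  set N := Subalgebra.toSubmodule F.toSubalgebra with hN
  have hNfin : FiniteDimensional ℂ N := ‹FiniteDimensional ℂ F›
  have hNF : ∀ {x}, x ∈ N ↔ x ∈ F := Iff.rfl
  obtain ⟨s, hs⟩ := exists_separating_finset N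
  -- Evaluation at the separating vectors gives `F` the inner product `∑ₓ ⟪a x, b x⟫`; the `uᵢ` will
  -- be an orthonormal basis for it.
  let T : (K →L[ℂ] K) →ₗ[ℂ] PiLp 2 (fun _ : s => K) :=
    { toFun := fun a => WithLp.toLp 2 fun x => a x
      map_add' := fun a b => rfl
      map_smul' := fun c a => rfl }
  have hT : ∀ a ∈ N, ∀ b ∈ N, T a = T b → a = b := by
    intro a ha b hb hab
    rw [← sub_eq_zero]
    refine hs _ (N.sub_mem ha hb) fun x hx => ?_
    exact sub_eq_zero.2 (congrArg (fun v : PiLp 2 (fun _ : s => K) => v ⟨x, hx⟩) hab)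
  have hTinner : ∀ a b c : K →L[ℂ] K,
      (inner ℂ (T b) (T (a * c)) : ℂ) = inner ℂ (T (star a * b)) (T c) := by
    intro a b c
    rw [PiLp.inner_apply, PiLp.inner_apply]
    refine Finset.sum_congr rfl fun x _ => ?_
    change inner ℂ (b x) (a (c x)) = inner ℂ (star a (b x)) (c x)
    rw [ContinuousLinearMap.star_eq_adjoint, ContinuousLinearMap.adjoint_inner_left]
  let b := stdOrthonormalBasis ℂ (N.map T)
  have hex : ∀ i, ∃ u ∈ N, T u = b i := fun i => (b i).2
  choose u huN huT using hex
  have hu : ∀ f ∈ N, f = ∑ i, (inner ℂ (T (u i)) (T f) : ℂ) • u i := by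
    intro f hf
    refine hT _ hf _ (N.sum_mem fun i _ => N.smul_mem _ (huN i)) ?_
    have h1 := b.sum_repr ⟨T f, Submodule.mem_map_of_mem hf⟩
    have h2 := congrArg (Submodule.subtype _) h1
    rw [map_sum] at h2
    rw [map_sum]
    refine h2.symm.trans (Finset.sum_congr rfl fun i _ => ?_)
    rw [map_smul, map_smul, b.repr_apply_apply, Submodule.coe_inner, huT]
    rfl
  refine ⟨_, u, fun i => huN i, fun f hf => ⟨_, hu f hf⟩, fun a ha y => ?_⟩
  have h1 : ∀ i, a * u i = ∑ j, (inner ℂ (T (u j)) (T (a * u i)) : ℂ) • u j := fun i =>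
    hu _ (mul_mem (S := StarSubalgebra ℂ (K →L[ℂ] K)) (s := F) ha (huN i))
  -- Left multiplications by `a` and `a*` are adjoint for this inner product, so `uⱼ* a` expands
  -- with the same matrix coefficients as `a uᵢ`. This is what makes the sum central for `F`.
  have h2 : ∀ j, star (u j) * a =
      ∑ i, (inner ℂ (T (u j)) (T (a * u i)) : ℂ) • star (u i) := fun j => by
    have h3 : star (star a * u j) = star (u j) * a := by rw [star_mul, star_star]
    rw [← h3]
    conv_lhs => rw [hu _ (mul_mem (S := StarSubalgebra ℂ (K →L[ℂ] K)) (s := F)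
      (star_mem (s := F) ha) (huN j))]
    rw [star_sum]
    refine Finset.sum_congr rfl fun i _ => ?_
    rw [star_smul, hTinner, Complex.star_def, inner_conj_symm, star_star]
  rw [Finset.mul_sum, Finset.sum_mul]
  have h4 : ∀ i, a * (u i * y * star (u i)) =
      ∑ j, (inner ℂ (T (u j)) (T (a * u i)) : ℂ) • (u j * y * star (u i)) := fun i => by
    rw [← mul_assoc, ← mul_assoc]
    conv_lhs => rw [h1 i, Finset.sum_mul, Finset.sum_mul]
    simp only [smul_mul_assoc]
  have h5 : ∀ j, u j * y * star (u j) * a =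
      ∑ i, (inner ℂ (T (u j)) (T (a * u i)) : ℂ) • (u j * y * star (u i)) := fun j => by
    rw [mul_assoc, h2 j, Finset.mul_sum]
    simp only [mul_smul_comm]
  rw [Finset.sum_congr rfl fun i _ => h4 i, Finset.sum_congr rfl fun j _ => h5 j, Finset.sum_comm]

theorem finite_spectrum_of_mem (F : StarSubalgebra ℂ (K →L[ℂ] K)) [FiniteDimensional ℂ F]
    {h : K →L[ℂ] K} (hF : h ∈ F) : (spectrum ℝ h).Finite := by
  have h1 : IsIntegral ℂ (⟨h, hF⟩ : F) := IsIntegral.of_finite ℂ _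
  obtain ⟨p, hp, hp0⟩ := h1
  have h2 : Polynomial.aeval h p = 0 := by
    have := congrArg F.subtype hp0
    rw [← Polynomial.aeval_def] at this
    have h3 := Polynomial.aeval_algHom_apply (F.subtype : F →ₐ[ℂ] (K →L[ℂ] K)) ⟨h, hF⟩ p
    rw [map_zero] at this
    exact h3.trans this
  have h4 : (spectrum ℂ h).Finite := by
    refine Set.Finite.subset (Polynomial.finite_setOfPred_isRoot hp.ne_zero) fun k hk => ?_
    have h5 := spectrum.subset_polynomial_aeval h p ⟨k, hk, rfl⟩
    rw [h2] at h5
    by_contra h6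
    refine h5 ?_
    rw [spectrum.mem_resolventSet_iff, sub_zero]
    exact (IsUnit.mk0 _ h6).map (algebraMap ℂ (K →L[ℂ] K))
  rw [← spectrum.preimage_algebraMap ℂ]
  exact h4.preimage (FaithfulSMul.algebraMap_injective ℝ ℂ).injOn

/-- The spectral projections of a selfadjoint element of a finite-dimensional `*`-algebra. -/
theorem exists_spectral_projections (F : StarSubalgebra ℂ (K →L[ℂ] K)) [FiniteDimensional ℂ F]
    {h : K →L[ℂ] K} (hF : h ∈ F) (hh : IsSelfAdjoint h) :
    ∃ (s : Finset ℝ) (g : ℝ → K →L[ℂ] K), (∀ t ∈ s, g t ∈ F ∧ IsStarProjection (g t) ∧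
      h * g t = t • g t ∧ ∀ y, Commute h y → Commute (g t) y) ∧ ∑ t ∈ s, g t = 1 := by
  classical
  have hfin := finite_spectrum_of_mem F hF
  have hcont : ∀ f : ℝ → ℝ, ContinuousOn f (spectrum ℝ h) := fun f => hfin.continuousOn f
  have hclosed : IsClosed (F : Set (K →L[ℂ] K)) :=
    Submodule.closed_of_finiteDimensional (Subalgebra.toSubmodule F.toSubalgebra)
  refine ⟨hfin.toFinset, fun t => cfc (fun r : ℝ => if r = t then (1 : ℝ) else 0) h,
    fun t ht => ⟨cfc_mem (𝕜' := ℂ) _ hF, ⟨?_, cfc_predicate _ h⟩, ?_, fun y hy => hy.cfc_real _⟩, ?_⟩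
  · rw [IsIdempotentElem, ← cfc_mul _ _ h (hcont _) (hcont _)]
    congr 1
    ext r
    split_ifs <;> simp
  · have h1 : h * cfc (fun r : ℝ => if r = t then (1 : ℝ) else 0) h =
        cfc (fun r : ℝ => r) h * cfc (fun r : ℝ => if r = t then (1 : ℝ) else 0) h := by
      rw [cfc_id' ℝ h hh]
    refine h1.trans ?_
    rw [← cfc_mul _ _ h (hcont _) (hcont _), ← cfc_smul t _ h (hcont _)]
    congr 1
    ext r
    split_ifs with hr <;> simp [hr]
  · rw [← cfc_sum _ h _ (fun _ _ => hcont _)]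
    rw [← cfc_one ℝ h hh]
    refine cfc_congr fun r hr => ?_
    simp [hr]

/-- Among the projections of `F` with `e f ≠ 0`, take one whose left ideal `F f` has least
dimension. For selfadjoint `h` in `f F f` some spectral projection `g` has `e f g ≠ 0`; minimality
gives `f g = f`, so `h` is a multiple of `f`. -/
theorem exists_minimal_projection (F : StarSubalgebra ℂ (K →L[ℂ] K)) [FiniteDimensional ℂ F]
    {e : K →L[ℂ] K} (he : e ≠ 0) :
    ∃ f ∈ F, IsStarProjection f ∧ e * f ≠ 0 ∧ ∀ a ∈ F, ∃ c : ℂ, f * a * f = c • f := by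
  classical
  let J : (K →L[ℂ] K) → Submodule ℂ F := fun f =>
    { carrier := {x | (x : K →L[ℂ] K) * f = x}
      add_mem' := fun {a b} ha hb => by
        simp only [Set.mem_ofPred_eq] at ha hb ⊢
        rw [AddMemClass.coe_add, add_mul, ha, hb]
      zero_mem' := by simp
      smul_mem' := fun c a ha => by
        simp only [Set.mem_ofPred_eq] at ha ⊢
        rw [SetLike.val_smul, smul_mul_assoc, ha] }
  have hex : ∃ n, ∃ f ∈ F, IsStarProjection f ∧ e * f ≠ 0 ∧ Module.finrank ℂ (J f) = n :=
    ⟨_, 1, one_mem F, IsStarProjection.one _, by simpa using he, rfl⟩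
  obtain ⟨f, hfF, hf, hef, hfn⟩ := Nat.find_spec hex
  have hff : f * f = f := hf.isIdempotentElem
  have hfs : star f = f := hf.isSelfAdjoint.star_eq
  have hmin : ∀ f' ∈ F, IsStarProjection f' → e * f' ≠ 0 → f' * f = f' → f' = f := by
    intro f' hf'F hf' hef' hf'f
    by_contra hne
    have hlt : J f' < J f := by
      refine lt_of_le_of_ne (fun x hx => ?_) fun h => hne ?_
      · change (x : K →L[ℂ] K) * f' = x at hx
        change (x : K →L[ℂ] K) * f = x
        rw [← hx, mul_assoc, hf'f]
      · have h1 : (⟨f, hfF⟩ : F) ∈ J f := hff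
        rw [← h] at h1
        have h2 : f * f' = f := h1
        have h3 := congrArg star h2
        rw [star_mul, hfs, hf'.isSelfAdjoint.star_eq, hf'f] at h3
        exact h3
    have h1 := Submodule.finrank_lt_finrank_of_lt hlt
    have h2 := Nat.find_min' hex ⟨f', hf'F, hf', hef', rfl⟩
    omega
  have hsa : ∀ h ∈ F, IsSelfAdjoint h → ∃ c : ℂ, f * h * f = c • f := by
    intro h₀ hF₀ hh₀
    set h := f * h₀ * f with hdef
    have hF : h ∈ F := mul_mem (mul_mem hfF hF₀) hfF
    have hh : IsSelfAdjoint h := by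
      rw [isSelfAdjoint_iff, hdef, star_mul, star_mul, hfs, hh₀.star_eq, mul_assoc]
    have hhf : h * f = h := by rw [hdef, mul_assoc, hff]
    have hfh : f * h = h := by rw [hdef, ← mul_assoc, ← mul_assoc, hff]
    obtain ⟨s, g, hg, hsum⟩ := exists_spectral_projections F hF hh
    obtain ⟨t, hts, ht⟩ : ∃ t ∈ s, e * (f * g t) ≠ 0 := by
      by_contra! hcon
      apply hef
      rw [← mul_one (e * f), ← hsum, Finset.mul_sum]
      exact Finset.sum_eq_zero fun t ht => by rw [mul_assoc, hcon t ht]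
    obtain ⟨hgF, hgp, hhg, hgc⟩ := hg t hts
    have hgf : g t * f = f * g t := hgc f (by rw [commute_iff_eq, hhf, hfh])
    have h1 : f * g t = f := by
      refine hmin _ (mul_mem hfF hgF) ⟨?_, ?_⟩ ht ?_
      · rw [IsIdempotentElem, mul_assoc, ← mul_assoc (g t), hgf, mul_assoc f (g t),
          hgp.isIdempotentElem.eq, ← mul_assoc, hff]
      · rw [isSelfAdjoint_iff, star_mul, hfs, hgp.isSelfAdjoint.star_eq, hgf]
      · rw [mul_assoc, hgf, ← mul_assoc, hff]
    refine ⟨(t : ℂ), ?_⟩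
    rw [← hhf]
    conv_lhs => rw [← h1, ← hgf, ← mul_assoc, hhg, smul_mul_assoc, hgf, h1]
    rfl
  refine ⟨f, hfF, hf, hef, fun a ha => ?_⟩
  obtain ⟨c, hc⟩ := hsa (a + star a) (add_mem ha (star_mem ha)) (IsSelfAdjoint.add_star_self a)
  obtain ⟨d, hd⟩ := hsa (Complex.I • (a - star a))
    (F.smul_mem (sub_mem ha (star_mem ha)) _) (by
      simp only [isSelfAdjoint_iff, star_smul, star_sub, star_star, Complex.star_def,
        Complex.conj_I]
      module)
  refine ⟨(1 / 2 : ℂ) * c + (-Complex.I / 2) * d, ?_⟩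
  have h4 : (1 / 2 : ℂ) • (a + star a) + (-Complex.I / 2) • Complex.I • (a - star a) = a := by
    rw [smul_smul, show -Complex.I / 2 * Complex.I = 1 / 2 by
      rw [div_mul_eq_mul_div, neg_mul, Complex.I_mul_I, neg_neg]]
    module
  conv_lhs => rw [← h4]
  rw [mul_add, add_mul, mul_smul_comm, smul_mul_assoc, hc, mul_smul_comm (-Complex.I / 2),
    smul_mul_assoc, hd, add_smul, mul_smul, mul_smul]

/-- Passing to the relative commutant of a finite-dimensional subalgebra creates no abelian
projections. -/
theorem VonNeumannAlgebra.eq_zero_of_isAbelianProjection_relativeCommutant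
    (S : VonNeumannAlgebra K) (F : StarSubalgebra ℂ (K →L[ℂ] K)) [FiniteDimensional ℂ F]
    (hFS : ∀ f ∈ F, f ∈ S) {z : K →L[ℂ] K}
    (hz : ∀ q, IsAbelianProjection S q → q * z = 0 → q = 0) {e : K →L[ℂ] K}
    (he : IsAbelianProjection (S.relativeCommutant F) e) (hez : e * z = 0) : e = 0 := by
  by_contra he0
  obtain ⟨heT, hep, hecomm⟩ := he
  obtain ⟨heS, heF⟩ := mem_relativeCommutant.1 heT
  obtain ⟨f, hfF, hf, hef, hmin⟩ := exists_minimal_projection F he0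
  obtain ⟨m, u, huF, huspan, hucomm⟩ := exists_casimir F
  have hff : f * f = f := hf.isIdempotentElem
  have hfs : star f = f := hf.isSelfAdjoint.star_eq
  have hee : e * e = e := hep.isIdempotentElem
  have hes : star e = e := hep.isSelfAdjoint.star_eq
  have hfe : f * e = e * f := heF f hfF
  choose! l hl using hmin
  obtain ⟨q, hq⟩ : ∃ q, q = e * f := ⟨_, rfl⟩
  rw [← hq] at hef
  have hqS : q ∈ S := hq ▸ mul_mem heS (hFS f hfF)
  have hqp : IsStarProjection q := by
    constructor
    · rw [IsIdempotentElem, hq, mul_assoc, ← mul_assoc f, hfe, mul_assoc e f, hff, ← mul_assoc, hee]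
    · rw [isSelfAdjoint_iff, hq, star_mul, hfs, hes, hfe]
  have hfu : ∀ i, f * star (u i) * f = star (l (u i)) • f := fun i => by
    have := congrArg star (hl (u i) (huF i))
    rwa [star_mul, star_mul, hfs, star_smul, hfs, ← mul_assoc] at this
  obtain ⟨E, hE⟩ : ∃ E : (K →L[ℂ] K) → K →L[ℂ] K, ∀ y, E y = ∑ i, u i * y * star (u i) :=
    ⟨_, fun _ => rfl⟩
  have hEcomm : ∀ g ∈ F, ∀ y, g * E y = E y * g := fun g hg y => by rw [hE, hucomm g hg]
  set κ : ℂ := ∑ i, l (u i) * star (l (u i)) with hκ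
  -- `κ = ∑ |l(uᵢ)|²` vanishes only if `f uᵢ f = 0` for all `i`; since the `uᵢ` span `F`, this would
  -- give `f = 0`.
  have hκ0 : κ ≠ 0 := by
    intro h0
    have h1 : ∀ i, l (u i) = 0 := by
      have h2 : ∑ i, ‖l (u i)‖ ^ 2 = 0 := by
        have h3 : κ = ((∑ i, ‖l (u i)‖ ^ 2 : ℝ) : ℂ) := by
          rw [hκ]
          push_cast
          refine Finset.sum_congr rfl fun i _ => ?_
          rw [Complex.star_def, Complex.mul_conj']
        rw [h3] at h0
        exact_mod_cast h0
      intro i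
      have := (Finset.sum_eq_zero_iff_of_nonneg fun i _ => by positivity).1 h2 i (Finset.mem_univ i)
      simpa using this
    obtain ⟨c, hc⟩ := huspan f hfF
    have h4 : f * (∑ i, c i • u i) * f = 0 := by
      rw [Finset.mul_sum, Finset.sum_mul]
      refine Finset.sum_eq_zero fun i _ => ?_
      rw [mul_smul_comm, smul_mul_assoc, hl _ (huF i), h1, zero_smul, smul_zero]
    have h2 : f = 0 := by rwa [← hc, hff, hff] at h4
    apply hef
    rw [hq, h2, mul_zero]
  -- Averaging moves `q a q` into `F' ∩ S`, and compression by `f` recovers it up to `κ`. So the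
  -- commutativity of the corner of `e` in `F' ∩ S` passes to the corner of `q = e f` in `S`.
  have hfE : ∀ a, f * E (q * a * q) * f = κ • (q * a * q) := by
    intro a
    rw [hE, hκ, Finset.mul_sum, Finset.sum_mul, Finset.sum_smul]
    refine Finset.sum_congr rfl fun i _ => ?_
    calc f * (u i * (q * a * q) * star (u i)) * f
        = f * (u i * ((f * e) * a * (e * f)) * star (u i)) * f := by rw [hfe, hq]
      _ = (f * u i * f) * (e * a * e) * (f * star (u i) * f) := by simp only [mul_assoc]
      _ = (l (u i) * star (l (u i))) • ((f * e) * a * (e * f)) := by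
          rw [hl _ (huF i), hfu, mul_smul_comm, smul_mul_assoc, smul_mul_assoc, smul_smul, mul_comm]
          simp only [mul_assoc]
      _ = _ := by rw [hfe, hq]
  have hET : ∀ a ∈ S, E (q * a * q) ∈ S.relativeCommutant F := fun a ha => by
    refine mem_relativeCommutant.2 ⟨hE (q * a * q) ▸ sum_mem fun i _ => ?_, fun g hg => hEcomm g hg _⟩
    exact mul_mem (mul_mem (hFS _ (huF i)) (mul_mem (mul_mem hqS ha) hqS))
      (star_mem (hFS _ (huF i)))
  have hqe : q * e = q := by rw [hq, mul_assoc, hfe, ← mul_assoc, hee]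
  have heq : e * q = q := by rw [hq, ← mul_assoc, hee]
  have heE : ∀ a, e * E (q * a * q) * e = E (q * a * q) := fun a => by
    rw [hE, Finset.mul_sum, Finset.sum_mul]
    refine Finset.sum_congr rfl fun i _ => ?_
    calc e * (u i * (q * a * q) * star (u i)) * e
        = (e * u i) * (q * a * q) * (star (u i) * e) := by simp only [mul_assoc]
      _ = u i * (e * q) * a * (q * e) * star (u i) := by
        rw [← heF _ (huF i), heF _ (star_mem (huF i))]; simp only [mul_assoc]
      _ = _ := by rw [hqe, heq]; simp only [mul_assoc]
  have hab : IsAbelianProjection S q := by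
    refine ⟨hqS, hqp, fun a ha b hb => ?_⟩
    have h1 := hecomm _ (hET a ha) _ (hET b hb)
    rw [heE, heE] at h1
    have h2 : ∀ a b : K →L[ℂ] K, (κ * κ) • ((q * a * q) * (q * b * q)) =
        f * (E (q * a * q) * E (q * b * q)) * f := by
      intro a b
      rw [← smul_mul_smul_comm, ← hfE, ← hfE]
      calc _ = f * E (q * a * q) * (f * f) * E (q * b * q) * f := by simp only [mul_assoc]
        _ = f * f * E (q * a * q) * E (q * b * q) * f := by
          rw [hff, mul_assoc f _ f, ← hEcomm f hfF, ← mul_assoc, hff]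
        _ = _ := by rw [hff, mul_assoc f]
    have h3 : (κ * κ) • ((q * a * q) * (q * b * q)) = (κ * κ) • ((q * b * q) * (q * a * q)) := by
      rw [h2, h2, h1]
    exact smul_right_injective _ (mul_ne_zero hκ0 hκ0) h3
  apply hef
  refine hz q hab ?_
  rw [hq, heF f hfF |>.symm, mul_assoc, hez, mul_zero]

end

/-! ### Matrices of operators acting on `Lⁿ` -/

section MatrixRepresentation

variable {L : Type*} [NormedAddCommGroup L] [InnerProductSpace ℂ L] {n : ℕ}

/-- The operator on `Lⁿ` given by a matrix of operators on `L`. -/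
def matrixOperator (X : CStarMatrix (Fin n) (Fin n) (L →L[ℂ] L)) :
    PiLp 2 (fun _ : Fin n => L) →L[ℂ] PiLp 2 (fun _ : Fin n => L) :=
  (PiLp.continuousLinearEquiv 2 ℂ (fun _ : Fin n => L)).symm.toContinuousLinearMap ∘L
    ContinuousLinearMap.pi fun k => ∑ l, X k l ∘L PiLp.proj 2 (fun _ : Fin n => L) l

theorem matrixOperator_apply (X : CStarMatrix (Fin n) (Fin n) (L →L[ℂ] L))
    (ξ : PiLp 2 (fun _ : Fin n => L)) (k : Fin n) :
    matrixOperator X ξ k = ∑ l, X k l (ξ l) := by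
  simp [matrixOperator]

theorem inner_matrixOperator (X : CStarMatrix (Fin n) (Fin n) (L →L[ℂ] L))
    (η ξ : PiLp 2 (fun _ : Fin n => L)) :
    inner ℂ η (matrixOperator X ξ) = ∑ k, ∑ l, inner ℂ (η k) (X k l (ξ l)) := by
  simp only [PiLp.inner_apply, matrixOperator_apply, inner_sum]

theorem ContinuousLinearMap.norm_le_of_inner_le {T : L →L[ℂ] L} {c : ℝ} (hc : 0 ≤ c)
    (h : ∀ η ξ, ‖(inner ℂ η (T ξ) : ℂ)‖ ≤ c * ‖η‖ * ‖ξ‖) : ‖T‖ ≤ c := by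
  refine T.opNorm_le_bound hc fun ξ => ?_
  by_cases h0 : ‖T ξ‖ = 0
  · rw [h0]; positivity
  · have h1 := h (T ξ) ξ
    rw [inner_self_eq_norm_sq_to_K, norm_pow, RCLike.norm_ofReal, abs_norm] at h1
    have h2 : 0 < ‖T ξ‖ := lt_of_le_of_ne (norm_nonneg _) (Ne.symm h0)
    nlinarith

variable [CompleteSpace L]

variable (L n) in
/-- The representation of `𝕄ₙ(B(L))` on `Lⁿ`. -/
def matrixOperatorHom : CStarMatrix (Fin n) (Fin n) (L →L[ℂ] L) →⋆ₐ[ℂ]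
    (PiLp 2 (fun _ : Fin n => L) →L[ℂ] PiLp 2 (fun _ : Fin n => L)) where
  toFun := matrixOperator
  map_one' := by
    ext ξ k
    simp only [matrixOperator_apply, CStarMatrix.one_apply]
    rw [Finset.sum_eq_single k] <;> simp +contextual [eq_comm]
  map_mul' X Y := by
    ext ξ k
    simp only [matrixOperator_apply, CStarMatrix.mul_apply, mul_apply_eq_comp, map_sum,
      _root_.sum_apply]
    exact Finset.sum_comm
  map_zero' := by
    ext ξ k
    simp [matrixOperator_apply]
  map_add' X Y := by
    ext ξ k
    simp [matrixOperator_apply, Finset.sum_add_distrib]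
  commutes' r := by
    ext ξ k
    rw [Algebra.algebraMap_eq_smul_one, Algebra.algebraMap_eq_smul_one]
    simp only [matrixOperator_apply, CStarMatrix.smul_apply, CStarMatrix.one_apply]
    rw [Finset.sum_eq_single k] <;> simp +contextual [eq_comm]
  map_star' X := by
    refine ContinuousLinearMap.ext fun ξ => ext_inner_left ℂ fun η => ?_
    rw [ContinuousLinearMap.star_eq_adjoint, ContinuousLinearMap.adjoint_inner_right,
      inner_matrixOperator, ← inner_conj_symm, inner_matrixOperator, map_sum, Finset.sum_comm]
    refine Finset.sum_congr rfl fun k _ => ?_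
    rw [map_sum]
    refine Finset.sum_congr rfl fun l _ => ?_
    rw [inner_conj_symm, CStarMatrix.star_apply, ContinuousLinearMap.star_eq_adjoint,
      ContinuousLinearMap.adjoint_inner_right]

theorem matrixOperatorHom_apply (X : CStarMatrix (Fin n) (Fin n) (L →L[ℂ] L)) :
    matrixOperatorHom L n X = matrixOperator X := rfl

theorem matrixOperatorHom_injective : Function.Injective (matrixOperatorHom L n) := by
  intro X Y h
  ext k l v
  have h1 := congrArg (fun T => T (WithLp.toLp 2 (Pi.single l v)) k) h
  simp only [matrixOperatorHom_apply, matrixOperator_apply] at h1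
  rw [Finset.sum_eq_single l, Finset.sum_eq_single l] at h1
  · simpa using h1
  all_goals simp +contextual

/-- An injective *-homomorphism of C⋆-algebras is isometric; the abstract matrix norm can therefore
be computed from vectors in `Lⁿ`. -/
theorem norm_matrixOperator (X : CStarMatrix (Fin n) (Fin n) (L →L[ℂ] L)) :
    ‖matrixOperator X‖ = ‖X‖ :=
  NonUnitalStarAlgHom.norm_map (matrixOperatorHom L n) matrixOperatorHom_injective X

theorem norm_sum_inner_le (X : CStarMatrix (Fin n) (Fin n) (L →L[ℂ] L))
    (η ξ : PiLp 2 (fun _ : Fin n => L)) :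
    ‖∑ k, ∑ l, (inner ℂ (η k) (X k l (ξ l)) : ℂ)‖ ≤ ‖X‖ * ‖η‖ * ‖ξ‖ := by
  rw [← inner_matrixOperator, ← norm_matrixOperator X]
  calc _ ≤ ‖η‖ * ‖matrixOperator X ξ‖ := norm_inner_le_norm _ _
    _ ≤ ‖η‖ * (‖matrixOperator X‖ * ‖ξ‖) := by gcongr; exact ContinuousLinearMap.le_opNorm _ _
    _ = _ := by ring

theorem CStarMatrix.norm_le_of_inner_le {X : CStarMatrix (Fin n) (Fin n) (L →L[ℂ] L)} {c : ℝ}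
    (hc : 0 ≤ c) (h : ∀ η ξ : PiLp 2 (fun _ : Fin n => L),
      ‖∑ k, ∑ l, (inner ℂ (η k) (X k l (ξ l)) : ℂ)‖ ≤ c * ‖η‖ * ‖ξ‖) : ‖X‖ ≤ c := by
  rw [← norm_matrixOperator]
  refine ContinuousLinearMap.norm_le_of_inner_le hc fun η ξ => ?_
  rw [inner_matrixOperator]
  exact h η ξ

end MatrixRepresentation

/-! ### Compressing to a corner and recovering from a corner -/

section Compression

variable {L : Type*} [NormedAddCommGroup L] [InnerProductSpace ℂ L] [CompleteSpace L]

/-- The row `(uᵢ)` is a partial isometry from the direct sum of copies of `L`, with initial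
projection `p ⊕ ⋯ ⊕ p`. -/
theorem norm_sum_apply_le {ι : Type*} [Fintype ι] [DecidableEq ι] {u : ι → (L →L[ℂ] L)}
    {p : L →L[ℂ] L} (hp : IsStarProjection p)
    (hu : ∀ i j, star (u i) * u j = if i = j then p else 0) (ξ : PiLp 2 (fun _ : ι => L)) :
    ‖∑ i, u i (ξ i)‖ ≤ ‖ξ‖ := by
  have h1 : ‖∑ i, u i (ξ i)‖ ^ 2 ≤ ‖ξ‖ ^ 2 := by
    have h2 : (inner ℂ (∑ i, u i (ξ i)) (∑ i, u i (ξ i)) : ℂ) = ∑ i, inner ℂ (ξ i) (p (ξ i)) := by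
      rw [sum_inner]
      refine Finset.sum_congr rfl fun i _ => ?_
      rw [inner_sum, Finset.sum_eq_single i]
      · rw [← ContinuousLinearMap.adjoint_inner_right, ← ContinuousLinearMap.star_eq_adjoint,
          ← mul_apply_eq_comp, hu, if_pos rfl]
      · intro j _ hj
        rw [← ContinuousLinearMap.adjoint_inner_right, ← ContinuousLinearMap.star_eq_adjoint,
          ← mul_apply_eq_comp, hu, if_neg (Ne.symm hj)]
        simp
      · simp
    rw [PiLp.norm_sq_eq_of_L2]
    have h3 : ‖∑ i, u i (ξ i)‖ ^ 2 = ‖∑ i, (inner ℂ (ξ i) (p (ξ i)) : ℂ)‖ := by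
      rw [← h2, inner_self_eq_norm_sq_to_K, norm_pow, RCLike.norm_ofReal, abs_norm]
    rw [h3]
    refine (norm_sum_le _ _).trans (Finset.sum_le_sum fun i _ => ?_)
    calc _ ≤ ‖ξ i‖ * ‖p (ξ i)‖ := norm_inner_le_norm _ _
      _ ≤ ‖ξ i‖ * (1 * ‖ξ i‖) := by
          gcongr
          exact p.le_of_opNorm_le (IsStarProjection.norm_le p hp) _
      _ = _ := by ring
  exact le_of_sq_le_sq h1 (norm_nonneg _)

/-- The adjoint column is a contraction too: with `a` its norm at `ξ`, pairing with the row gives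
`a² ≤ ‖ξ‖ a`. -/
theorem sum_norm_star_apply_sq_le {ι : Type*} [Fintype ι] [DecidableEq ι] {u : ι → (L →L[ℂ] L)}
    {p : L →L[ℂ] L} (hp : IsStarProjection p)
    (hu : ∀ i j, star (u i) * u j = if i = j then p else 0) (ξ : L) :
    ∑ i, ‖star (u i) ξ‖ ^ 2 ≤ ‖ξ‖ ^ 2 := by
  have h := norm_sum_apply_le hp hu (WithLp.toLp 2 fun i => star (u i) ξ)
  have h2 : ∑ i, ‖star (u i) ξ‖ ^ 2 = ‖(WithLp.toLp 2 fun i => star (u i) ξ :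
      PiLp 2 (fun _ : ι => L))‖ ^ 2 := by
    rw [PiLp.norm_sq_eq_of_L2]
  have h3 : ∑ i, ‖star (u i) ξ‖ ^ 2 = RCLike.re (inner ℂ ξ (∑ i, u i (star (u i) ξ)) : ℂ) := by
    rw [inner_sum, map_sum]
    refine Finset.sum_congr rfl fun i _ => ?_
    rw [← ContinuousLinearMap.adjoint_inner_left, ← ContinuousLinearMap.star_eq_adjoint,
      inner_self_eq_norm_sq_to_K]
    norm_cast
  have h4 : RCLike.re (inner ℂ ξ (∑ i, u i (star (u i) ξ)) : ℂ) ≤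
      ‖ξ‖ * ‖∑ i, u i (star (u i) ξ)‖ := re_inner_le_norm _ _
  rw [← h3, h2] at h4
  rw [h2]
  generalize ‖(WithLp.toLp 2 fun i => star (u i) ξ : PiLp 2 (fun _ : ι => L))‖ = a at *
  simp only [] at h
  nlinarith [norm_nonneg ξ, sq_nonneg (a - ‖ξ‖), mul_le_mul_of_nonneg_left h (norm_nonneg ξ)]

/-- A bimodule map is bounded on compressions of matrices by a projection `p` whose `n`-fold
multiple is a subprojection of the unit. -/
theorem norm_compression_le {n : ℕ} {N : StarSubalgebra ℂ (L →L[ℂ] L)}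
    (φ : N →L[ℂ] (L →L[ℂ] L)) {u : Fin n → (L →L[ℂ] L)} {p : L →L[ℂ] L}
    (hp : IsStarProjection p) (hu : ∀ i j, star (u i) * u j = if i = j then p else 0)
    (huN : ∀ i, u i ∈ N)
    (hφl : ∀ i x, φ (⟨u i, huN i⟩ * x) = u i * φ x)
    (hφr : ∀ i x, φ (x * star ⟨u i, huN i⟩) = φ x * star (u i))
    (X : Matrix (Fin n) (Fin n) N) :
    ‖CStarMatrix.ofMatrix (X.map fun x => p * φ x * p)‖ ≤
      ‖φ‖ * ‖CStarMatrix.ofMatrix (X.map fun x => (x : L →L[ℂ] L))‖ := by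
  -- The whole matrix `X` is stored in one element of `N` without increasing the norm, and `φ b`
  -- contains every `p φ(X k l) p` as the corner `uₖ* φ(b) uₗ`.
  obtain ⟨b, hb⟩ : ∃ b : N, b = ∑ k, ∑ l, ⟨u k, huN k⟩ * X k l * star ⟨u l, huN l⟩ := ⟨_, rfl⟩
  have hbc : (b : L →L[ℂ] L) = ∑ k, ∑ l, u k * X k l * star (u l) := by
    rw [hb]; simp
  have hφb : φ b = ∑ k, ∑ l, u k * φ (X k l) * star (u l) := by
    rw [hb]; simp only [map_sum, hφr, hφl]
  have hb1 : ‖b‖ ≤ ‖CStarMatrix.ofMatrix (X.map fun x => (x : L →L[ℂ] L))‖ := by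
    change ‖(b : L →L[ℂ] L)‖ ≤ _
    refine ContinuousLinearMap.norm_le_of_inner_le (norm_nonneg _) fun η ξ => ?_
    have h := norm_sum_inner_le (CStarMatrix.ofMatrix (X.map fun x => (x : L →L[ℂ] L)))
      (WithLp.toLp 2 fun i => star (u i) η) (WithLp.toLp 2 fun i => star (u i) ξ)
    have key : ∀ ζ, ‖(WithLp.toLp 2 fun i => star (u i) ζ : PiLp 2 (fun _ : Fin n => L))‖ ≤ ‖ζ‖ :=
      fun ζ => by
        refine le_of_sq_le_sq ?_ (norm_nonneg _)
        rw [PiLp.norm_sq_eq_of_L2]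
        exact sum_norm_star_apply_sq_le hp hu ζ
    have e : inner ℂ η ((b : L →L[ℂ] L) ξ) = ∑ k, ∑ l, inner ℂ (star (u k) η)
        (CStarMatrix.ofMatrix (X.map fun x => (x : L →L[ℂ] L)) k l (star (u l) ξ)) := by
      rw [hbc]
      simp only [_root_.sum_apply, inner_sum, mul_apply_eq_comp]
      refine Finset.sum_congr rfl fun k _ => Finset.sum_congr rfl fun l _ => ?_
      rw [ContinuousLinearMap.star_eq_adjoint (u k), ContinuousLinearMap.adjoint_inner_left]
      rfl
    rw [e]
    refine h.trans ?_
    gcongr <;> exact key _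
  refine (?_ : _ ≤ ‖φ b‖).trans ((φ.le_opNorm b).trans (by gcongr))
  refine CStarMatrix.norm_le_of_inner_le (norm_nonneg _) fun η ξ => ?_
  have hpk : ∀ k l, p * φ (X k l) * p = star (u k) * φ b * u l := by
    intro k l
    rw [hφb]
    simp only [Finset.mul_sum, Finset.sum_mul]
    rw [Finset.sum_eq_single k]
    · rw [Finset.sum_eq_single l]
      · rw [show star (u k) * (u k * φ (X k l) * star (u l)) * u l =
          (star (u k) * u k) * φ (X k l) * (star (u l) * u l) by noncomm_ring, hu, hu]
        simp
      · intro j _ hj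
        rw [show star (u k) * (u k * φ (X k j) * star (u j)) * u l =
          (star (u k) * u k) * φ (X k j) * (star (u j) * u l) by noncomm_ring, hu, hu, if_neg hj]
        simp
      · simp
    · intro i _ hi
      refine Finset.sum_eq_zero fun j _ => ?_
      rw [show star (u k) * (u i * φ (X i j) * star (u j)) * u l =
          (star (u k) * u i) * φ (X i j) * (star (u j) * u l) by noncomm_ring, hu,
          if_neg (Ne.symm hi)]
      simp
    · simp
  have e : ∑ k, ∑ l, inner ℂ (η k) (CStarMatrix.ofMatrix (X.map fun x => p * φ x * p) k l (ξ l)) =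
      inner ℂ (∑ k, u k (η k)) (φ b (∑ l, u l (ξ l))) := by
    rw [sum_inner]
    refine Finset.sum_congr rfl fun k _ => ?_
    rw [map_sum, inner_sum]
    refine Finset.sum_congr rfl fun l _ => ?_
    change inner ℂ (η k) ((p * φ (X k l) * p) (ξ l)) = _
    rw [hpk, mul_apply_eq_comp, mul_apply_eq_comp, ContinuousLinearMap.star_eq_adjoint,
      ContinuousLinearMap.adjoint_inner_right]
  rw [e]
  calc _ ≤ ‖∑ k, u k (η k)‖ * ‖φ b (∑ l, u l (ξ l))‖ := norm_inner_le_norm _ _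
    _ ≤ ‖η‖ * (‖φ b‖ * ‖ξ‖) := by
        gcongr
        · exact norm_sum_apply_le hp hu η
        · refine ((φ b).le_opNorm _).trans ?_
          gcongr
          exact norm_sum_apply_le hp hu ξ
    _ = _ := by ring

/-- A matrix of operators commuting with the matrix units `v a * star (v b)` is as large as its
corner. -/
theorem norm_mul_le_of_commute {n : ℕ} {ι : Type*} [Fintype ι] [DecidableEq ι]
    {v : ι → (L →L[ℂ] L)} {p e : L →L[ℂ] L}
    (hp : IsStarProjection p) (hv : ∀ i j, star (v i) * v j = if i = j then p else 0)
    (he : ∑ i, v i * star (v i) = e) (Y : Matrix (Fin n) (Fin n) (L →L[ℂ] L))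
    (hY : ∀ k l i, v i * Y k l = Y k l * v i) (hpY : ∀ k l, p * Y k l = Y k l * p) :
    ‖CStarMatrix.ofMatrix (Y.map fun y => y * e)‖ ≤
      ‖CStarMatrix.ofMatrix (Y.map fun y => p * y * p)‖ := by
  refine CStarMatrix.norm_le_of_inner_le (norm_nonneg _) fun η ξ => ?_
  obtain ⟨c, hc⟩ : ∃ c, c = ‖CStarMatrix.ofMatrix (Y.map fun y => p * y * p)‖ := ⟨_, rfl⟩
  have hc0 : 0 ≤ c := hc ▸ norm_nonneg _
  let V (a : ι) (ζ : PiLp 2 (fun _ : Fin n => L)) : PiLp 2 (fun _ : Fin n => L) :=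
    WithLp.toLp 2 fun k => star (v a) (ζ k)
  have hvp : ∀ a, v a * p = v a := fun a =>
    mul_eq_self_of_star_mul_self hp (by rw [hv, if_pos rfl])
  -- Below `e` the matrix is an orthogonal sum of copies of its corner; the copies act on orthogonal
  -- subspaces, and Cauchy–Schwarz over `a` adds up the estimates.
  have hk : ∀ k l, Y k l * e = ∑ a, v a * (p * Y k l * p) * star (v a) := by
    intro k l
    rw [← he, Finset.mul_sum]
    refine Finset.sum_congr rfl fun a _ => ?_
    rw [hpY, mul_assoc (Y k l), hp.isIdempotentElem.eq, ← mul_assoc (v a), hY, mul_assoc (Y k l),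
      hvp, mul_assoc]
  have e1 : ∑ k, ∑ l, inner ℂ (η k) (CStarMatrix.ofMatrix (Y.map fun y => y * e) k l (ξ l)) =
      ∑ a, ∑ k, ∑ l, inner ℂ (V a η k)
        (CStarMatrix.ofMatrix (Y.map fun y => p * y * p) k l (V a ξ l)) := by
    symm
    rw [Finset.sum_comm]
    refine Finset.sum_congr rfl fun k _ => ?_
    rw [Finset.sum_comm]
    refine Finset.sum_congr rfl fun l _ => ?_
    symm
    change inner ℂ (η k) ((Y k l * e) (ξ l)) = _
    rw [hk, _root_.sum_apply, inner_sum]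
    refine Finset.sum_congr rfl fun a _ => ?_
    rw [mul_apply_eq_comp, mul_apply_eq_comp, ← ContinuousLinearMap.adjoint_inner_left,
      ← ContinuousLinearMap.star_eq_adjoint]
    rfl
  have hV : ∀ ζ, ∑ a, ‖V a ζ‖ ^ 2 ≤ ‖ζ‖ ^ 2 := by
    intro ζ
    simp only [PiLp.norm_sq_eq_of_L2, V]
    rw [Finset.sum_comm]
    exact Finset.sum_le_sum fun k _ => sum_norm_star_apply_sq_le hp hv (ζ k)
  rw [e1, ← hc]
  calc _ ≤ ∑ a, c * (‖V a η‖ * ‖V a ξ‖) := by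
        refine (norm_sum_le _ _).trans (Finset.sum_le_sum fun a _ => ?_)
        rw [hc, ← mul_assoc]
        exact norm_sum_inner_le _ (V a η) (V a ξ)
    _ = c * ∑ a, ‖V a η‖ * ‖V a ξ‖ := by rw [Finset.mul_sum]
    _ ≤ c * (√(∑ a, ‖V a η‖ ^ 2) * √(∑ a, ‖V a ξ‖ ^ 2)) := by
        gcongr
        exact Real.sum_mul_le_sqrt_mul_sqrt _ _ _
    _ ≤ c * (‖η‖ * ‖ξ‖) := by
        gcongr
        · exact Real.sqrt_le_iff.2 ⟨norm_nonneg _, hV η⟩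
        · exact Real.sqrt_le_iff.2 ⟨norm_nonneg _, hV ξ⟩
    _ = _ := by ring

end Compression

/-! ### Tensor products of operators -/

section OpTensor

variable {H K : Type*} [NormedAddCommGroup H] [InnerProductSpace ℂ H]
  [NormedAddCommGroup K] [InnerProductSpace ℂ K]

theorem opTensor_coe_tmul (a : H →L[ℂ] H) (b : K →L[ℂ] K) (ξ : H) (η : K) :
    opTensor a b ((ξ ⊗ₜ[ℂ] η : H ⊗[ℂ] K) : HilbertTensor H K) =
      ((a ξ ⊗ₜ[ℂ] b η : H ⊗[ℂ] K) : HilbertTensor H K) := by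
  rw [opTensor, ContinuousLinearMap.completion_apply_coe, TensorProduct.mapL_tmul]

theorem HilbertTensor.clm_ext {E : Type*} [NormedAddCommGroup E] [NormedSpace ℂ E]
    {S T : HilbertTensor H K →L[ℂ] E}
    (h : ∀ (ξ : H) (η : K), S ((ξ ⊗ₜ[ℂ] η : H ⊗[ℂ] K) : HilbertTensor H K) =
      T ((ξ ⊗ₜ[ℂ] η : H ⊗[ℂ] K) : HilbertTensor H K)) : S = T := by
  ext x
  induction x using UniformSpace.Completion.induction_on with
  | hp => exact isClosed_eq S.continuous T.continuous
  | ih a =>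
    induction a using TensorProduct.induction_on with
    | zero => rw [UniformSpace.Completion.coe_zero, map_zero, map_zero]
    | tmul ξ η => exact h ξ η
    | add a b ha hb => rw [UniformSpace.Completion.coe_add, map_add, map_add, ha, hb]

theorem opTensor_mul (a₁ a₂ : H →L[ℂ] H) (b₁ b₂ : K →L[ℂ] K) :
    opTensor (a₁ * a₂) (b₁ * b₂) = opTensor a₁ b₁ * opTensor a₂ b₂ :=
  HilbertTensor.clm_ext fun ξ η => by
    rw [mul_apply_eq_comp, opTensor_coe_tmul, opTensor_coe_tmul, opTensor_coe_tmul,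
      mul_apply_eq_comp, mul_apply_eq_comp]

theorem opTensor_add_right (a : H →L[ℂ] H) (b₁ b₂ : K →L[ℂ] K) :
    opTensor a (b₁ + b₂) = opTensor a b₁ + opTensor a b₂ :=
  HilbertTensor.clm_ext fun ξ η => by
    rw [_root_.add_apply, opTensor_coe_tmul, opTensor_coe_tmul, opTensor_coe_tmul,
      _root_.add_apply, TensorProduct.tmul_add, UniformSpace.Completion.coe_add]

theorem opTensor_smul_right (c : ℂ) (a : H →L[ℂ] H) (b : K →L[ℂ] K) :
    opTensor a (c • b) = c • opTensor a b :=
  HilbertTensor.clm_ext fun ξ η => by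
    rw [_root_.smul_apply, opTensor_coe_tmul, opTensor_coe_tmul,
      _root_.smul_apply, TensorProduct.tmul_smul, UniformSpace.Completion.coe_smul]

theorem opTensor_one_one : opTensor (1 : H →L[ℂ] H) (1 : K →L[ℂ] K) = 1 :=
  HilbertTensor.clm_ext fun ξ η => by
    rw [opTensor_coe_tmul]; rfl

theorem inner_coe_tmul (ξ ξ' : H) (η η' : K) :
    inner ℂ ((ξ ⊗ₜ[ℂ] η : H ⊗[ℂ] K) : HilbertTensor H K)
      ((ξ' ⊗ₜ[ℂ] η' : H ⊗[ℂ] K) : HilbertTensor H K) = inner ℂ ξ ξ' * inner ℂ η η' := by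
  rw [UniformSpace.Completion.inner_coe, TensorProduct.inner_tmul]

theorem HilbertTensor.clm_ext_inner {S T : HilbertTensor H K →L[ℂ] HilbertTensor H K}
    (h : ∀ (ξ ξ' : H) (η η' : K),
      (inner ℂ ((ξ' ⊗ₜ[ℂ] η' : H ⊗[ℂ] K) : HilbertTensor H K)
        (S ((ξ ⊗ₜ[ℂ] η : H ⊗[ℂ] K) : HilbertTensor H K)) : ℂ) =
      inner ℂ ((ξ' ⊗ₜ[ℂ] η' : H ⊗[ℂ] K) : HilbertTensor H K)
        (T ((ξ ⊗ₜ[ℂ] η : H ⊗[ℂ] K) : HilbertTensor H K))) : S = T := by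
  refine HilbertTensor.clm_ext fun ξ η => ?_
  have e : innerSL ℂ (S ((ξ ⊗ₜ[ℂ] η : H ⊗[ℂ] K) : HilbertTensor H K)) =
      innerSL ℂ (T ((ξ ⊗ₜ[ℂ] η : H ⊗[ℂ] K) : HilbertTensor H K)) := by
    refine HilbertTensor.clm_ext fun ξ' η' => ?_
    rw [innerSL_apply_apply, innerSL_apply_apply, ← inner_conj_symm, h, inner_conj_symm]
  refine ext_inner_right ℂ fun v => ?_
  have := congrArg (fun f => f v) e
  simpa using this

variable [CompleteSpace H] [CompleteSpace K]

theorem star_opTensor (a : H →L[ℂ] H) (b : K →L[ℂ] K) :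
    star (opTensor a b) = opTensor (star a) (star b) :=
  HilbertTensor.clm_ext_inner fun ξ ξ' η η' => by
    rw [ContinuousLinearMap.star_eq_adjoint, ContinuousLinearMap.adjoint_inner_right,
      opTensor_coe_tmul, opTensor_coe_tmul, inner_coe_tmul, inner_coe_tmul,
      ContinuousLinearMap.star_eq_adjoint, ContinuousLinearMap.adjoint_inner_right,
      ContinuousLinearMap.star_eq_adjoint, ContinuousLinearMap.adjoint_inner_right]

variable (H K) in
/-- The representation `s ↦ I ⊗ s`. -/
def oneTensorHom : (K →L[ℂ] K) →⋆ₐ[ℂ] (HilbertTensor H K →L[ℂ] HilbertTensor H K) where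
  toFun s := opTensor 1 s
  map_one' := opTensor_one_one
  map_mul' a b := by rw [← opTensor_mul, mul_one]
  map_zero' := by
    have := opTensor_smul_right (0 : ℂ) (1 : H →L[ℂ] H) (0 : K →L[ℂ] K)
    simpa using this
  map_add' := opTensor_add_right _
  commutes' r := by
    rw [Algebra.algebraMap_eq_smul_one, Algebra.algebraMap_eq_smul_one, opTensor_smul_right,
      opTensor_one_one]
  map_star' s := by rw [star_opTensor, star_one]

theorem oneTensorHom_apply (s : K →L[ℂ] K) : oneTensorHom H K s = opTensor 1 s := rfl

end OpTensor

/-! ### Many isometries from two -/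

section Isometries

variable {K : Type*} [NormedAddCommGroup K] [InnerProductSpace ℂ K] [CompleteSpace K]

/-- The family is `v₁, v₂ v₁, v₂² v₁, …`; centrality of `z` makes `v₂* v₂ = z` act as the unit on
the earlier members. -/
theorem VonNeumannAlgebra.exists_isometries (S : VonNeumannAlgebra K) {z v₁ v₂ : K →L[ℂ] K}
    (hz : IsStarProjection z) (hzc : z ∈ S.commutant)
    (hv₁ : v₁ ∈ S) (hv₂ : v₂ ∈ S)
    (h₁ : star v₁ * v₁ = z) (h₂ : star v₂ * v₂ = z) (h₁₂ : star v₁ * v₂ = 0) (n : ℕ) :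
    ∃ u : Fin n → (K →L[ℂ] K), (∀ i, u i ∈ S) ∧
      ∀ i j, star (u i) * u j = if i = j then z else 0 := by
  induction n with
  | zero => exact ⟨fun i => i.elim0, fun i => i.elim0, fun i => i.elim0⟩
  | succ n ih =>
    obtain ⟨u, huS, hu⟩ := ih
    have h₂₁ : star v₂ * v₁ = 0 := by simpa using congrArg star h₁₂
    have huz : ∀ i, u i * z = u i := fun i =>
      mul_eq_self_of_star_mul_self hz (by rw [hu, if_pos rfl])
    have hcomm : ∀ i, z * u i = u i := fun i => by
      rw [← S.commute_of_mem_commutant (huS i) hzc, huz]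
    refine ⟨Fin.cons v₁ fun i => v₂ * u i, fun i => ?_, fun i j => ?_⟩
    · refine Fin.cases ?_ (fun i => ?_) i
      · exact hv₁
      · exact mul_mem hv₂ (huS i)
    · refine Fin.cases ?_ (fun i => ?_) i <;> refine Fin.cases ?_ (fun j => ?_) j
      · simpa using h₁
      · simp only [Fin.cons_zero, Fin.cons_succ, ← mul_assoc, h₁₂, zero_mul]
        simp [eq_comm]
      · simp only [Fin.cons_zero, Fin.cons_succ, star_mul, mul_assoc, h₂₁, mul_zero]
        simp
      · simp only [Fin.cons_succ, star_mul, Fin.succ_inj]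
        rw [mul_assoc, ← mul_assoc (star v₂), h₂, hcomm, hu]

end Isometries

/-! ### The bound for one finite-dimensional subalgebra -/

section FiniteLevel

variable {L K : Type*}
    [NormedAddCommGroup L] [InnerProductSpace ℂ L] [CompleteSpace L]
    [NormedAddCommGroup K] [InnerProductSpace ℂ K] [CompleteSpace K]
    {S : VonNeumannAlgebra K} {N : StarSubalgebra ℂ (L →L[ℂ] L)}

/-- Bimodule maps over the image of `S` under the representation `π`. -/
def IsBimoduleMap (S : VonNeumannAlgebra K) (π : (K →L[ℂ] K) →⋆ₐ[ℂ] (L →L[ℂ] L))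
    (φ : N → (L →L[ℂ] L)) : Prop :=
  ∀ s ∈ S, ∃ h : π s ∈ N, ∀ x, φ (⟨π s, h⟩ * x) = π s * φ x ∧ φ (x * ⟨π s, h⟩) = φ x * π s

theorem IsBimoduleMap.norm_compression_le
    {π : (K →L[ℂ] K) →⋆ₐ[ℂ] (L →L[ℂ] L)} {φ : N →L[ℂ] (L →L[ℂ] L)} (hmod : IsBimoduleMap S π φ)
    {n : ℕ} {u : Fin n → (K →L[ℂ] K)} {p : K →L[ℂ] K} (hp : IsStarProjection p)
    (huS : ∀ i, u i ∈ S) (hu : ∀ i j, star (u i) * u j = if i = j then p else 0)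
    (X : Matrix (Fin n) (Fin n) N) :
    ‖CStarMatrix.ofMatrix (X.map fun x => π p * φ x * π p)‖ ≤
      ‖φ‖ * ‖CStarMatrix.ofMatrix (X.map fun x => (x : L →L[ℂ] L))‖ := by
  choose h hφ using hmod
  refine _root_.norm_compression_le φ (u := fun i => π (u i)) (hp.map _) ?_
    (fun i => h _ (huS i)) (fun i x => (hφ _ (huS i) x).1) (fun i x => ?_) X
  · intro i j
    rw [← map_star, ← map_mul, hu]
    split <;> simp
  · rw [← map_star, ← (hφ _ (star_mem (huS i)) x).2]
    congr 2
    exact Subtype.ext (map_star π (u i)).symm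

/-- A bounded bimodule map is bounded, uniformly in `n`, on matrices with entries in the commutant of
the relative commutant of a finite-dimensional subalgebra. -/
theorem IsBimoduleMap.norm_amplification_le_of_commute_relativeCommutant
    {π : (K →L[ℂ] K) →⋆ₐ[ℂ] (L →L[ℂ] L)} {φ : N →L[ℂ] (L →L[ℂ] L)} (hmod : IsBimoduleMap S π φ)
    (hS : HasNoFiniteTypeISummand S)
    (F : StarSubalgebra ℂ (K →L[ℂ] K)) [FiniteDimensional ℂ F] (hFS : ∀ f ∈ F, f ∈ S)
    {n : ℕ} (X : Matrix (Fin n) (Fin n) N)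
    (hX : ∀ k l, ∀ t ∈ S.relativeCommutant F, π t * (X k l : _ →L[ℂ] _) =
      (X k l : L →L[ℂ] L) * π t) :
    ‖CStarMatrix.ofMatrix (X.map φ)‖ ≤
      2 * ‖φ‖ * ‖CStarMatrix.ofMatrix (X.map fun x => (x : L →L[ℂ] L))‖ := by
  obtain ⟨z, hzS, hzc, hz, ⟨v₁, hv₁, v₂, hv₂, h₁, h₂, h₁₂⟩, hab⟩ :=
    S.exists_central_decomposition hS
  -- Modularity over `S` transfers commutation with `t ∈ F' ∩ S` from the entries to their images.
  have hφ : ∀ k l, ∀ t ∈ S.relativeCommutant F,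
      π t * φ (X k l) = φ (X k l) * π t := by
    intro k l t ht
    have htS := (VonNeumannAlgebra.mem_relativeCommutant.1 ht).1
    obtain ⟨h, hφ⟩ := hmod t htS
    rw [← (hφ _).1, ← (hφ _).2]
    congr 1
    exact Subtype.ext (hX k l t ht)
  have hzT : z ∈ S.relativeCommutant F := VonNeumannAlgebra.mem_relativeCommutant.2
    ⟨hzS, fun f hf => S.commute_of_mem_commutant (hFS f hf) hzc⟩
  obtain ⟨u, huS, hu⟩ := S.exists_isometries hz hzc hv₁ hv₂ h₁ h₂ h₁₂ n
  have hX1 : ‖CStarMatrix.ofMatrix (X.map fun x => φ x * π z)‖ ≤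
      ‖φ‖ * ‖CStarMatrix.ofMatrix (X.map fun x => (x : L →L[ℂ] L))‖ := by
    have e : (X.map fun x => φ x * π z) = X.map fun x => π z * φ x * π z := by
      ext1 k l
      simp only [Matrix.map_apply]
      rw [hφ k l z hzT, mul_assoc, ← map_mul, hz.isIdempotentElem.eq]
    rw [e]
    exact hmod.norm_compression_le hz huS hu X
  -- The division takes place in `F' ∩ S`, not merely in `S`, so that the `v i` commute with the `φ
  -- (X k l)`. Its `2 ^ n ≥ n` pieces all serve to recover the norm from a corner, n of them to
  -- bound that corner.
  obtain ⟨ι, _, _, v, p, hcard, hvT, hpT, hp, hpe, hv, hve⟩ :=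
    (S.relativeCommutant F).exists_division (e := 1 - z) (sub_mem (one_mem _) hzT) hz.one_sub
      (fun q hq hqe => S.eq_zero_of_isAbelianProjection_relativeCommutant F hFS hab hq (by
        rw [mul_sub, mul_one] at hqe
        simpa using hqe)) n
  have hle : Fintype.card (Fin n) ≤ Fintype.card ι := by
    rw [hcard, Fintype.card_fin]; exact Nat.lt_two_pow_self.le
  obtain ⟨g⟩ := Function.Embedding.nonempty_of_card_le hle
  have hX2 : ‖CStarMatrix.ofMatrix (X.map fun x => φ x * π (1 - z))‖ ≤
      ‖φ‖ * ‖CStarMatrix.ofMatrix (X.map fun x => (x : L →L[ℂ] L))‖ := by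
    refine le_trans ?_ (hmod.norm_compression_le hp (u := fun i => v (g i))
      (fun i => (VonNeumannAlgebra.mem_relativeCommutant.1 (hvT (g i))).1)
      (fun i j => by rw [hv]; simp) X)
    refine norm_mul_le_of_commute (v := fun i => π (v i)) (hp.map _) ?_ ?_
      (X.map φ) (fun k l i => hφ k l _ (hvT i)) (fun k l => hφ k l _ hpT)
    · intro i j
      rw [← map_star, ← map_mul, hv]
      split <;> simp
    · simp only [← map_star, ← map_mul, ← map_sum, hve]
  have hsum : CStarMatrix.ofMatrix (X.map φ) =
      CStarMatrix.ofMatrix (X.map fun x => φ x * π z) +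
        CStarMatrix.ofMatrix (X.map fun x => φ x * π (1 - z)) := by
    ext1 k l
    change φ (X k l) = φ (X k l) * _ + φ (X k l) * _
    rw [← mul_add, ← map_add]
    simp
  rw [hsum]
  refine (norm_add_le _ _).trans ((add_le_add hX1 hX2).trans (le_of_eq ?_))
  ring

end FiniteLevel

/-! ### Von Neumann's density theorem, also for selfadjoint elements -/

section Amplification

variable {L : Type*} [NormedAddCommGroup L] [InnerProductSpace ℂ L] {n : ℕ}

/-- The diagonal operator `a ⊕ ⋯ ⊕ a` as a matrix. -/
def diagonalMatrix (n : ℕ) (a : L →L[ℂ] L) : CStarMatrix (Fin n) (Fin n) (L →L[ℂ] L) :=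
  CStarMatrix.ofMatrix (Matrix.diagonal fun _ => a)

theorem matrixOperator_diagonalMatrix (a : L →L[ℂ] L) (ξ : PiLp 2 (fun _ : Fin n => L))
    (k : Fin n) : matrixOperator (diagonalMatrix n a) ξ k = a (ξ k) := by
  rw [matrixOperator_apply, Finset.sum_eq_single k]
  · simp [diagonalMatrix]
  · intro l _ hl
    simp [diagonalMatrix, Matrix.diagonal_apply_ne _ hl.symm]
  · simp

/-- Makes commutation on `Lⁿ` an entrywise condition, so that commutants can be compared before and
after amplification. -/
theorem commute_diagonalMatrix_iff {Q : CStarMatrix (Fin n) (Fin n) (L →L[ℂ] L)}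
    {a : L →L[ℂ] L} : diagonalMatrix n a * Q = Q * diagonalMatrix n a ↔
      ∀ k l, a * Q k l = Q k l * a := by
  have h1 : ∀ k l, (diagonalMatrix n a * Q) k l = a * Q k l := fun k l =>
    Matrix.diagonal_mul (fun _ => a) (CStarMatrix.ofMatrix.symm Q) k l
  have h2 : ∀ k l, (Q * diagonalMatrix n a) k l = Q k l * a := fun k l =>
    Matrix.mul_diagonal (fun _ => a) (CStarMatrix.ofMatrix.symm Q) k l
  rw [← CStarMatrix.ext_iff]
  simp only [h1, h2]

variable [CompleteSpace L]

theorem matrixOperatorHom_surjective : Function.Surjective (matrixOperatorHom L n) := by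
  intro T
  let J (l : Fin n) : L →L[ℂ] PiLp 2 (fun _ : Fin n => L) :=
    (PiLp.continuousLinearEquiv 2 ℂ (fun _ : Fin n => L)).symm.toContinuousLinearMap ∘L
      ContinuousLinearMap.single ℂ (fun _ => L) l
  have hJ : ∀ ξ : PiLp 2 (fun _ : Fin n => L), ξ = ∑ l, J l (ξ l) := by
    intro ξ
    ext k
    simp only [WithLp.ofLp_sum, Finset.sum_apply]
    rw [Finset.sum_eq_single k]
    · simp [J]
    · intro l _ hl
      simp [J, hl.symm]
    · simp
  refine ⟨CStarMatrix.ofMatrix fun k l => PiLp.proj 2 (fun _ : Fin n => L) k ∘L T ∘L J l, ?_⟩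
  ext ξ k
  rw [matrixOperatorHom_apply, matrixOperator_apply]
  conv_rhs => rw [hJ ξ, map_sum]
  simp only [WithLp.ofLp_sum, Finset.sum_apply]
  rfl

theorem star_diagonalMatrix (a : L →L[ℂ] L) :
    star (diagonalMatrix n a) = diagonalMatrix n (star a) := by
  ext1 k l
  rw [CStarMatrix.star_apply, diagonalMatrix, diagonalMatrix, CStarMatrix.ofMatrix_apply,
    CStarMatrix.ofMatrix_apply]
  by_cases h : k = l
  · rw [h, Matrix.diagonal_apply_eq, Matrix.diagonal_apply_eq]
  · rw [Matrix.diagonal_apply_ne _ h, Matrix.diagonal_apply_ne _ (Ne.symm h), star_zero]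

/-- Von Neumann's density theorem: an element of the bicommutant is approximated by the algebra on
finitely many vectors. -/
theorem exists_mem_norm_sub_apply_lt (A : StarSubalgebra ℂ (L →L[ℂ] L)) {y : L →L[ℂ] L}
    (hy : y ∈ Set.centralizer (Set.centralizer (A : Set (L →L[ℂ] L)))) (ζ : Fin n → L) {ε : ℝ}
    (hε : 0 < ε) : ∃ a ∈ A, ∀ k, ‖a (ζ k) - y (ζ k)‖ < ε := by
  let f : A →ₗ[ℂ] PiLp 2 (fun _ : Fin n => L) :=
    { toFun := fun a => WithLp.toLp 2 fun k => (a : L →L[ℂ] L) (ζ k)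
      map_add' := fun a b => by ext; simp
      map_smul' := fun c a => by ext; simp }
  -- The projection onto `V` commutes with diagonal `A`, so its entries lie in `A'` and it commutes
  -- with `y ⊕ ⋯ ⊕ y`. As `1 ∈ A`, the vector `ζ` lies in `V`, and so does its image under `y ⊕ ⋯ ⊕
  -- y`.
  let V := f.range.topologicalClosure
  have hDV : ∀ a ∈ A, ∀ ξ ∈ V, matrixOperator (diagonalMatrix n a) ξ ∈ V := by
    intro a ha ξ hξ
    refine map_mem_closure (matrixOperator (diagonalMatrix n a)).continuous hξ ?_
    rintro _ ⟨b, rfl⟩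
    refine ⟨⟨a, ha⟩ * b, ?_⟩
    ext k
    rw [matrixOperator_diagonalMatrix]
    rfl
  obtain ⟨P, hP⟩ : ∃ P, P = V.starProjection := ⟨_, rfl⟩
  have hPs : star P = P := by rw [hP]; exact isStarProjection_starProjection.isSelfAdjoint.star_eq
  have hPD : ∀ a ∈ A, P * matrixOperator (diagonalMatrix n a) * P =
      matrixOperator (diagonalMatrix n a) * P := by
    intro a ha
    refine ContinuousLinearMap.ext fun ξ => ?_
    rw [mul_apply_eq_comp, mul_apply_eq_comp, hP]
    exact Submodule.starProjection_eq_self_iff.2 (hDV a ha _ (Submodule.starProjection_apply_mem _ _))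
  have hstar : ∀ a : L →L[ℂ] L, star (matrixOperator (diagonalMatrix n a)) =
      matrixOperator (diagonalMatrix n (star a)) := by
    intro a
    rw [← star_diagonalMatrix]
    exact (map_star (matrixOperatorHom L n) _).symm
  have hcomm : ∀ a ∈ A, matrixOperator (diagonalMatrix n a) * P =
      P * matrixOperator (diagonalMatrix n a) := by
    intro a ha
    have h := congrArg star (hPD (star a) (star_mem ha))
    rw [star_mul, star_mul, star_mul, hstar, star_star, hPs, ← mul_assoc, hPD a ha] at h
    exact h
  obtain ⟨Q, hQ⟩ := matrixOperatorHom_surjective P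
  have hQA : ∀ k l, Q k l ∈ Set.centralizer (A : Set (L →L[ℂ] L)) := by
    intro k l a ha
    refine commute_diagonalMatrix_iff.1 (matrixOperatorHom_injective ?_) k l
    rw [map_mul, map_mul, hQ]
    exact hcomm a ha
  have hyP : matrixOperator (diagonalMatrix n y) * P = P * matrixOperator (diagonalMatrix n y) := by
    rw [← hQ, ← matrixOperatorHom_apply, ← map_mul, ← map_mul]
    congr 1
    exact commute_diagonalMatrix_iff.2 fun k l => (hy _ (hQA k l)).symm
  have hζV : f 1 ∈ V := subset_closure ⟨1, rfl⟩
  have hmem : matrixOperator (diagonalMatrix n y) (f 1) ∈ V := by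
    rw [← Submodule.starProjection_eq_self_iff (K := V), ← hP, ← mul_apply_eq_comp, ← hyP,
      mul_apply_eq_comp]
    congr 1
    rw [hP]
    exact Submodule.starProjection_eq_self_iff.2 hζV
  obtain ⟨_, ⟨a, rfl⟩, ha⟩ := Metric.mem_closure_iff.1 hmem ε hε
  refine ⟨a, a.2, fun k => lt_of_le_of_lt ?_ ha⟩
  rw [dist_comm, dist_eq_norm]
  refine le_trans (le_of_eq ?_) (PiLp.norm_apply_le _ k)
  rw [PiLp.sub_apply, matrixOperator_diagonalMatrix]
  rfl

/-- Selfadjoint operators form only a real subspace, so the bipolar argument is run with the real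
inner product `re ⟪·, ·⟫`. -/
theorem mem_closure_of_re_inner {E : Type*} [NormedAddCommGroup E] [InnerProductSpace ℂ E]
    [CompleteSpace E] (W : AddSubgroup E) (hW : ∀ (r : ℝ), ∀ w ∈ W, (r : ℂ) • w ∈ W) {x : E}
    (hx : ∀ η : E, (∀ w ∈ W, (inner ℂ η w).re = 0) → (inner ℂ η x).re = 0) :
    x ∈ closure (W : Set E) := by
  let _ : InnerProductSpace ℝ E := InnerProductSpace.complexToReal
  let W' : Submodule ℝ E :=
    { W with
      smul_mem' := fun r w hw => by
        have := hW r w hw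
        rwa [Complex.coe_smul] at this }
  change x ∈ W'.topologicalClosure
  rw [← Submodule.orthogonal_orthogonal_eq_closure, Submodule.mem_orthogonal]
  intro η hη
  refine hx η fun w hw => ?_
  have h : (inner ℝ η w : ℝ) = 0 := Submodule.inner_left_of_mem_orthogonal (K := W') hw hη
  exact h

/-- Selfadjoint elements of the bicommutant are approximated by selfadjoint elements. -/
theorem exists_isSelfAdjoint_mem_norm_sub_apply_lt (A : StarSubalgebra ℂ (L →L[ℂ] L))
    {y : L →L[ℂ] L} (hy : y ∈ Set.centralizer (Set.centralizer (A : Set (L →L[ℂ] L))))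
    (hys : IsSelfAdjoint y) (ζ : Fin n → L) {ε : ℝ} (hε : 0 < ε) :
    ∃ a ∈ A, IsSelfAdjoint a ∧ ∀ k, ‖a (ζ k) - y (ζ k)‖ < ε := by
  let f : (L →L[ℂ] L) →ₗ[ℂ] PiLp 2 (fun _ : Fin n => L) :=
    { toFun := fun a => WithLp.toLp 2 fun k => a (ζ k)
      map_add' := fun a b => by ext; simp
      map_smul' := fun c a => by ext; simp }
  let W : AddSubgroup (PiLp 2 (fun _ : Fin n => L)) :=
    (A.toSubalgebra.toSubmodule.toAddSubgroup ⊓ selfAdjoint (L →L[ℂ] L)).map f.toAddMonoidHom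
  have hmem : f y ∈ closure (W : Set (PiLp 2 (fun _ : Fin n => L))) := by
    refine mem_closure_of_re_inner W ?_ ?_
    · rintro r _ ⟨a, ⟨ha, has⟩, rfl⟩
      refine ⟨(r : ℂ) • a, ⟨A.smul_mem ha _, ?_⟩, map_smul f _ a⟩
      exact IsSelfAdjoint.smul (by simp [IsSelfAdjoint]) has
    · intro η hη
      -- The adjoint is not strongly continuous, so `b + b*` need not approximate `2y` on `ζ`. But
      -- if `b` approximates `y` on both `ζ` and `η`, then `re ⟪η, (b + b*) ζ⟫`, which is zero,
      -- approximates `2 re ⟪η, y ζ⟫`.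
      have key : ∀ δ > 0, |2 * (inner ℂ η (f y) : ℂ).re| ≤ δ * ∑ k, (‖η k‖ + ‖ζ k‖) := by
        intro δ hδ
        obtain ⟨b, hb, hbζ⟩ := exists_mem_norm_sub_apply_lt A hy (Fin.append ζ fun k => η k) hδ
        have h1 : ∀ k, ‖b (ζ k) - y (ζ k)‖ < δ := fun k => by
          simpa using hbζ (Fin.castAdd n k)
        have h2 : ∀ k, ‖b (η k) - y (η k)‖ < δ := fun k => by
          simpa only [Fin.append_right] using hbζ (Fin.natAdd n k)
        have h3 := hη (f (b + star b)) ⟨b + star b, ⟨A.add_mem hb (star_mem (s := A) hb),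
          IsSelfAdjoint.add_star_self b⟩, rfl⟩
        have e : 2 * (inner ℂ η (f y) : ℂ).re = -∑ k, ((inner ℂ (η k) (b (ζ k) - y (ζ k)) : ℂ).re +
            (inner ℂ (b (η k) - y (η k)) (ζ k) : ℂ).re) := by
          have e1 : ∀ k, (inner ℂ (y (η k)) (ζ k) : ℂ) = inner ℂ (η k) (y (ζ k)) := fun k => by
            rw [← ContinuousLinearMap.adjoint_inner_right, ← ContinuousLinearMap.star_eq_adjoint,
              hys.star_eq]
          have e2 : ∀ k, (inner ℂ (b (η k)) (ζ k) : ℂ) = inner ℂ (η k) (star b (ζ k)) := fun k => by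
            rw [← ContinuousLinearMap.adjoint_inner_right, ← ContinuousLinearMap.star_eq_adjoint]
          have e3 : (∑ k, ((inner ℂ (η k) (b (ζ k)) : ℂ).re +
              (inner ℂ (η k) (star b (ζ k)) : ℂ).re)) = 0 := by
            rw [← h3, PiLp.inner_apply, Complex.re_sum]
            refine Finset.sum_congr rfl fun k _ => ?_
            rw [← Complex.add_re, ← inner_add_right]
            rfl
          rw [PiLp.inner_apply, Complex.re_sum]
          simp only [inner_sub_left, inner_sub_right, e1, e2, Complex.sub_re]
          rw [Finset.mul_sum, ← Finset.sum_neg_distrib, ← sub_eq_zero, ← Finset.sum_sub_distrib]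
          rw [← e3]
          refine Finset.sum_congr rfl fun k _ => ?_
          change 2 * (inner ℂ (η k) (y (ζ k)) : ℂ).re - _ = _
          ring
        rw [e, abs_neg, Finset.mul_sum]
        refine (Finset.abs_sum_le_sum_abs _ _).trans (Finset.sum_le_sum fun k _ => ?_)
        refine (abs_add_le _ _).trans ?_
        have i1 : |(inner ℂ (η k) (b (ζ k) - y (ζ k)) : ℂ).re| ≤ ‖η k‖ * δ :=
          (Complex.abs_re_le_norm _).trans ((norm_inner_le_norm _ _).trans
            (by gcongr; exact (h1 k).le))
        have i2 : |(inner ℂ (b (η k) - y (η k)) (ζ k) : ℂ).re| ≤ δ * ‖ζ k‖ :=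
          (Complex.abs_re_le_norm _).trans ((norm_inner_le_norm _ _).trans
            (by gcongr; exact (h2 k).le))
        linarith
      obtain ⟨c, hc⟩ : ∃ c, c = ∑ k, (‖η k‖ + ‖ζ k‖) := ⟨_, rfl⟩
      have hc0 : 0 ≤ c := hc ▸ Finset.sum_nonneg fun k _ => by positivity
      rw [← hc] at key
      have : |2 * (inner ℂ η (f y) : ℂ).re| ≤ 0 := by
        refine le_of_forall_pos_le_add fun δ hδ => ?_
        refine (key (δ / (c + 1)) (by positivity)).trans ?_
        rw [zero_add, div_mul_eq_mul_div, div_le_iff₀ (by positivity)]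
        nlinarith
      have := abs_nonpos_iff.1 this
      linarith
  obtain ⟨_, ⟨a, ⟨ha, has⟩, rfl⟩, h⟩ := Metric.mem_closure_iff.1 hmem ε hε
  refine ⟨a, ha, has, fun k => lt_of_le_of_lt ?_ h⟩
  rw [dist_comm, dist_eq_norm]
  exact PiLp.norm_apply_le (f a - f y) k

end Amplification

/-! ### Kaplansky's density theorem -/

section Kaplansky

variable {L : Type*} [NormedAddCommGroup L] [InnerProductSpace ℂ L] [CompleteSpace L]

/-- The operator `(1 + a²)⁻¹`. -/
def cfcResolvent (a : L →L[ℂ] L) : L →L[ℂ] L := cfc (fun t : ℝ => (1 + t * t)⁻¹) a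

theorem continuous_inv_one_add_sq : Continuous fun t : ℝ => (1 + t * t)⁻¹ :=
  (by fun_prop : Continuous fun t : ℝ => 1 + t * t).inv₀ fun t => by nlinarith [mul_self_nonneg t]

theorem cfcResolvent_mul_one_add {a : L →L[ℂ] L} (ha : IsSelfAdjoint a) :
    cfcResolvent a * (1 + a * a) = 1 ∧ (1 + a * a) * cfcResolvent a = 1 := by
  have h1 : 1 + a * a = cfc (fun t : ℝ => 1 + t * t) a := by
    rw [cfc_add .., cfc_mul .., cfc_const_one .., cfc_id' ..]
  rw [h1, cfcResolvent,
    ← cfc_mul _ _ a continuous_inv_one_add_sq.continuousOn (by fun_prop),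
    ← cfc_mul _ _ a (by fun_prop) continuous_inv_one_add_sq.continuousOn]
  have h0 : ∀ t : ℝ, 1 + t * t ≠ 0 := fun t => by nlinarith [mul_self_nonneg t]
  simp only [inv_mul_cancel₀ (h0 _), mul_inv_cancel₀ (h0 _)]
  exact ⟨cfc_const_one ℝ a, cfc_const_one ℝ a⟩

theorem norm_cfcResolvent_le (a : L →L[ℂ] L) : ‖cfcResolvent a‖ ≤ 1 :=
  norm_cfc_le zero_le_one fun t _ => by
    have h : 0 < 1 + t * t := by nlinarith [mul_self_nonneg t]
    rw [Real.norm_eq_abs, abs_of_nonneg (inv_nonneg.2 h.le)]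
    exact inv_le_one_of_one_le₀ (by nlinarith [mul_self_nonneg t])

theorem cfcResolvent_mul {a : L →L[ℂ] L} (ha : IsSelfAdjoint a) :
    cfcResolvent a * a = cfc (fun t : ℝ => (1 + t * t)⁻¹ * t) a := by
  rw [cfc_mul _ _ a continuous_inv_one_add_sq.continuousOn (by fun_prop), cfc_id' ℝ a, cfcResolvent]

theorem abs_two_mul_inv_mul_le (t : ℝ) : |2 * ((1 + t * t)⁻¹ * t)| ≤ 1 := by
  have h : 0 < 1 + t * t := by nlinarith [mul_self_nonneg t]
  rw [← mul_assoc, mul_comm (2 : ℝ), mul_assoc, inv_mul_eq_div, abs_div, abs_of_pos h,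
    div_le_one h, abs_le]
  constructor <;> nlinarith [sq_nonneg (t - 1), sq_nonneg (t + 1)]

theorem norm_two_smul_cfcResolvent_mul_le {a : L →L[ℂ] L} (ha : IsSelfAdjoint a) :
    ‖(2 : ℝ) • (cfcResolvent a * a)‖ ≤ 1 := by
  rw [cfcResolvent_mul ha, ← cfc_const_mul _ (fun t : ℝ => (1 + t * t)⁻¹ * t) _
    (continuous_inv_one_add_sq.mul continuous_id).continuousOn]
  exact norm_cfc_le zero_le_one fun t _ => abs_two_mul_inv_mul_le t

/-- The function `2t / (1 + t²)` is bounded by one and strongly continuous on all selfadjoint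
operators, with no norm bound on `a`: with `r` the resolvent, `r(a) a - y r(y) = r(a) (a - y) r(y) -
r(a) a (a - y) y r(y)`. -/
theorem norm_two_smul_cfcResolvent_sub_apply_le {a y : L →L[ℂ] L} (ha : IsSelfAdjoint a)
    (hy : IsSelfAdjoint y) (v : L) :
    ‖((2 : ℝ) • (cfcResolvent a * a) - (2 : ℝ) • (y * cfcResolvent y)) v‖ ≤
      2 * ‖a (cfcResolvent y v) - y (cfcResolvent y v)‖ +
        ‖a (y (cfcResolvent y v)) - y (y (cfcResolvent y v))‖ := by
  have h1 : cfcResolvent a * a - y * cfcResolvent y = cfcResolvent a * (a - y) * cfcResolvent y -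
      cfcResolvent a * a * (a - y) * (y * cfcResolvent y) := by
    calc cfcResolvent a * a - y * cfcResolvent y =
        cfcResolvent a * a * ((1 + y * y) * cfcResolvent y) -
          (cfcResolvent a * (1 + a * a)) * y * cfcResolvent y := by
          rw [(cfcResolvent_mul_one_add ha).1, (cfcResolvent_mul_one_add hy).2, mul_one, one_mul]
      _ = _ := by noncomm_ring
  rw [← smul_sub, h1, smul_sub, _root_.sub_apply]
  refine (norm_sub_le _ _).trans (add_le_add ?_ ?_)
  · rw [_root_.smul_apply, norm_smul, Real.norm_ofNat]
    gcongr
    simpa using (cfcResolvent a).le_of_opNorm_le (norm_cfcResolvent_le a)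
      (a (cfcResolvent y v) - y (cfcResolvent y v))
  · simpa using ((2 : ℝ) • (cfcResolvent a * a)).le_of_opNorm_le
      (norm_two_smul_cfcResolvent_mul_le ha)
      (a (y (cfcResolvent y v)) - y (y (cfcResolvent y v)))

/-- On `[-1, 1]` the function `2t / (1 + t²)` has the continuous right inverse `t / (1 + √(1 -
t²))`; functional calculus keeps `y` in the bicommutant. -/
theorem exists_eq_two_smul_mul_cfcResolvent {x : L →L[ℂ] L} (hx : IsSelfAdjoint x)
    (hx1 : ‖x‖ ≤ 1) : ∃ y : L →L[ℂ] L, IsSelfAdjoint y ∧ (∀ b, Commute x b → Commute y b) ∧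
      x = (2 : ℝ) • (y * cfcResolvent y) := by
  have hg : Continuous fun t : ℝ => t / (1 + √(1 - t * t)) :=
    continuous_id.div (by fun_prop) fun t => by positivity
  obtain ⟨y, hy⟩ : ∃ y, y = cfc (fun t : ℝ => t / (1 + √(1 - t * t))) x := ⟨_, rfl⟩
  have hys : IsSelfAdjoint y := hy ▸ cfc_predicate _ _
  refine ⟨y, hys, fun b hb => hy ▸ hb.cfc_real _, ?_⟩
  have hf : Continuous fun t : ℝ => 2 * (t * (1 + t * t)⁻¹) :=
    continuous_const.mul (continuous_id.mul continuous_inv_one_add_sq)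
  have h1 : (2 : ℝ) • (y * cfcResolvent y) = cfc (fun t : ℝ => 2 * (t * (1 + t * t)⁻¹)) y := by
    rw [cfc_const_mul _ (fun t : ℝ => t * (1 + t * t)⁻¹) _ (continuous_id.mul continuous_inv_one_add_sq).continuousOn,
      cfc_mul _ _ y (by fun_prop) continuous_inv_one_add_sq.continuousOn, cfc_id' ℝ y, cfcResolvent]
  rw [h1, hy, ← cfc_comp' _ _ x hf.continuousOn hg.continuousOn]
  conv_lhs => rw [← cfc_id' ℝ x]
  refine cfc_congr fun t ht => ?_
  have ht1 : |t| ≤ 1 := by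
    refine (?_ : _ ≤ ‖x‖).trans hx1
    simpa [cfc_id' ℝ x] using norm_apply_le_norm_cfc (fun t : ℝ => t) x ht
  have ht2 : 0 ≤ 1 - t * t := by nlinarith [abs_le.1 ht1]
  have hs := Real.mul_self_sqrt ht2
  have hs0 := Real.sqrt_nonneg (1 - t * t)
  obtain ⟨s, hs'⟩ : ∃ s, s = √(1 - t * t) := ⟨_, rfl⟩
  simp only [← hs'] at hs hs0 ⊢
  have h2 : (1 + s) ≠ 0 := by positivity
  have h3 : 1 + t / (1 + s) * (t / (1 + s)) = 2 / (1 + s) := by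
    field_simp
    nlinarith
  rw [h3]
  field_simp

/-- A form of Kaplansky's density theorem. -/
theorem exists_mem_norm_le_norm_sub_apply_lt (A : StarSubalgebra ℂ (L →L[ℂ] L)) {x : L →L[ℂ] L}
    (hx : x ∈ Set.centralizer (Set.centralizer (A : Set (L →L[ℂ] L)))) (hxs : IsSelfAdjoint x)
    (hx1 : ‖x‖ ≤ 1) {n : ℕ} (ζ : Fin n → L) {ε : ℝ} (hε : 0 < ε) :
    ∃ b ∈ A, ‖b‖ ≤ 2 ∧ ∀ k, ‖b (ζ k) - x (ζ k)‖ < ε := by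
  obtain ⟨y, hys, hyc, hxy⟩ := exists_eq_two_smul_mul_cfcResolvent hxs hx1
  have hy : y ∈ Set.centralizer (Set.centralizer (A : Set (L →L[ℂ] L))) := fun b hb =>
    (hyc b (hx b hb).symm).eq.symm
  -- The tolerance gives `2 · ε/6 + ε/6 = ε/2` in the resolvent estimate; the other half is spent on
  -- the norm approximation below.
  obtain ⟨a, haA, has, ha⟩ := exists_isSelfAdjoint_mem_norm_sub_apply_lt A hy hys
    (Fin.append (fun k => cfcResolvent y (ζ k)) fun k => y (cfcResolvent y (ζ k)))
    (ε := ε / 6) (by positivity)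
  have h1 : ∀ k, ‖a (cfcResolvent y (ζ k)) - y (cfcResolvent y (ζ k))‖ < ε / 6 := fun k => by
    simpa only [Fin.append_left] using ha (Fin.castAdd n k)
  have h2 : ∀ k, ‖a (y (cfcResolvent y (ζ k))) - y (y (cfcResolvent y (ζ k)))‖ < ε / 6 :=
    fun k => by simpa only [Fin.append_right] using ha (Fin.natAdd n k)
  have hmem : (2 : ℝ) • (cfcResolvent a * a) ∈ closure (A : Set (L →L[ℂ] L)) := by
    have : cfc (fun t : ℝ => 2 * ((1 + t * t)⁻¹ * t)) a ∈ A.topologicalClosure :=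
      cfc_mem (hs := A.isClosed_topologicalClosure) (𝕜' := ℂ) _ (A.le_topologicalClosure haA)
    rwa [cfc_const_mul _ (fun t : ℝ => (1 + t * t)⁻¹ * t) _
        (continuous_inv_one_add_sq.mul continuous_id).continuousOn,
      ← cfcResolvent_mul has] at this
  obtain ⟨M, hM0, hM⟩ : ∃ M : ℝ, 0 < M ∧ ∀ k, ‖ζ k‖ ≤ M :=
    ⟨1 + ∑ k, ‖ζ k‖, by positivity, fun k =>
      (Finset.single_le_sum (f := fun k => ‖ζ k‖) (fun _ _ => norm_nonneg _)
        (Finset.mem_univ k)).trans (by linarith)⟩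
  -- `A` is not assumed norm closed, so the contraction `2 r(a) a` is only a norm limit of elements
  -- of `A`. Staying within distance one of it yields the bound 2 instead of 1.
  obtain ⟨b, hbA, hb⟩ := Metric.mem_closure_iff.1 hmem (min 1 (ε / (2 * M))) (by positivity)
  rw [dist_comm, dist_eq_norm] at hb
  refine ⟨b, hbA, ?_, fun k => ?_⟩
  · have h3 := norm_le_norm_add_norm_sub' b ((2 : ℝ) • (cfcResolvent a * a))
    have h4 := norm_two_smul_cfcResolvent_mul_le has
    have h5 := hb.le.trans (min_le_left _ _)
    linarith
  · have h3 := norm_two_smul_cfcResolvent_sub_apply_le has hys (ζ k)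
    rw [← hxy] at h3
    have h4 : ‖(b - (2 : ℝ) • (cfcResolvent a * a)) (ζ k)‖ ≤ ε / (2 * M) * M :=
      ((b - (2 : ℝ) • (cfcResolvent a * a)).le_of_opNorm_le
        (hb.le.trans (min_le_right _ _)) _).trans (by gcongr; exact hM k)
    have h5 : ε / (2 * M) * M = ε / 2 := by field_simp
    have h6 : b (ζ k) - x (ζ k) = (b - (2 : ℝ) • (cfcResolvent a * a)) (ζ k) +
        ((2 : ℝ) • (cfcResolvent a * a) - x) (ζ k) := by
      simp only [_root_.sub_apply]
      abel
    rw [h6]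
    refine (norm_add_le _ _).trans_lt ?_
    have := h1 k
    have := h2 k
    linarith

end Kaplansky

/-! ### Density for matrices -/

section MatrixDensity

variable {L : Type*} [NormedAddCommGroup L] [InnerProductSpace ℂ L] [CompleteSpace L]

/-- The operators on `Lⁿ` whose matrix has its entries in `A`. -/
def matrixSubalgebra (A : StarSubalgebra ℂ (L →L[ℂ] L)) (n : ℕ) :
    StarSubalgebra ℂ (PiLp 2 (fun _ : Fin n => L) →L[ℂ] PiLp 2 (fun _ : Fin n => L)) :=
  StarSubalgebra.map (matrixOperatorHom L n)
    { carrier := {X | ∀ k l, X k l ∈ A}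
      mul_mem' := fun {X Y} hX hY k l => by
        rw [CStarMatrix.mul_apply]
        exact sum_mem fun i _ => mul_mem (hX k i) (hY i l)
      add_mem' := fun {X Y} hX hY k l => add_mem (hX k l) (hY k l)
      algebraMap_mem' := fun r k l => by
        rw [Algebra.algebraMap_eq_smul_one, CStarMatrix.smul_apply, CStarMatrix.one_apply]
        refine A.smul_mem ?_ r
        split
        · exact one_mem A
        · exact zero_mem A
      star_mem' := fun {X} hX k l => by
        rw [CStarMatrix.star_apply]
        exact star_mem (hX l k) }

theorem matrixOperator_mem_matrixSubalgebra {A : StarSubalgebra ℂ (L →L[ℂ] L)} {n : ℕ}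
    {X : CStarMatrix (Fin n) (Fin n) (L →L[ℂ] L)} (hX : ∀ k l, X k l ∈ A) :
    matrixOperator X ∈ matrixSubalgebra A n :=
  ⟨X, hX, rfl⟩

/-- Commuting with the scalar matrix units makes `Q` diagonal with equal entries; commuting with
diagonal `A` puts this entry into `A'`. -/
theorem exists_eq_diagonalMatrix {A : StarSubalgebra ℂ (L →L[ℂ] L)} {n : ℕ}
    {Q : CStarMatrix (Fin n) (Fin n) (L →L[ℂ] L)}
    (hQ : ∀ X : CStarMatrix (Fin n) (Fin n) (L →L[ℂ] L), (∀ k l, X k l ∈ A) → X * Q = Q * X) :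
    ∃ q ∈ Set.centralizer (A : Set (L →L[ℂ] L)), Q = diagonalMatrix n q := by
  -- For `n = 0` there is no entry to choose as `q`, and any element of `A'` will do.
  rcases Nat.eq_zero_or_pos n with rfl | hn
  · exact ⟨0, by simp [Set.mem_centralizer_iff], CStarMatrix.ext fun k => k.elim0⟩
  have hE : ∀ i j k l : Fin n, (if k = i then Q j l else 0) = if j = l then Q k i else 0 := by
    intro i j k l
    obtain ⟨E, hE⟩ : ∃ E : CStarMatrix (Fin n) (Fin n) (L →L[ℂ] L),
        ∀ a b, E a b = if a = i then if b = j then 1 else 0 else 0 :=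
      ⟨CStarMatrix.ofMatrix (Matrix.of fun a b => if a = i then if b = j then 1 else 0 else 0),
        fun _ _ => rfl⟩
    have h := congrArg (fun Y => Y k l) (hQ E fun a b => by
        rw [hE]
        split_ifs
        exacts [one_mem A, zero_mem A, zero_mem A])
    simp only [CStarMatrix.mul_apply, hE] at h
    rw [Finset.sum_eq_single j, Finset.sum_eq_single i] at h
    · by_cases h1 : k = i <;> by_cases h2 : j = l <;> simp_all [eq_comm]
    · intro b _ hb
      simp [hb]
    · simp
    · intro b _ hb
      simp [hb]
    · simp
  refine ⟨Q ⟨0, hn⟩ ⟨0, hn⟩, fun a ha => ?_, CStarMatrix.ext fun k l => ?_⟩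
  · refine commute_diagonalMatrix_iff.1 (hQ _ fun k l => ?_) _ _
    simp only [diagonalMatrix, CStarMatrix.ofMatrix_apply, Matrix.diagonal_apply]
    split_ifs
    exacts [ha, zero_mem A]
  · simp only [diagonalMatrix, CStarMatrix.ofMatrix_apply, Matrix.diagonal_apply]
    split_ifs with h
    · subst h
      simpa using (hE k ⟨0, hn⟩ k ⟨0, hn⟩).symm
    · have := hE l l k l
      simpa [h] using this.symm

/-- The commutant of `𝕄ₙ(A)` consists of diagonal elements of `A'`, so matrices with entries in
`A''` lie in the bicommutant of `𝕄ₙ(A)`. -/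
theorem matrixOperator_mem_centralizer {A : StarSubalgebra ℂ (L →L[ℂ] L)} {n : ℕ}
    {X : CStarMatrix (Fin n) (Fin n) (L →L[ℂ] L)}
    (hX : ∀ k l, X k l ∈ Set.centralizer (Set.centralizer (A : Set (L →L[ℂ] L)))) :
    matrixOperator X ∈ Set.centralizer (Set.centralizer (matrixSubalgebra A n : Set
      (PiLp 2 (fun _ : Fin n => L) →L[ℂ] PiLp 2 (fun _ : Fin n => L)))) := by
  intro T hT
  obtain ⟨Q, rfl⟩ := matrixOperatorHom_surjective T
  obtain ⟨q, hq, rfl⟩ := exists_eq_diagonalMatrix (A := A) (Q := Q) fun Y hY =>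
    matrixOperatorHom_injective (by
      rw [map_mul, map_mul]
      exact hT _ (matrixOperator_mem_matrixSubalgebra hY))
  rw [← matrixOperatorHom_apply, ← map_mul, ← map_mul]
  congr 1
  exact commute_diagonalMatrix_iff.2 fun k l => hX k l q hq

theorem exists_matrix_norm_le_norm_sub_apply_lt {A : StarSubalgebra ℂ (L →L[ℂ] L)} {n : ℕ}
    {X : CStarMatrix (Fin n) (Fin n) (L →L[ℂ] L)}
    (hX : ∀ k l, X k l ∈ Set.centralizer (Set.centralizer (A : Set (L →L[ℂ] L))))
    (hXs : IsSelfAdjoint X) (hX1 : ‖X‖ ≤ 1) (s : Finset L) {ε : ℝ} (hε : 0 < ε) :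
    ∃ B : CStarMatrix (Fin n) (Fin n) (L →L[ℂ] L), (∀ k l, B k l ∈ A) ∧ ‖B‖ ≤ 2 ∧
      ∀ v ∈ s, ∀ k l, ‖B k l v - X k l v‖ < ε := by
  -- Test vectors: each `v ∈ s` placed in each coordinate `l`, which reads off the columns of a
  -- matrix and controls all entries at once.
  let e := Fintype.equivFin (s × Fin n)
  obtain ⟨_, ⟨B, hBA, rfl⟩, hB, hBX⟩ := exists_mem_norm_le_norm_sub_apply_lt (matrixSubalgebra A n)
    (matrixOperator_mem_centralizer hX) (hXs.map (matrixOperatorHom L n))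
    (by rwa [norm_matrixOperator]) (fun i => WithLp.toLp 2 (Pi.single (e.symm i).2
      ((e.symm i).1 : L))) hε
  have hB' : ‖matrixOperator B‖ ≤ 2 := hB
  rw [norm_matrixOperator] at hB'
  refine ⟨B, hBA, hB', fun v hv k l => lt_of_le_of_lt ?_ (hBX (e ⟨⟨v, hv⟩, l⟩))⟩
  rw [Equiv.symm_apply_apply]
  have hsingle : ∀ Y : CStarMatrix (Fin n) (Fin n) (L →L[ℂ] L),
      matrixOperator Y (WithLp.toLp 2 (Pi.single l v)) k = Y k l v := by
    intro Y
    rw [matrixOperator_apply, Finset.sum_eq_single l]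
    · simp
    · intro j _ hj
      simp [hj]
    · simp
  rw [← hsingle, ← hsingle, ← PiLp.sub_apply]
  exact PiLp.norm_apply_le _ k

end MatrixDensity

/-! ### Normal maps and passage to the ultraweak closure -/

section Normal

variable {L : Type*} [NormedAddCommGroup L] [InnerProductSpace ℂ L]

theorem continuous_ultraweak_inner (η ξ : L) :
    @Continuous _ _ (ultraweakTopology L) _ fun x : L →L[ℂ] L => (inner ℂ η (x ξ) : ℂ) := by
  have h : (fun x : L →L[ℂ] L => (inner ℂ η (x ξ) : ℂ)) = fun x : L →L[ℂ] L =>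
      ∑' n, inner ℂ ((lp.single (E := fun _ : ℕ => L) 2 0 η) n)
        (x ((lp.single (E := fun _ : ℕ => L) 2 0 ξ) n)) := by
    funext x
    rw [tsum_eq_single 0]
    · simp
    · intro n hn
      simp [lp.single_apply, Pi.single_eq_of_ne hn]
  rw [h]
  exact continuous_iInf_dom (i := lp.single (E := fun _ : ℕ => L) 2 0 ξ)
    (continuous_iInf_dom (i := lp.single (E := fun _ : ℕ => L) 2 0 η) continuous_induced_dom)

/-- Dominated convergence in the defining series. Boundedness is essential, which is why Kaplansky's
theorem is needed and not just bicommutant density. -/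
theorem tendsto_ultraweak_of_bounded {ι : Type*} {l : Filter ι} {x : ι → (L →L[ℂ] L)}
    {x₀ : L →L[ℂ] L} {c : ℝ} (hx : ∀ i, ‖x i‖ ≤ c)
    (h : ∀ v, Filter.Tendsto (fun i => x i v) l (nhds (x₀ v))) :
    Filter.Tendsto x l (@nhds _ (ultraweakTopology L) x₀) := by
  simp only [nhds_iInf, nhds_induced, Filter.tendsto_iInf, Filter.tendsto_comap_iff]
  intro ξ η
  have hsum : ∀ ζ : lp (fun _ : ℕ => L) 2, Summable fun n => ‖ζ n‖ ^ 2 := fun ζ => by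
    have := (lp.memℓp ζ).summable (by norm_num)
    simpa using this
  refine tendsto_tsum_of_dominated_convergence
    (bound := fun n => c * (‖η n‖ ^ 2 + ‖ξ n‖ ^ 2)) (((hsum η).add (hsum ξ)).mul_left c) ?_ ?_
  · intro n
    exact Filter.Tendsto.inner tendsto_const_nhds (h (ξ n))
  · refine Filter.Eventually.of_forall fun i n => ?_
    have hc : 0 ≤ c := (norm_nonneg _).trans (hx i)
    calc _ ≤ ‖η n‖ * ‖x i (ξ n)‖ := norm_inner_le_norm _ _
      _ ≤ ‖η n‖ * (c * ‖ξ n‖) := by gcongr; exact (x i).le_of_opNorm_le (hx i) _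
      _ = c * (‖η n‖ * ‖ξ n‖) := by ring
      _ ≤ _ := by
        gcongr
        nlinarith [sq_nonneg (‖η n‖ - ‖ξ n‖), sq_nonneg ‖η n‖, sq_nonneg ‖ξ n‖]

variable [CompleteSpace L] {N : VonNeumannAlgebra L}

theorem IsNormalMap.tendsto_inner {φ : N.toStarSubalgebra → (L →L[ℂ] L)} (hφ : IsNormalMap φ)
    {ι : Type*} {l : Filter ι} {x : ι → N.toStarSubalgebra} {x₀ : N.toStarSubalgebra} {c : ℝ}
    (hx : ∀ i, ‖(x i : L →L[ℂ] L)‖ ≤ c)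
    (h : ∀ v, Filter.Tendsto (fun i => (x i : L →L[ℂ] L) v) l (nhds ((x₀ : L →L[ℂ] L) v)))
    (η ξ : L) : Filter.Tendsto (fun i => (inner ℂ η (φ (x i) ξ) : ℂ)) l
      (nhds (inner ℂ η (φ x₀ ξ))) := by
  have h1 := tendsto_ultraweak_of_bounded hx h
  have h2 : Filter.Tendsto x l (@nhds _ (TopologicalSpace.induced
      (fun x : N.toStarSubalgebra => (x : L →L[ℂ] L)) (ultraweakTopology L)) x₀) := by
    rw [@nhds_induced _ _ (ultraweakTopology L), Filter.tendsto_comap_iff]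
    exact h1
  have h3 := (@Continuous.tendsto _ _ (_) (_) _ hφ x₀).comp h2
  exact (@Continuous.tendsto _ _ (ultraweakTopology L) _ _ (continuous_ultraweak_inner η ξ)
    (φ x₀)).comp h3

/-- Approximants over `A`, indexed by a finite set of vectors and a tolerance `1 / (m + 1)`,
converge to `X` strongly in each entry. The estimate passes to the limit through inner products; the
factor 2 is the norm bound of the approximants. -/
theorem norm_map_le_of_isSelfAdjoint_of_norm_le_one {φ : N.toStarSubalgebra → (L →L[ℂ] L)}
    (hφ : IsNormalMap φ) {A : StarSubalgebra ℂ (L →L[ℂ] L)} (hAN : ∀ a ∈ A, a ∈ N)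
    (hNA : ∀ x ∈ N, x ∈ Set.centralizer (Set.centralizer (A : Set (L →L[ℂ] L)))) {n : ℕ}
    {C : ℝ} (hC : ∀ X : Matrix (Fin n) (Fin n) N.toStarSubalgebra,
      (∀ k l, (X k l : L →L[ℂ] L) ∈ A) → ‖CStarMatrix.ofMatrix (X.map φ)‖ ≤
        C * ‖CStarMatrix.ofMatrix (X.map fun x => (x : L →L[ℂ] L))‖) (hC0 : 0 ≤ C)
    (X : Matrix (Fin n) (Fin n) N.toStarSubalgebra)
    (hXs : IsSelfAdjoint (CStarMatrix.ofMatrix (X.map fun x => (x : L →L[ℂ] L))))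
    (hX1 : ‖CStarMatrix.ofMatrix (X.map fun x => (x : L →L[ℂ] L))‖ ≤ 1) :
    ‖CStarMatrix.ofMatrix (X.map φ)‖ ≤ C * 2 := by
  have key : ∀ i : Finset L × ℕ, ∃ B : Matrix (Fin n) (Fin n) N.toStarSubalgebra,
      (∀ k l, (B k l : L →L[ℂ] L) ∈ A) ∧
      ‖CStarMatrix.ofMatrix (B.map fun x => (x : L →L[ℂ] L))‖ ≤ 2 ∧
      ∀ v ∈ i.1, ∀ k l, ‖(B k l : L →L[ℂ] L) v - (X k l : L →L[ℂ] L) v‖ < 1 / ((i.2 : ℝ) + 1) := by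
    intro i
    obtain ⟨B, hBA, hB, hBX⟩ := exists_matrix_norm_le_norm_sub_apply_lt (A := A)
      (fun k l => hNA _ (X k l).2) hXs hX1 i.1 (Nat.one_div_pos_of_nat (α := ℝ) (n := i.2))
    exact ⟨fun k l => ⟨B k l, hAN _ (hBA k l)⟩, hBA, hB, hBX⟩
  choose B hBA hB hBX using key
  classical
  have hlim : ∀ k l v, Filter.Tendsto (fun i => (B i k l : L →L[ℂ] L) v) Filter.atTop
      (nhds ((X k l : L →L[ℂ] L) v)) := by
    intro k l v
    rw [tendsto_iff_norm_sub_tendsto_zero]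
    have h0 : Filter.Tendsto (fun i : Finset L × ℕ => 1 / ((i.2 : ℝ) + 1)) Filter.atTop
        (nhds 0) := by
      rw [← Filter.prod_atTop_atTop_eq]
      exact tendsto_one_div_add_atTop_nhds_zero_nat.comp Filter.tendsto_snd
    refine tendsto_of_tendsto_of_tendsto_of_le_of_le' tendsto_const_nhds h0
      (Filter.Eventually.of_forall fun i => norm_nonneg _) ?_
    filter_upwards [Filter.eventually_ge_atTop (({v}, 0) : Finset L × ℕ)] with i hi
    exact (hBX i v (hi.1 (Finset.mem_singleton_self v)) k l).le
  refine CStarMatrix.norm_le_of_inner_le (by positivity) fun η ξ => ?_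
  have hlim' : Filter.Tendsto (fun i => ‖∑ k, ∑ l, (inner ℂ (η k) (φ (B i k l) (ξ l)) : ℂ)‖)
      Filter.atTop (nhds ‖∑ k, ∑ l, (inner ℂ (η k) (φ (X k l) (ξ l)) : ℂ)‖) := by
    refine Filter.Tendsto.norm (tendsto_finsetSum _ fun k _ => tendsto_finsetSum _ fun l _ => ?_)
    exact hφ.tendsto_inner (c := 2) (fun i => (CStarMatrix.norm_entry_le_norm
      (M := CStarMatrix.ofMatrix ((B i).map fun x => (x : L →L[ℂ] L)))).trans (hB i))
      (hlim k l) _ _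
  refine le_of_tendsto hlim' (Filter.Eventually.of_forall fun i => ?_)
  refine (norm_sum_inner_le (CStarMatrix.ofMatrix ((B i).map φ)) η ξ).trans ?_
  gcongr
  exact (hC _ (hBA i)).trans (by gcongr; exact hB i)

/-- Density was proved for selfadjoint matrices only; the real and imaginary parts of `X` each
contribute `2 C ‖X‖`. -/
theorem isCompletelyBounded_of_isNormalMap {φ : N.toStarSubalgebra →ₗ[ℂ] (L →L[ℂ] L)}
    (hφ : IsNormalMap φ) {A : StarSubalgebra ℂ (L →L[ℂ] L)} (hAN : ∀ a ∈ A, a ∈ N)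
    (hNA : ∀ x ∈ N, x ∈ Set.centralizer (Set.centralizer (A : Set (L →L[ℂ] L))))
    {C : ℝ} (hC : ∀ (n : ℕ) (X : Matrix (Fin n) (Fin n) N.toStarSubalgebra),
      (∀ k l, (X k l : L →L[ℂ] L) ∈ A) → ‖CStarMatrix.ofMatrix (X.map φ)‖ ≤
        C * ‖CStarMatrix.ofMatrix (X.map fun x => (x : L →L[ℂ] L))‖) (hC0 : 0 ≤ C) :
    IsCompletelyBounded φ := by
  refine ⟨4 * C, fun n X => ?_⟩
  let v : Matrix (Fin n) (Fin n) N.toStarSubalgebra →ₗ[ℂ]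
      CStarMatrix (Fin n) (Fin n) (L →L[ℂ] L) :=
    { toFun := fun X => CStarMatrix.ofMatrix (X.map fun x => (x : L →L[ℂ] L))
      map_add' := fun X Y => rfl
      map_smul' := fun c X => rfl }
  let Φ : Matrix (Fin n) (Fin n) N.toStarSubalgebra →ₗ[ℂ]
      CStarMatrix (Fin n) (Fin n) (L →L[ℂ] L) :=
    { toFun := fun X => CStarMatrix.ofMatrix (X.map φ)
      map_add' := fun X Y => CStarMatrix.ext fun k l => map_add φ (X k l) (Y k l)
      map_smul' := fun c X => CStarMatrix.ext fun k l => map_smul φ c (X k l) }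
  have hv : ∀ X, v X.conjTranspose = star (v X) := fun X => rfl
  have hsa : ∀ X, IsSelfAdjoint (v X) → ‖Φ X‖ ≤ C * 2 * ‖v X‖ := by
    intro X hX
    by_cases h0 : ‖v X‖ = 0
    · have hX0 : X = 0 := by
        ext k l
        have := congrArg (fun Y => Y k l) (norm_eq_zero.1 h0)
        exact congrArg (fun T : L →L[ℂ] L => T _) this
      rw [hX0, map_zero, norm_zero]
      positivity
    · have hpos : 0 < ‖v X‖ := lt_of_le_of_ne (norm_nonneg _) (Ne.symm h0)
      have h1 := norm_map_le_of_isSelfAdjoint_of_norm_le_one hφ hAN hNA (hC n) hC0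
        (((‖v X‖⁻¹ : ℝ) : ℂ) • X) (by
          change IsSelfAdjoint (v (((‖v X‖⁻¹ : ℝ) : ℂ) • X))
          rw [map_smul]
          exact IsSelfAdjoint.smul (by simp [IsSelfAdjoint]) hX) (by
          change ‖v (((‖v X‖⁻¹ : ℝ) : ℂ) • X)‖ ≤ 1
          rw [map_smul, norm_smul, Complex.norm_real, norm_inv, norm_norm, inv_mul_cancel₀ h0])
      change ‖Φ (((‖v X‖⁻¹ : ℝ) : ℂ) • X)‖ ≤ _ at h1
      rw [map_smul, norm_smul, Complex.norm_real, norm_inv, norm_norm, inv_mul_le_iff₀ hpos] at h1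
      linarith
  have hdec : X = (2⁻¹ : ℂ) • (X + X.conjTranspose) +
      (2⁻¹ : ℂ) • (X - X.conjTranspose) := by module
  have h1 : ‖Φ ((2⁻¹ : ℂ) • (X + X.conjTranspose))‖ ≤ C * 2 * ‖v X‖ := by
    refine (hsa _ ?_).trans ?_
    · rw [map_smul, map_add, hv]
      exact IsSelfAdjoint.smul (by simp [IsSelfAdjoint]) (IsSelfAdjoint.add_star_self _)
    · gcongr
      rw [map_smul, map_add, hv, norm_smul]
      have := norm_add_le (v X) (star (v X))
      rw [show ‖star (v X)‖ = ‖v X‖ from norm_star (v X)] at this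
      norm_num
      linarith
  have h2 : ‖Φ ((2⁻¹ : ℂ) • (X - X.conjTranspose))‖ ≤ C * 2 * ‖v X‖ := by
    have h3 := hsa (Complex.I • (2⁻¹ : ℂ) • (X - X.conjTranspose)) (by
      rw [map_smul, map_smul, map_sub, hv, IsSelfAdjoint, star_smul, star_smul, star_sub, star_star]
      simp only [RCLike.star_def, Complex.conj_I, map_inv₀, map_ofNat]
      module)
    rw [map_smul Φ, map_smul v, norm_smul, norm_smul, Complex.norm_I, one_mul, one_mul] at h3
    refine h3.trans ?_
    gcongr
    rw [map_smul, map_sub, hv, norm_smul]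
    have := norm_sub_le (v X) (star (v X))
    rw [show ‖star (v X)‖ = ‖v X‖ from norm_star (v X)] at this
    norm_num
    linarith
  change ‖Φ X‖ ≤ 4 * C * ‖v X‖
  calc ‖Φ X‖ ≤ ‖Φ ((2⁻¹ : ℂ) • (X + X.conjTranspose))‖ +
        ‖Φ ((2⁻¹ : ℂ) • (X - X.conjTranspose))‖ := by
        conv_lhs => rw [hdec, map_add]
        exact norm_add_le _ _
    _ ≤ _ := by linarith

end Normal

/-! ### The local *-algebra and the bound on it -/

section LocallyCommuting

variable {L K : Type*}
    [NormedAddCommGroup L] [InnerProductSpace ℂ L] [CompleteSpace L]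
    [NormedAddCommGroup K] [InnerProductSpace ℂ K] [CompleteSpace K]

/-- The elements of `N` that commute with the image of the relative commutant of some member
of a directed family of subalgebras. -/
def locallyCommuting (N : VonNeumannAlgebra L) (S : VonNeumannAlgebra K)
    (π : (K →L[ℂ] K) →⋆ₐ[ℂ] (L →L[ℂ] L)) (𝓕 : Set (StarSubalgebra ℂ (K →L[ℂ] K)))
    (hne : 𝓕.Nonempty) (hdir : DirectedOn (· ≤ ·) 𝓕) : StarSubalgebra ℂ (L →L[ℂ] L) where
  carrier := {x | x ∈ N ∧ ∃ F ∈ 𝓕, ∀ t ∈ S.relativeCommutant F, π t * x = x * π t}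
  mul_mem' := by
    rintro x y ⟨hx, F, hF, hxF⟩ ⟨hy, F', hF', hyF⟩
    -- Relative commutants shrink as the subalgebra grows, so both elements commute with that of the
    -- common upper bound `G`.
    obtain ⟨G, hG, hFG, hFG'⟩ := hdir F hF F' hF'
    refine ⟨mul_mem hx hy, G, hG, fun t ht => ?_⟩
    rw [VonNeumannAlgebra.mem_relativeCommutant] at ht
    rw [← mul_assoc, hxF t (VonNeumannAlgebra.mem_relativeCommutant.2
      ⟨ht.1, fun f hf => ht.2 f (hFG hf)⟩), mul_assoc,
      hyF t (VonNeumannAlgebra.mem_relativeCommutant.2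
      ⟨ht.1, fun f hf => ht.2 f (hFG' hf)⟩), mul_assoc]
  add_mem' := by
    rintro x y ⟨hx, F, hF, hxF⟩ ⟨hy, F', hF', hyF⟩
    obtain ⟨G, hG, hFG, hFG'⟩ := hdir F hF F' hF'
    refine ⟨add_mem hx hy, G, hG, fun t ht => ?_⟩
    rw [VonNeumannAlgebra.mem_relativeCommutant] at ht
    rw [mul_add, add_mul, hxF t (VonNeumannAlgebra.mem_relativeCommutant.2
      ⟨ht.1, fun f hf => ht.2 f (hFG hf)⟩), hyF t (VonNeumannAlgebra.mem_relativeCommutant.2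
      ⟨ht.1, fun f hf => ht.2 f (hFG' hf)⟩)]
  algebraMap_mem' := fun r =>
    ⟨N.toStarSubalgebra.algebraMap_mem r, hne.some, hne.some_mem, fun t _ =>
      (Algebra.commutes r (π t)).symm⟩
  star_mem' := by
    rintro x ⟨hx, F, hF, hxF⟩
    refine ⟨star_mem hx, F, hF, fun t ht => ?_⟩
    have h := congrArg star (hxF (star t) (star_mem ht))
    rw [star_mul, star_mul, map_star, star_star] at h
    exact h.symm

theorem IsBimoduleMap.isCompletelyBounded {N : VonNeumannAlgebra L} {S : VonNeumannAlgebra K}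
    {π : (K →L[ℂ] K) →⋆ₐ[ℂ] (L →L[ℂ] L)} {φ : N.toStarSubalgebra →L[ℂ] (L →L[ℂ] L)}
    (hmod : IsBimoduleMap S π φ) (hnormal : IsNormalMap φ) (hS : HasNoFiniteTypeISummand S)
    {𝓕 : Set (StarSubalgebra ℂ (K →L[ℂ] K))} (hne : 𝓕.Nonempty) (hdir : DirectedOn (· ≤ ·) 𝓕)
    (hfin : ∀ F ∈ 𝓕, FiniteDimensional ℂ F) (hFS : ∀ F ∈ 𝓕, ∀ f ∈ F, f ∈ S)
    (hN : ∀ x ∈ N, x ∈ Set.centralizer (Set.centralizer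
      (locallyCommuting N S π 𝓕 hne hdir : Set (L →L[ℂ] L)))) : IsCompletelyBounded φ := by
  have := hne.to_subtype
  refine isCompletelyBounded_of_isNormalMap (φ := φ.toLinearMap)
    (A := locallyCommuting N S π 𝓕 hne hdir) hnormal (fun a ha => ha.1) hN
    (C := 2 * ‖φ‖) (fun n X hX => ?_) (by positivity)
  choose _ F hF hcomm using hX
  -- A matrix has finitely many entries, so one member of the directed family serves them all.
  obtain ⟨G, hG, hFG⟩ : ∃ G ∈ 𝓕, ∀ i : Fin n × Fin n, F i.1 i.2 ≤ G := by
    obtain ⟨G, hG⟩ := hdir.directed_val.finite_le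
      (fun i : Fin n × Fin n => (⟨F i.1 i.2, hF i.1 i.2⟩ : 𝓕))
    exact ⟨G.1, G.2, hG⟩
  have := hfin G hG
  refine hmod.norm_amplification_le_of_commute_relativeCommutant hS G (hFS G hG) X
    fun k l t ht => hcomm k l t ?_
  rw [VonNeumannAlgebra.mem_relativeCommutant] at ht ⊢
  exact ⟨ht.1, fun f hf => ht.2 f (hFG (k, l) hf)⟩

end LocallyCommuting

/-! ### The local algebra generates `M ⊗̄ S` -/

section TensorGeneration

variable {H K : Type*}
    [NormedAddCommGroup H] [InnerProductSpace ℂ H]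
    [NormedAddCommGroup K] [InnerProductSpace ℂ K] [CompleteSpace K]

theorem exists_inner_tmul_eq_inner (ζ : HilbertTensor H K) (ξ : H) : ∃ k : K, ∀ v : K,
    (inner ℂ ζ ((ξ ⊗ₜ[ℂ] v : H ⊗[ℂ] K) : HilbertTensor H K) : ℂ) = inner ℂ k v := by
  let f : K →L[ℂ] ℂ := LinearMap.mkContinuous
    { toFun := fun v => inner ℂ ζ ((ξ ⊗ₜ[ℂ] v : H ⊗[ℂ] K) : HilbertTensor H K)
      map_add' := fun v w => by
        rw [TensorProduct.tmul_add, UniformSpace.Completion.coe_add, inner_add_right]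
      map_smul' := fun c v => by
        rw [TensorProduct.tmul_smul, UniformSpace.Completion.coe_smul, inner_smul_right]
        rfl } (‖ζ‖ * ‖ξ‖) fun v => by
      refine (norm_inner_le_norm (𝕜 := ℂ) ζ ((ξ ⊗ₜ[ℂ] v : H ⊗[ℂ] K) : HilbertTensor H K)).trans
        (le_of_eq ?_)
      rw [UniformSpace.Completion.norm_coe, TensorProduct.norm_tmul (𝕜 := ℂ), mul_assoc]
  refine ⟨(InnerProductSpace.toDual ℂ K).symm f, fun v => ?_⟩
  rw [InnerProductSpace.toDual_symm_apply]
  rfl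

variable [CompleteSpace H]

/-- On simple tensors both sides of the commutation relation become coefficients `⟪k, s η⟫`, by
slicing with Riesz representation; these are ultraweakly continuous in `s`. -/
theorem isClosed_commute_oneTensorHom (y : HilbertTensor H K →L[ℂ] HilbertTensor H K) :
    @IsClosed _ (ultraweakTopology K)
      {s : K →L[ℂ] K | y * oneTensorHom H K s = oneTensorHom H K s * y} := by
  have e : {s : K →L[ℂ] K | y * oneTensorHom H K s = oneTensorHom H K s * y} =
      ⋂ (ξ : H) (ξ' : H) (η : K) (η' : K), {s : K →L[ℂ] K |
        (inner ℂ ((ξ' ⊗ₜ[ℂ] η' : H ⊗[ℂ] K) : HilbertTensor H K)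
          ((y * oneTensorHom H K s) ((ξ ⊗ₜ[ℂ] η : H ⊗[ℂ] K) : HilbertTensor H K)) : ℂ) =
        inner ℂ ((ξ' ⊗ₜ[ℂ] η' : H ⊗[ℂ] K) : HilbertTensor H K)
          ((oneTensorHom H K s * y) ((ξ ⊗ₜ[ℂ] η : H ⊗[ℂ] K) : HilbertTensor H K))} := by
    ext s
    simp only [Set.mem_iInter]
    exact ⟨fun h ξ ξ' η η' => by rw [Set.mem_ofPred_eq, h], fun h =>
      HilbertTensor.clm_ext_inner fun ξ ξ' η η' => h ξ ξ' η η'⟩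
  rw [e]
  refine @isClosed_iInter _ _ (ultraweakTopology K) _ fun ξ =>
    @isClosed_iInter _ _ (ultraweakTopology K) _ fun ξ' =>
    @isClosed_iInter _ _ (ultraweakTopology K) _ fun η =>
    @isClosed_iInter _ _ (ultraweakTopology K) _ fun η' => ?_
  obtain ⟨k, hk⟩ := exists_inner_tmul_eq_inner
    (star y ((ξ' ⊗ₜ[ℂ] η' : H ⊗[ℂ] K) : HilbertTensor H K)) ξ
  obtain ⟨k', hk'⟩ := exists_inner_tmul_eq_inner
    (y ((ξ ⊗ₜ[ℂ] η : H ⊗[ℂ] K) : HilbertTensor H K)) ξ'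
  have h1 : ∀ s : K →L[ℂ] K, (inner ℂ ((ξ' ⊗ₜ[ℂ] η' : H ⊗[ℂ] K) : HilbertTensor H K)
      ((y * oneTensorHom H K s) ((ξ ⊗ₜ[ℂ] η : H ⊗[ℂ] K) : HilbertTensor H K)) : ℂ) =
      inner ℂ k (s η) := by
    intro s
    rw [← hk, mul_apply_eq_comp, oneTensorHom_apply, opTensor_coe_tmul,
      ContinuousLinearMap.star_eq_adjoint, ContinuousLinearMap.adjoint_inner_left]
    rfl
  have h2 : ∀ s : K →L[ℂ] K, (inner ℂ ((ξ' ⊗ₜ[ℂ] η' : H ⊗[ℂ] K) : HilbertTensor H K)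
      ((oneTensorHom H K s * y) ((ξ ⊗ₜ[ℂ] η : H ⊗[ℂ] K) : HilbertTensor H K)) : ℂ) =
      inner ℂ η' (s k') := by
    intro s
    rw [mul_apply_eq_comp, ← ContinuousLinearMap.adjoint_inner_left,
      ← ContinuousLinearMap.star_eq_adjoint, ← map_star, oneTensorHom_apply, opTensor_coe_tmul,
      ← inner_conj_symm]
    change (starRingEnd ℂ) (inner ℂ _ ((ξ' ⊗ₜ[ℂ] star s η' : H ⊗[ℂ] K) : HilbertTensor H K)) = _
    rw [hk', inner_conj_symm, ContinuousLinearMap.star_eq_adjoint,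
      ContinuousLinearMap.adjoint_inner_left]
  simp only [h1, h2]
  exact @isClosed_eq _ _ _ (ultraweakTopology K) _ _ _ (continuous_ultraweak_inner k η)
    (continuous_ultraweak_inner η' k')

/-- `M ⊗ 1` commutes with all of `1 ⊗ S`, and `1 ⊗ F` with `1 ⊗ (F' ∩ S)`, so both are local. What
commutes with every `1 ⊗ F` commutes with `1 ⊗ S` by ultraweak closure, hence with the generators `m
⊗ s`. -/
theorem mem_centralizer_locallyCommuting (M : VonNeumannAlgebra H) (S : VonNeumannAlgebra K)
    {𝓕 : Set (StarSubalgebra ℂ (K →L[ℂ] K))} (hne : 𝓕.Nonempty) (hdir : DirectedOn (· ≤ ·) 𝓕)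
    (hcl : @closure _ (ultraweakTopology K) (⋃ F ∈ 𝓕, (F : Set (K →L[ℂ] K))) =
      (S : Set (K →L[ℂ] K)))
    {x : HilbertTensor H K →L[ℂ] HilbertTensor H K} (hx : x ∈ vonNeumannTensor M S) :
    x ∈ Set.centralizer (Set.centralizer
      (locallyCommuting (vonNeumannTensor M S) S (oneTensorHom H K) 𝓕 hne hdir :
        Set (HilbertTensor H K →L[ℂ] HilbertTensor H K))) := by
  intro y hy
  have hmem : ∀ m ∈ M, ∀ s ∈ S, opTensor m s ∈ vonNeumannTensor M S := fun m hm s hs =>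
    subset_generatedVonNeumannAlgebra _ ⟨m, hm, s, hs, rfl⟩
  have hM : ∀ m ∈ M, y * opTensor m 1 = opTensor m 1 * y := fun m hm =>
    (hy _ ⟨hmem m hm 1 (one_mem S), hne.some, hne.some_mem, fun t _ => by
      rw [oneTensorHom_apply, ← opTensor_mul, ← opTensor_mul, one_mul, mul_one, one_mul,
        mul_one]⟩).symm
  have hF : (⋃ F ∈ 𝓕, (F : Set (K →L[ℂ] K))) ⊆
      {s : K →L[ℂ] K | y * oneTensorHom H K s = oneTensorHom H K s * y} := by
    intro f hf
    obtain ⟨F, hF, hfF⟩ := Set.mem_iUnion₂.1 hf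
    have hfS : f ∈ S := by
      change f ∈ (S : Set (K →L[ℂ] K))
      rw [← hcl]
      exact @subset_closure _ (ultraweakTopology K) _ _ hf
    refine (hy _ ⟨hmem 1 (one_mem M) f hfS, F, hF, fun t ht => ?_⟩).symm
    rw [← oneTensorHom_apply, ← map_mul, ← map_mul,
      (VonNeumannAlgebra.mem_relativeCommutant.1 ht).2 f hfF]
  have hS : ∀ s ∈ S, y * oneTensorHom H K s = oneTensorHom H K s * y := by
    intro s hs
    have h := @closure_minimal _ (ultraweakTopology K) _ _ hF (isClosed_commute_oneTensorHom y)
    rw [hcl] at h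
    exact h hs
  have hgen : ∀ m ∈ M, ∀ s ∈ S, opTensor m s * y = y * opTensor m s := by
    intro m hm s hs
    have e : opTensor m s = opTensor m 1 * oneTensorHom H K s := by
      rw [oneTensorHom_apply, ← opTensor_mul, mul_one, one_mul]
    rw [e, mul_assoc, ← hS s hs, ← mul_assoc, ← hM m hm, mul_assoc]
  have hy' : y ∈ StarSubalgebra.centralizer ℂ {x | ∃ m ∈ M, ∃ s ∈ S, x = opTensor m s} := by
    rw [StarSubalgebra.mem_centralizer_iff]
    rintro _ ⟨m, hm, s, hs, rfl⟩
    exact ⟨hgen m hm s hs, by rw [star_opTensor]; exact hgen _ (star_mem hm) _ (star_mem hs)⟩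
  have hx' : x ∈ StarSubalgebra.centralizer ℂ (StarSubalgebra.centralizer ℂ
    {x | ∃ m ∈ M, ∃ s ∈ S, x = opTensor m s} :
      Set (HilbertTensor H K →L[ℂ] HilbertTensor H K)) := hx
  exact ((StarSubalgebra.mem_centralizer_iff ℂ).1 hx' y hy').1

end TensorGeneration

theorem lemma2p1 {H K : Type*}
    [NormedAddCommGroup H] [InnerProductSpace ℂ H] [CompleteSpace H]
    [NormedAddCommGroup K] [InnerProductSpace ℂ K] [CompleteSpace K]
    (M : VonNeumannAlgebra H) (S : VonNeumannAlgebra K)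
    (hS : IsHyperfinite S) (hS' : HasNoFiniteTypeISummand S)
    (φ : (vonNeumannTensor M S).toStarSubalgebra →L[ℂ]
      (HilbertTensor H K →L[ℂ] HilbertTensor H K))
    (hnormal : IsNormalMap φ) (hmod : IsModularMap φ) :
    IsCompletelyBounded φ := by
  obtain ⟨𝓕, hne, hdir, hfin, hcl⟩ := hS
  have hmod' : IsBimoduleMap S (oneTensorHom H K) φ := fun s hs =>
    ⟨(oneTensor M s hs).2, hmod s hs⟩
  refine hmod'.isCompletelyBounded hnormal hS' hne hdir hfin (fun F hF f hf => ?_) fun x hx =>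
    mem_centralizer_locallyCommuting M S hne hdir hcl hx
  change f ∈ (S : Set (K →L[ℂ] K))
  rw [← hcl]
  exact @subset_closure _ (ultraweakTopology K) _ _ (Set.mem_biUnion hF hf)
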